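/- Let $(B,\tau)$ be a von Neumann algebra with a faithful normal tracial state, let $\Lambda$ be a group and let $\Lambda\curvearrowright(B,\tau)$ be a trace preserving action. Put $M=B\rtimes\Lambda$, with canonical unitaries $(v_s)_{s\in\Lambda}$ and canonical trace $\tau$, and write $\|x\|_2=\tau(x^*x)^{1/2}$. Let $\Delta: M\to M\bar\otimes M$ be the dual coaction, i.e. the normal $*$-homomorphism with $\Delta(bv_s)=bv_s\otimes v_s$ for all $b\in B$, $s\in\Lambda$. Let $\mathcal{G}$ be a family of subgroups of $\Lambda$; a subset $F\subset\Lambda$ is called small relative to $\mathcal{G}$ if it is contained in a finite union of sets of the form $g\Sigma h$ with $g,h\in\Lambda$ and $\Sigma\in\mathcal{G}$. For von Neumann subalgebras $A,N$ of a tracial von Neumann algebra $\mathcal{M}$ (with the same unit), $A\prec_{\mathcal{M}}N$ means that there is a nonzero closed $A$-$N$-subbimodule of $L^2(\mathcal{M})$ that has finite right $N$-dimension (with respect to the trace). Let $P,Q\subset M$ be von Neumann subalgebras (with the same unit as $M$) such that 1. $\Delta(P)\prec_{M\bar\otimes M}M\bar\otimes Q$, 2. $P\not\prec_M B\rtimes\Sigma$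 for all $\Sigma\in\mathcal{G}$. Then there exist finitely many elements $x_1,\dots,x_n\in M$ and a $\delta>0$ such that for every $F\subset\Lambda$ that is small relative to $\mathcal{G}$ there is an element $s\in\Lambda\setminus F$ with $$\sum_{i,k=1}^n\|E_Q(x_iv_sx_k^*)\|_2^2\ge\delta,$$ where $E_Q:M\to Q$ is the trace preserving conditional expectation. -/

import Mathlib

open scoped TensorProduct InnerProductSpace ENNReal

noncomputable section

set_option linter.unusedSectionVars false

namespace TransferRigidity

/-! ### Tracial von Neumann algebras in standard form

A tracial von Neumann algebra `(M, τ)` is represented in its standard representation on `L²(M, τ)`: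
it is a von Neumann algebra on a Hilbert space `H` together with a unit vector `Ω` (the image of
`1` in `L²(M, τ)`) that is cyclic for `M` and implements the trace, `τ(x) = ⟪Ω, x Ω⟫`.
Then `H = L²(M, τ)`, the vector `x Ω` is the image of `x ∈ M` in `L²(M, τ)`, and `‖x‖₂ = ‖x Ω‖`.
Since `Ω` is cyclic and `τ` is tracial, `Ω` is separating, so that `τ` is a faithful normal trace;
conversely the GNS representation puts every tracial von Neumann algebra into this form. -/

section Standard

variable {H : Type*} [NormedAddCommGroup H] [InnerProductSpace ℂ H] [CompleteSpace H]

/-- The unit vector `Ω` is cyclic for `M` and `x ↦ ⟪Ω, x Ω⟫` is a trace on `M`. -/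
structure IsTraceVector (M : VonNeumannAlgebra H) (Ω : H) : Prop where
  norm_eq_one : ‖Ω‖ = 1
  trace : ∀ x ∈ M, ∀ y ∈ M, ⟪Ω, (x * y) Ω⟫_ℂ = ⟪Ω, (y * x) Ω⟫_ℂ
  cyclic : Dense {ξ : H | ∃ x ∈ M, x Ω = ξ}

/-- The von Neumann algebra `(S ∪ S*)''` generated by a set of operators. -/
def vnGen (S : Set (H →L[ℂ] H)) : VonNeumannAlgebra H where
  toStarSubalgebra := StarSubalgebra.centralizer ℂ
    (StarSubalgebra.centralizer ℂ S : Set (H →L[ℂ] H))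
  centralizer_centralizer' := by simp

theorem subset_vnGen (S : Set (H →L[ℂ] H)) : S ⊆ vnGen S := by
  intro x hx
  have key : ∀ g ∈ StarSubalgebra.centralizer ℂ S, g * x = x * g := fun g hg =>
    ((StarSubalgebra.mem_centralizer_iff ℂ).1 hg x hx).1.symm
  exact (StarSubalgebra.mem_centralizer_iff ℂ).2 fun g hg => ⟨key g hg, key _ (star_mem hg)⟩

/-- The subspace `L²(Q) ⊆ L²(M)`, the closure of `Q Ω`. -/
def L2 (Q : VonNeumannAlgebra H) (Ω : H) : Submodule ℂ H :=
  (Q.toStarSubalgebra.toSubalgebra.toSubmodule.map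
    (ContinuousLinearMap.apply ℂ H Ω).toLinearMap).topologicalClosure

instance (Q : VonNeumannAlgebra H) (Ω : H) : CompleteSpace (L2 Q Ω) := by
  unfold L2; infer_instance

theorem omega_mem_L2 (Q : VonNeumannAlgebra H) (Ω : H) : Ω ∈ L2 Q Ω :=
  Submodule.le_topologicalClosure _ ⟨1, one_mem Q.toStarSubalgebra, rfl⟩

/-- The trace preserving conditional expectation `E_Q : M → Q`, with values regarded in
`L²(Q) ⊇ Q`: it is the restriction to `M` of the orthogonal projection of `L²(M)` onto `L²(Q)`.
Hence `‖condExp Q Ω x‖` is the `2`-norm `‖E_Q(x)‖₂`. -/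
def condExp (Q : VonNeumannAlgebra H) (Ω : H) (x : H →L[ℂ] H) : H :=
  (L2 Q Ω).starProjection (x Ω)

/-- Right multiplication by `y ∈ M` on `L²(M)`: the bounded operator with `x Ω ↦ x y Ω`
for `x ∈ M`. -/
def rightMul (M : VonNeumannAlgebra H) (Ω : H) (y : H →L[ℂ] H) : H →L[ℂ] H :=
  LinearMap.extendOfNorm
    ((ContinuousLinearMap.apply ℂ H (y Ω)).toLinearMap ∘ₗ
      M.toStarSubalgebra.toSubalgebra.toSubmodule.subtype)
    ((ContinuousLinearMap.apply ℂ H Ω).toLinearMap ∘ₗ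
      M.toStarSubalgebra.toSubalgebra.toSubmodule.subtype)

theorem rightMul_apply {M : VonNeumannAlgebra H} {Ω : H} (h : IsTraceVector M Ω)
    {x y : H →L[ℂ] H} (hx : x ∈ M) (hy : y ∈ M) : rightMul M Ω y (x Ω) = x (y Ω) := by
  have nrm : ∀ z : H →L[ℂ] H, ((‖z Ω‖ ^ 2 : ℝ) : ℂ) = ⟪Ω, (star z * z) Ω⟫_ℂ := fun z => by
    rw [mul_apply_eq_comp, ContinuousLinearMap.star_eq_adjoint,
      ContinuousLinearMap.adjoint_inner_right, inner_self_eq_norm_sq_to_K]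
    simp
  have flip : ∀ z ∈ M, ‖(star z) Ω‖ = ‖z Ω‖ := fun z hz => by
    have : ((‖(star z) Ω‖ ^ 2 : ℝ) : ℂ) = ((‖z Ω‖ ^ 2 : ℝ) : ℂ) := by
      rw [nrm, nrm, star_star, h.trace z hz _ (star_mem hz)]
    have h2 : ‖(star z) Ω‖ ^ 2 = ‖z Ω‖ ^ 2 := by exact_mod_cast this
    exact (sq_eq_sq₀ (norm_nonneg _) (norm_nonneg _)).1 h2
  have bound : ∀ z ∈ M, ‖z (y Ω)‖ ≤ ‖star y‖ * ‖z Ω‖ := fun z hz => by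
    have e : ‖z (y Ω)‖ = ‖(star y) ((star z) Ω)‖ := by
      have := flip (z * y) (mul_mem hz hy)
      rw [star_mul] at this
      exact this.symm
    rw [e, ← flip z hz]
    exact ContinuousLinearMap.le_opNorm _ _
  refine LinearMap.extendOfNorm_eq (f := (ContinuousLinearMap.apply ℂ H (y Ω)).toLinearMap ∘ₗ
      M.toStarSubalgebra.toSubalgebra.toSubmodule.subtype)
    (e := (ContinuousLinearMap.apply ℂ H Ω).toLinearMap ∘ₗ
      M.toStarSubalgebra.toSubalgebra.toSubmodule.subtype) ?_ ⟨‖star y‖, fun z => bound z.1 z.2⟩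
      ⟨x, hx⟩
  refine h.cyclic.mono ?_
  rintro _ ⟨z, hz, rfl⟩
  exact ⟨⟨z, hz⟩, rfl⟩

/-- A right `Q`-submodule `K` of `L²(M)` has finite right `Q`-dimension: it is isomorphic, as a
right `Q`-module, to `p (ℓ²(ℕ) ⊗ L²(Q))` for a projection `p` in `B(ℓ²(ℕ)) ⊗ Q` with
`(Tr ⊗ τ)(p) < ∞`. Here `ℓ²(ℕ) ⊗ L²(Q)` is realized as `ℓ²(ℕ; L²(Q))`, the isomorphism is given by
a right `Q`-linear isometry `V`, `p` is the projection onto the range of `V` (which belongs to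
`B(ℓ²(ℕ)) ⊗ Q` because it commutes with the right action of `Q`), and
`(Tr ⊗ τ)(p) = ∑ₙ ⟪δₙ ⊗ Ω, p (δₙ ⊗ Ω)⟫ = ∑ₙ ‖p (δₙ ⊗ Ω)‖²`. Countably many coordinates are enough,
as a coordinate `n` with `p (δₙ ⊗ Ω) = 0` can be dropped. -/
def HasFiniteRightDim (M : VonNeumannAlgebra H) (Ω : H) (Q : VonNeumannAlgebra H)
    (K : Submodule ℂ H) : Prop :=
  ∃ V : K →ₗᵢ[ℂ] lp (fun _ : ℕ => L2 Q Ω) 2,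
    (∀ y ∈ Q, ∀ ξ η : K, (η : H) = rightMul M Ω y ξ →
      ∀ n, ((V η : ∀ _ : ℕ, L2 Q Ω) n : H) =
        rightMul M Ω y ((V ξ : ∀ _ : ℕ, L2 Q Ω) n : H)) ∧
    Summable fun n : ℕ =>
      ‖(LinearMap.range V.toLinearMap).topologicalClosure.starProjection
        (lp.single 2 n (⟨Ω, omega_mem_L2 Q Ω⟩ : L2 Q Ω))‖ ^ 2

/-- Popa's intertwining `P ≺_M Q` for unital subalgebras `P, Q` of `M`: there is a nonzero (closed)
`P`-`Q`-subbimodule of `L²(M)` that has finite right `Q`-dimension. -/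
def Intertwines (M : VonNeumannAlgebra H) (Ω : H) (P : StarSubalgebra ℂ (H →L[ℂ] H))
    (Q : VonNeumannAlgebra H) : Prop :=
  ∃ K : Submodule ℂ H, IsClosed (K : Set H) ∧ K ≠ ⊥ ∧
    (∀ x ∈ P, ∀ ξ ∈ K, x ξ ∈ K) ∧
    (∀ y ∈ Q, ∀ ξ ∈ K, rightMul M Ω y ξ ∈ K) ∧
    HasFiniteRightDim M Ω Q K

end Standard

/-! ### Tensor products -/

section Tensor

variable {H₁ H₂ : Type*} [NormedAddCommGroup H₁] [InnerProductSpace ℂ H₁] [CompleteSpace H₁]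
  [NormedAddCommGroup H₂] [InnerProductSpace ℂ H₂] [CompleteSpace H₂]

/-- The tensor product of two Hilbert spaces. -/
abbrev HTensor (H₁ H₂ : Type*) [NormedAddCommGroup H₁] [InnerProductSpace ℂ H₁]
    [NormedAddCommGroup H₂] [InnerProductSpace ℂ H₂] : Type _ :=
  UniformSpace.Completion (H₁ ⊗[ℂ] H₂)

/-- The elementary tensor `ξ ⊗ η` in the tensor product of Hilbert spaces. -/
def vtmul (ξ : H₁) (η : H₂) : HTensor H₁ H₂ := ((ξ ⊗ₜ[ℂ] η : H₁ ⊗[ℂ] H₂) : HTensor H₁ H₂)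

/-- The bounded operator `x ⊗ y` with `(x ⊗ y)(ξ ⊗ η) = x ξ ⊗ y η`. -/
def otmul (x : H₁ →L[ℂ] H₁) (y : H₂ →L[ℂ] H₂) : HTensor H₁ H₂ →L[ℂ] HTensor H₁ H₂ :=
  (TensorProduct.mapL x y).completion

/-- The von Neumann algebra tensor product. If `Ω₁` and `Ω₂` are the trace vectors of `M` and `N`,
then `Ω₁ ⊗ Ω₂` is the trace vector for the trace `τ ⊗ τ` on `M ⊗ N`. -/
def vnTensor (M : VonNeumannAlgebra H₁) (N : VonNeumannAlgebra H₂) :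
    VonNeumannAlgebra (HTensor H₁ H₂) :=
  vnGen {T | ∃ x ∈ M, ∃ y ∈ N, T = otmul x y}


theorem otmul_vtmul (x : H₁ →L[ℂ] H₁) (y : H₂ →L[ℂ] H₂) (ξ : H₁) (η : H₂) :
    otmul x y (vtmul ξ η) = vtmul (x ξ) (y η) := by
  simp [otmul, vtmul]

theorem inner_vtmul (ξ ξ' : H₁) (η η' : H₂) :
    ⟪vtmul ξ η, vtmul ξ' η'⟫_ℂ = ⟪ξ, ξ'⟫_ℂ * ⟪η, η'⟫_ℂ := by
  simp [vtmul]

theorem dense_span_vtmul :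
    Dense (Submodule.span ℂ {ζ : HTensor H₁ H₂ | ∃ ξ η, ζ = vtmul ξ η} : Set (HTensor H₁ H₂)) := by
  refine (UniformSpace.Completion.denseRange_coe (α := H₁ ⊗[ℂ] H₂)).mono ?_
  rintro _ ⟨z, rfl⟩
  induction z using TensorProduct.induction_on with
  | zero =>
    rw [UniformSpace.Completion.coe_zero]
    exact Submodule.zero_mem _
  | tmul ξ η => exact Submodule.subset_span ⟨ξ, η, rfl⟩
  | add a b ha hb =>
    rw [UniformSpace.Completion.coe_add]
    exact Submodule.add_mem _ ha hb

theorem vtmul_add_left (ξ ξ' : H₁) (η : H₂) : vtmul (ξ + ξ') η = vtmul ξ η + vtmul ξ' η := by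
  simp only [vtmul, TensorProduct.add_tmul, UniformSpace.Completion.coe_add]

theorem vtmul_smul_left (c : ℂ) (ξ : H₁) (η : H₂) : vtmul (c • ξ) η = c • vtmul ξ η := by
  simp [vtmul, ← TensorProduct.smul_tmul']

theorem ext_vtmul {E : Type*} [NormedAddCommGroup E] [NormedSpace ℂ E]
    {S T : HTensor H₁ H₂ →L[ℂ] E} (h : ∀ ξ η, S (vtmul ξ η) = T (vtmul ξ η)) : S = T := by
  refine ContinuousLinearMap.ext_on
    (s := {ζ : HTensor H₁ H₂ | ∃ ξ η, ζ = vtmul ξ η}) dense_span_vtmul ?_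
  rintro _ ⟨ξ, η, rfl⟩
  exact h ξ η

theorem star_otmul (x : H₁ →L[ℂ] H₁) (y : H₂ →L[ℂ] H₂) :
    star (otmul x y) = otmul (star x) (star y) := by
  refine ext_vtmul fun ξ η => ?_
  refine ext_inner_left ℂ fun ζ => ?_
  have key : (innerSL ℂ (star (otmul x y) (vtmul ξ η))) =
      innerSL ℂ (otmul (star x) (star y) (vtmul ξ η)) := by
    refine ext_vtmul fun ξ' η' => ?_
    simp only [innerSL_apply_apply, ContinuousLinearMap.star_eq_adjoint,
      ContinuousLinearMap.adjoint_inner_left, otmul_vtmul, inner_vtmul]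
  have := congrArg (fun f => star (f ζ)) key
  simpa using this

variable (H₁ H₂) in
/-- The amplification `x ↦ x ⊗ 1`. -/
def ampl : (H₁ →L[ℂ] H₁) →⋆ₐ[ℂ] (HTensor H₁ H₂ →L[ℂ] HTensor H₁ H₂) where
  toFun x := otmul x 1
  map_one' := ext_vtmul fun ξ η => by simp [otmul_vtmul]
  map_mul' x y := ext_vtmul fun ξ η => by simp [otmul_vtmul]
  map_zero' := ext_vtmul fun ξ η => by
    rw [otmul_vtmul]; simp [vtmul]
  map_add' x y := ext_vtmul fun ξ η => by
    simp [otmul_vtmul, vtmul_add_left]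
  commutes' c := ext_vtmul fun ξ η => by
    simp [otmul_vtmul, vtmul_smul_left, Algebra.algebraMap_eq_smul_one]
  map_star' x := by rw [star_otmul, star_one]

/-- The isometry `f ⊗ g` for isometries `f` and `g`. -/
def isoTmul {H₃ H₄ : Type*} [NormedAddCommGroup H₃] [InnerProductSpace ℂ H₃]
    [NormedAddCommGroup H₄] [InnerProductSpace ℂ H₄] (f : H₁ →ₗᵢ[ℂ] H₃) (g : H₂ →ₗᵢ[ℂ] H₄) :
    HTensor H₁ H₂ →ₗᵢ[ℂ] HTensor H₃ H₄ where
  toLinearMap := (TensorProduct.mapIsometry f g).toContinuousLinearMap.completion.toLinearMap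
  norm_map' ζ := by
    induction ζ using UniformSpace.Completion.induction_on with
    | hp =>
      exact isClosed_eq ((ContinuousLinearMap.continuous _).norm) continuous_norm
    | ih z => simp

theorem isoTmul_vtmul {H₃ H₄ : Type*} [NormedAddCommGroup H₃] [InnerProductSpace ℂ H₃]
    [NormedAddCommGroup H₄] [InnerProductSpace ℂ H₄] (f : H₁ →ₗᵢ[ℂ] H₃) (g : H₂ →ₗᵢ[ℂ] H₄)
    (ξ : H₁) (η : H₂) : isoTmul f g (vtmul ξ η) = vtmul (f ξ) (g η) := by
  change (TensorProduct.mapIsometry f g).toContinuousLinearMap.completion (vtmul ξ η) = _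
  simp [vtmul]

end Tensor

/-! ### Crossed products and the dual coaction -/

section CrossedProduct

variable {H : Type*} [NormedAddCommGroup H] [InnerProductSpace ℂ H] [CompleteSpace H]
  {Λ : Type*} [Group Λ]

theorem two_toReal_pos : 0 < (2 : ℝ≥0∞).toReal := by simp

/-- The Hilbert space `ℓ²(Λ; H) = ℓ²(Λ) ⊗ H`. -/
abbrev Ell2 (Λ H : Type*) [NormedAddCommGroup H] : Type _ := lp (fun _ : Λ => H) 2

open Classical in
theorem norm_single2 (t : Λ) (ξ : H) : ‖(lp.single 2 t ξ : Ell2 Λ H)‖ = ‖ξ‖ :=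
  lp.norm_single (E := fun _ : Λ => H) (p := 2) two_pos t ξ
open Classical in
/-- The isometry `ξ ↦ δ_t ⊗ ξ` from `H` to `ℓ²(Λ; H)`. -/
def delta (t : Λ) : H →ₗᵢ[ℂ] Ell2 Λ H where
  toFun := fun ξ => lp.single 2 t ξ
  map_add' ξ η := lp.single_add (E := fun _ : Λ => H) 2 t ξ η
  map_smul' c ξ := lp.single_smul (E := fun _ : Λ => H) (𝕜 := ℂ) 2 t c ξ
  norm_map' := norm_single2 t

open Classical in
theorem delta_apply (t s : Λ) (ξ : H) : (delta t ξ : ∀ _ : Λ, H) s = if s = t then ξ else 0 := by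
  change (lp.single 2 t ξ : ∀ _ : Λ, H) s = _
  by_cases h : s = t
  · subst h; simp
  · simp [h]

theorem norm_automorphism {B : VonNeumannAlgebra H}
    (φ : B.toStarSubalgebra ≃⋆ₐ[ℂ] B.toStarSubalgebra) (b : B.toStarSubalgebra) :
    ‖((φ b : B.toStarSubalgebra) : H →L[ℂ] H)‖ = ‖(b : H →L[ℂ] H)‖ := by
  have hcl : IsClosed (B.toStarSubalgebra : Set (H →L[ℂ] H)) := by
    rw [VonNeumannAlgebra.coe_toStarSubalgebra, ← B.centralizer_centralizer]
    exact Set.isClosed_centralizer _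
  have : IsClosed (B.toStarSubalgebra : Set (H →L[ℂ] H)) := hcl
  exact StarAlgEquiv.norm_map φ b

/-- The diagonal operator `(x ξ)(t) = x_t ξ(t)` on `ℓ²(Λ; H)` for a bounded family `x`. -/
def diagOp (x : Λ → H →L[ℂ] H) (C : ℝ) (hx : ∀ t, ‖x t‖ ≤ C) : Ell2 Λ H →L[ℂ] Ell2 Λ H :=
  LinearMap.mkContinuous
    { toFun := fun ξ => ⟨fun t => x t (ξ t),
        ((lp.memℓp ξ).norm.const_mul C).mono fun t => (x t).le_of_opNorm_le (hx t) _⟩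
      map_add' := fun ξ η => by ext t; exact map_add (x t) _ _
      map_smul' := fun c ξ => by ext t; exact map_smul (x t) c _ } C fun ξ => by
    have hC : 0 ≤ C := (norm_nonneg _).trans (hx 1)
    have h : ‖((C : ℂ) • ξ : Ell2 Λ H)‖ = C * ‖ξ‖ := by
      rw [norm_smul, Complex.norm_real, Real.norm_of_nonneg hC]
    rw [← h]
    refine lp.norm_mono two_ne_zero fun t => ?_
    have h' : ‖((C : ℂ) • ξ : Ell2 Λ H) t‖ = C * ‖ξ t‖ := by
      rw [lp.coeFn_smul, Pi.smul_apply, norm_smul, Complex.norm_real, Real.norm_of_nonneg hC]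
    rw [h']
    exact (x t).le_of_opNorm_le (hx t) _

/-- The copy of `b ∈ B` in the crossed product: `(b ξ)(t) = σ_{t⁻¹}(b) ξ(t)`. -/
def piB {B : VonNeumannAlgebra H} (σ : Λ →* (B.toStarSubalgebra ≃⋆ₐ[ℂ] B.toStarSubalgebra))
    (b : B.toStarSubalgebra) : Ell2 Λ H →L[ℂ] Ell2 Λ H :=
  diagOp (fun t => (σ t⁻¹ b : B.toStarSubalgebra)) ‖(b : H →L[ℂ] H)‖
    fun t => (norm_automorphism (σ t⁻¹) b).le

/-- The translate `t ↦ ξ(s t)` of `ξ`. -/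
def shiftFun (s : Λ) (ξ : Ell2 Λ H) : Ell2 Λ H :=
  ⟨fun t => ξ (s * t), by
    have h := (memℓp_gen_iff (E := fun _ : Λ => H) two_toReal_pos).1 (lp.memℓp ξ)
    exact (memℓp_gen_iff (E := fun _ : Λ => H) two_toReal_pos).2
      ((Equiv.mulLeft s).summable_iff.2 h)⟩

theorem shiftFun_apply (s : Λ) (ξ : Ell2 Λ H) (t : Λ) :
  (shiftFun s ξ : ∀ _ : Λ, H) t = ξ (s * t) := rfl

theorem shiftFun_shiftFun (s r : Λ) (ξ : Ell2 Λ H) :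
    shiftFun s (shiftFun r ξ) = shiftFun (r * s) ξ := by
  ext t
  simp only [shiftFun_apply, mul_assoc]

theorem shiftFun_one (ξ : Ell2 Λ H) : shiftFun 1 ξ = ξ := by
  ext t
  simp only [shiftFun_apply, one_mul]

theorem norm_shiftFun (s : Λ) (ξ : Ell2 Λ H) : ‖shiftFun s ξ‖ = ‖ξ‖ := by
  rw [lp.norm_eq_tsum_rpow two_toReal_pos, lp.norm_eq_tsum_rpow two_toReal_pos]
  congr 1
  exact (Equiv.mulLeft s).tsum_eq fun t => ‖ξ t‖ ^ (2 : ℝ≥0∞).toReal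

/-- Translation `(v_s ξ)(t) = ξ(s⁻¹ t)` as a unitary from `ℓ²(Λ; H)` to itself. -/
def shift (s : Λ) : Ell2 Λ H ≃ₗᵢ[ℂ] Ell2 Λ H where
  toFun ξ := shiftFun s⁻¹ ξ
  invFun ξ := shiftFun s ξ
  map_add' ξ η := rfl
  map_smul' c ξ := rfl
  left_inv ξ := by
    change shiftFun s (shiftFun s⁻¹ ξ) = ξ
    rw [shiftFun_shiftFun, inv_mul_cancel, shiftFun_one]
  right_inv ξ := by
    change shiftFun s⁻¹ (shiftFun s ξ) = ξ
    rw [shiftFun_shiftFun, mul_inv_cancel, shiftFun_one]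
  norm_map' ξ := norm_shiftFun _ _

variable (H) in
/-- The canonical unitary `v_s`, `(v_s ξ)(t) = ξ(s⁻¹ t)`. -/
def vOp (s : Λ) : Ell2 Λ H →L[ℂ] Ell2 Λ H :=
  (shift s).toLinearIsometry.toContinuousLinearMap

theorem piB_delta {B : VonNeumannAlgebra H}
    (σ : Λ →* (B.toStarSubalgebra ≃⋆ₐ[ℂ] B.toStarSubalgebra)) (b : B.toStarSubalgebra) (t : Λ)
    (ξ : H) : piB σ b (delta t ξ) = delta t (((σ t⁻¹ b : B.toStarSubalgebra) : H →L[ℂ] H) ξ) := by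
  ext r
  change ((σ r⁻¹ b : B.toStarSubalgebra) : H →L[ℂ] H) ((delta t ξ : ∀ _ : Λ, H) r) = _
  rw [delta_apply, delta_apply]
  split_ifs with h
  · rw [h]
  · simp

theorem vOp_delta (s t : Λ) (ξ : H) : vOp H s (delta t ξ) = delta (s * t) ξ := by
  ext r
  change (delta t ξ : ∀ _ : Λ, H) (s⁻¹ * r) = _
  rw [delta_apply, delta_apply]
  by_cases h : r = s * t
  · rw [if_pos h, if_pos (by rw [h, inv_mul_cancel_left])]
  · rw [if_neg h, if_neg fun h' => h (by rw [← h', mul_inv_cancel_left])]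

/-- The von Neumann algebra `B ⋊ Σ ⊆ B ⋊ Λ` generated by `B` and `v_s`, `s ∈ Σ`, for a subgroup
`Σ` of `Λ`. All of them act on `ℓ²(Λ; H)`, with trace vector `δ_1 ⊗ Ω`. -/
def crossed {B : VonNeumannAlgebra H} (σ : Λ →* (B.toStarSubalgebra ≃⋆ₐ[ℂ] B.toStarSubalgebra))
    (S : Subgroup Λ) : VonNeumannAlgebra (Ell2 Λ H) :=
  vnGen (Set.range (piB σ) ∪ vOp H '' S)

/-- `ℓ²(Λ; H) ⊗ K` is the Hilbert sum of the subspaces `δ_t ⊗ H ⊗ K`, each of them identified with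
`H ⊗ K` by means of a unitary `u_t` on `K`. -/
theorem isHilbertSum_delta {K : Type*} [NormedAddCommGroup K] [InnerProductSpace ℂ K]
    [CompleteSpace K] (u : Λ → (K ≃ₗᵢ[ℂ] K)) :
    IsHilbertSum ℂ (fun _ : Λ => HTensor H K)
      fun t => isoTmul (delta (H := H) t) (u t).toLinearIsometry := by
  classical
  refine IsHilbertSum.mk ?_ ?_
  · intro s t hst ζ ζ'
    have h1 : ∀ ξ η, (innerSL ℂ ((isoTmul (delta (H := H) s) (u s).toLinearIsometry)
        (vtmul ξ η))).comp
        (isoTmul (delta (H := H) t) (u t).toLinearIsometry).toContinuousLinearMap = 0 := by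
      intro ξ η
      refine ext_vtmul fun ξ' η' => ?_
      have h0 : ⟪(delta s ξ : Ell2 Λ H), delta t ξ'⟫_ℂ = 0 := by
        rw [lp.inner_eq_tsum]
        refine (tsum_congr fun r => ?_).trans tsum_zero
        rw [delta_apply, delta_apply]
        by_cases h : r = s
        · simp [h, hst]
        · simp [h]
      change ⟪isoTmul (delta (H := H) s) (u s).toLinearIsometry (vtmul ξ η),
        isoTmul (delta (H := H) t) (u t).toLinearIsometry (vtmul ξ' η')⟫_ℂ = 0
      rw [isoTmul_vtmul, isoTmul_vtmul, inner_vtmul, h0, zero_mul]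
    have h2 : (innerSL ℂ ((isoTmul (delta (H := H) t) (u t).toLinearIsometry) ζ')).comp
        (isoTmul (delta (H := H) s) (u s).toLinearIsometry).toContinuousLinearMap = 0 := by
      refine ext_vtmul fun ξ η => ?_
      have := DFunLike.congr_fun (h1 ξ η) ζ'
      change ⟪isoTmul (delta (H := H) t) (u t).toLinearIsometry ζ',
        isoTmul (delta (H := H) s) (u s).toLinearIsometry (vtmul ξ η)⟫_ℂ = 0
      rw [← inner_conj_symm]
      have h3 : ⟪isoTmul (delta (H := H) s) (u s).toLinearIsometry (vtmul ξ η),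
        isoTmul (delta (H := H) t) (u t).toLinearIsometry ζ'⟫_ℂ = 0 := this
      rw [h3, map_zero]
    have h4 : ⟪isoTmul (delta (H := H) t) (u t).toLinearIsometry ζ',
        isoTmul (delta (H := H) s) (u s).toLinearIsometry ζ⟫_ℂ = 0 := DFunLike.congr_fun h2 ζ
    rw [← inner_conj_symm, h4, map_zero]
  · set R := (⨆ t, LinearMap.range (isoTmul (delta (H := H) t)
      (u t).toLinearIsometry).toLinearMap).topologicalClosure with hR
    have hcl : IsClosed (R : Set (HTensor (Ell2 Λ H) K)) :=
      Submodule.isClosed_topologicalClosure _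
    have h1 : ∀ (t : Λ) (ξ : H) (η : K), vtmul (delta t ξ) η ∈ R := fun t ξ η => by
      refine Submodule.le_topologicalClosure _ (Submodule.mem_iSup_of_mem t ?_)
      refine ⟨vtmul ξ ((u t).symm η), ?_⟩
      refine (isoTmul_vtmul _ _ _ _).trans ?_
      simp
    have h2 : ∀ (ξ : Ell2 Λ H) (η : K), vtmul ξ η ∈ R := fun ξ η => by
      have hs := lp.hasSum_single (E := fun _ : Λ => H) (p := 2) (by norm_num) ξ
      have hcont : Continuous fun ζ : Ell2 Λ H => (vtmul ζ η : HTensor (Ell2 Λ H) K) :=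
        (UniformSpace.Completion.continuous_coe _).comp
          ((TensorProduct.continuous_tmul (𝕜 := ℂ)).comp (Continuous.prodMk_left η))
      let L : Ell2 Λ H →+ HTensor (Ell2 Λ H) K :=
        { toFun := fun ζ => vtmul ζ η
          map_zero' := by simpa using vtmul_smul_left (0 : ℂ) (0 : Ell2 Λ H) η
          map_add' := fun a b => vtmul_add_left a b η }
      have hs' := hs.map L hcont
      refine hcl.mem_of_tendsto hs' (Filter.Eventually.of_forall fun F => ?_)
      exact Submodule.sum_mem _ fun t _ => h1 t _ η
    intro ζ _
    have h3 : Submodule.span ℂ {ζ : HTensor (Ell2 Λ H) K | ∃ ξ η, ζ = vtmul ξ η} ≤ R := by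
      rw [Submodule.span_le]
      rintro _ ⟨ξ, η, rfl⟩
      exact h2 ξ η
    exact closure_minimal h3 hcl (dense_span_vtmul ζ)

/-- The unitary `W` of `ℓ²(Λ; H) ⊗ ℓ²(Λ; H)` given by
`W ((δ_t ⊗ ξ) ⊗ η) = (δ_t ⊗ ξ) ⊗ v_t η`. -/
def dualUnitary (Λ H : Type*) [NormedAddCommGroup H] [InnerProductSpace ℂ H] [CompleteSpace H]
    [Group Λ] : HTensor (Ell2 Λ H) (Ell2 Λ H) ≃ₗᵢ[ℂ] HTensor (Ell2 Λ H) (Ell2 Λ H) :=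
  (isHilbertSum_delta (H := H) fun _ : Λ =>
      LinearIsometryEquiv.refl ℂ (Ell2 Λ H)).linearIsometryEquiv.trans
    (isHilbertSum_delta (H := H) fun t : Λ => shift (H := H) t).linearIsometryEquiv.symm

theorem dualUnitary_apply (t : Λ) (ξ : H) (η : Ell2 Λ H) :
    dualUnitary Λ H (vtmul (delta t ξ) η) = vtmul (delta t ξ) (vOp H t η) := by
  have h1 : ∀ u : Λ → (Ell2 Λ H ≃ₗᵢ[ℂ] Ell2 Λ H), ∀ η',
      (isHilbertSum_delta (H := H) u).linearIsometryEquiv.symm (by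
        classical exact lp.single 2 t (vtmul ξ η')) = vtmul (delta t ξ) (u t η') := by
    intro u η'
    classical
    refine ((isHilbertSum_delta (H := H) u).linearIsometryEquiv_symm_apply_single _).trans ?_
    exact isoTmul_vtmul _ _ _ _
  have h2 := h1 (fun _ => LinearIsometryEquiv.refl ℂ (Ell2 Λ H)) η
  have h3 := h1 (fun t => shift t) η
  rw [LinearIsometryEquiv.symm_apply_eq] at h2
  rw [dualUnitary, LinearIsometryEquiv.trans_apply]
  refine Eq.trans ?_ h3
  exact congrArg _ h2.symm

/-- The dual coaction `Δ(x) = W (x ⊗ 1) W*`; it is spatially implemented, hence normal, and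
it is determined on `B ⋊ Λ` by `Δ(b) = b ⊗ 1` and `Δ(v_s) = v_s ⊗ v_s`. -/
def dualCoaction (Λ H : Type*) [NormedAddCommGroup H] [InnerProductSpace ℂ H] [CompleteSpace H]
    [Group Λ] : (Ell2 Λ H →L[ℂ] Ell2 Λ H) →⋆ₐ[ℂ]
      (HTensor (Ell2 Λ H) (Ell2 Λ H) →L[ℂ] HTensor (Ell2 Λ H) (Ell2 Λ H)) :=
  (StarAlgEquiv.toStarAlgHom (dualUnitary Λ H).conjStarAlgEquiv).comp (ampl (Ell2 Λ H) (Ell2 Λ H))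

theorem dualCoaction_apply (x : Ell2 Λ H →L[ℂ] Ell2 Λ H) (ζ : HTensor (Ell2 Λ H) (Ell2 Λ H)) :
    dualCoaction Λ H x (dualUnitary Λ H ζ) = dualUnitary Λ H (otmul x 1 ζ) := by
  change dualUnitary Λ H (otmul x 1 ((dualUnitary Λ H).symm (dualUnitary Λ H ζ))) = _
  rw [LinearIsometryEquiv.symm_apply_apply]

/-- An operator on `ℓ²(Λ; H) ⊗ ℓ²(Λ; H)` is determined by its values on `(δ_t ⊗ ξ) ⊗ v_t η`. -/
theorem ext_delta {S T : HTensor (Ell2 Λ H) (Ell2 Λ H) →L[ℂ] HTensor (Ell2 Λ H) (Ell2 Λ H)}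
    (h : ∀ t ξ η, S (vtmul (delta t ξ) (vOp H t η)) = T (vtmul (delta t ξ) (vOp H t η))) :
    S = T := by
  classical
  refine ext_vtmul fun ζ η => ?_
  have hs := lp.hasSum_single (E := fun _ : Λ => H) (p := 2) (by norm_num) ζ
  have hL : ∀ R : HTensor (Ell2 Λ H) (Ell2 Λ H) →L[ℂ] HTensor (Ell2 Λ H) (Ell2 Λ H),
      HasSum (fun t => R (vtmul (delta t (ζ t)) η)) (R (vtmul ζ η)) := fun R => by
    let L : Ell2 Λ H →+ HTensor (Ell2 Λ H) (Ell2 Λ H) :=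
      { toFun := fun ζ => R (vtmul ζ η)
        map_zero' := by
          simpa using congrArg R (vtmul_smul_left (0 : ℂ) (0 : Ell2 Λ H) η)
        map_add' := fun a b => by rw [vtmul_add_left, map_add] }
    have hcont : Continuous L := R.continuous.comp
      ((UniformSpace.Completion.continuous_coe _).comp
        ((TensorProduct.continuous_tmul (𝕜 := ℂ)).comp (Continuous.prodMk_left η)))
    exact hs.map L hcont
  refine (hL S).unique ?_
  convert hL T using 2 with t
  have := h t (ζ t) ((shift t).symm η)
  have h2 : vOp H t ((shift t).symm η) = η := (shift t).apply_symm_apply η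
  rwa [h2] at this

theorem dualCoaction_piB {B : VonNeumannAlgebra H}
    (σ : Λ →* (B.toStarSubalgebra ≃⋆ₐ[ℂ] B.toStarSubalgebra)) (b : B.toStarSubalgebra) :
    dualCoaction Λ H (piB σ b) = otmul (piB σ b) 1 := by
  refine ext_delta fun t ξ η => ?_
  rw [← dualUnitary_apply, dualCoaction_apply, otmul_vtmul, piB_delta, dualUnitary_apply,
    dualUnitary_apply, otmul_vtmul, piB_delta]
  rfl

theorem dualCoaction_vOp (s : Λ) :
    dualCoaction Λ H (vOp H s) = otmul (vOp H s) (vOp H s) := by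
  refine ext_delta fun t ξ η => ?_
  rw [← dualUnitary_apply, dualCoaction_apply, otmul_vtmul, vOp_delta, dualUnitary_apply,
    dualUnitary_apply, otmul_vtmul, vOp_delta]
  congr 1
  ext r
  change (η : ∀ _ : Λ, H) ((s * t)⁻¹ * r) = (η : ∀ _ : Λ, H) (t⁻¹ * (s⁻¹ * r))
  rw [mul_inv_rev, mul_assoc]

/-- `F` is contained in a finite union of sets `g Σ h` with `g, h ∈ Λ` and `Σ ∈ 𝒢`. -/
def SmallRelativeTo (𝒢 : Set (Subgroup Λ)) (F : Set Λ) : Prop :=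
  ∃ T : Finset (Λ × Subgroup Λ × Λ), (∀ p ∈ T, p.2.1 ∈ 𝒢) ∧
    ∀ s ∈ F, ∃ p ∈ T, ∃ k ∈ p.2.1, s = p.1 * k * p.2.2

end CrossedProduct

end TransferRigidity

end

/-!
The proof is by contradiction, and rests on Popa's characterization of intertwining by unitaries.
Write `u = ∑ₛ uₛ vₛ` for the Fourier expansion of `u ∈ M = B ⋊ Λ`; in `L²(M) = ℓ²(Λ; L²(B))` the
coefficient `uₛ` is the coordinate at `s` of the vector `u Ω`, where `Ω` stands for the trace vector
`δ₁ ⊗ Ω` of `M`.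

*Unitaries that avoid small sets* (`exists_unitary_coordProj_lt`). If `P ⊀ B ⋊ S` for all `S ∈ 𝒢`,
then for every small set `F` and `ε > 0` there is a unitary `u ∈ P` with `∑_{s ∈ F} ‖uₛ‖₂² < ε`.
A set `g S h` is, after a right translation, a left coset of `S`, and the projection of `L²(M)` onto
the vectors supported on a left coset commutes with the right action of `B ⋊ S` and has trace `1`
for the semifinite trace on the commutant of that action (`tsum_coset_star`). If all unitaries of
`P` had a uniformly large part on `F`, then the family of these finitely many projections could be
averaged over the unitary group of `P`: the element of minimal `2`-norm in the closed convex hull of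
its orbit is nonzero and commutes with `P` (`exists_invariant_of_finite_trace`). A spectral subspace
of one of its components is a `P`-`(B ⋊ S)`-bimodule of finite dimension
(`intertwines_of_invariant`), which was excluded. Treating all the projections at the same time as
one family gives a single `u` for all of `F`, even if different subgroups are involved.

*Fourier expansion of the coaction* (`hasSum_norm_sq_otmul_dualUnitary`,
`norm_starProjection_dualCoaction_le`). Since `Δ(u) (Ω ⊗ η) = ∑ₛ uₛ ⊗ vₛ η` is an orthogonal sum,
`‖E_{M ⊗ Q}((a ⊗ b) Δ(u) (c ⊗ d))‖₂²` is at most a constant times `∑ₛ ‖uₛ‖₂² ‖E_Q(b vₛ d)‖₂²`.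

If the theorem fails, then for finitely many `b, d ∈ M` the numbers `‖E_Q(b vₛ d)‖₂` are uniformly
small for `s` outside some small set `F`; choosing `u` with `∑_{s ∈ F} ‖uₛ‖₂²` negligible makes the
sum small. This yields a net of unitaries `u ∈ P` with `‖E_{M ⊗ Q}(x* Δ(u) y)‖₂ → 0` for all
elementary tensors `x, y`, which contradicts `Δ(P) ≺ M ⊗ Q`, by the easy half of Popa's theorem
(`Intertwines.not_tendsto_zero`).
-/

noncomputable section

set_option linter.unusedSectionVars false

namespace TransferRigidity

/-! ### Commutants, the trace and right multiplications -/

section Standard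

variable {H : Type*} [NormedAddCommGroup H] [InnerProductSpace ℂ H] [CompleteSpace H]

theorem vnGen_comm {S : Set (H →L[ℂ] H)} {T : H →L[ℂ] H}
    (h : ∀ g ∈ S, g * T = T * g ∧ star g * T = T * star g) {x : H →L[ℂ] H} (hx : x ∈ vnGen S) :
    x * T = T * x :=
  ((StarSubalgebra.mem_centralizer_iff ℂ).1 hx T
    ((StarSubalgebra.mem_centralizer_iff ℂ).2 h)).1.symm

theorem mem_of_comm_commutant {N : VonNeumannAlgebra H} {x : H →L[ℂ] H}
    (h : ∀ T : H →L[ℂ] H, (∀ g ∈ N, g * T = T * g) → x * T = T * x) : x ∈ N := by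
  rw [← N.commutant_commutant, VonNeumannAlgebra.mem_commutant_iff]
  intro T hT
  exact (h T (VonNeumannAlgebra.mem_commutant_iff.1 hT)).symm

theorem vnGen_le {S : Set (H →L[ℂ] H)} {N : VonNeumannAlgebra H} (h : ∀ x ∈ S, x ∈ N) :
    vnGen S ≤ N := fun _ hx =>
  mem_of_comm_commutant fun _ hT =>
    vnGen_comm (fun g hg => ⟨hT g (h g hg), hT _ (star_mem (h g hg))⟩) hx

theorem inner_star_left (x : H →L[ℂ] H) (ξ η : H) : ⟪star x ξ, η⟫_ℂ = ⟪ξ, x η⟫_ℂ := by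
  rw [ContinuousLinearMap.star_eq_adjoint, ContinuousLinearMap.adjoint_inner_left]

theorem inner_star_right (x : H →L[ℂ] H) (ξ η : H) : ⟪ξ, star x η⟫_ℂ = ⟪x ξ, η⟫_ℂ := by
  rw [ContinuousLinearMap.star_eq_adjoint, ContinuousLinearMap.adjoint_inner_right]

theorem comm_apply {x T : H →L[ℂ] H} (h : x * T = T * x) (ξ : H) : x (T ξ) = T (x ξ) :=
  DFunLike.congr_fun h ξ

theorem norm_star_apply {M : VonNeumannAlgebra H} {Ω : H} (h : IsTraceVector M Ω)
    {z : H →L[ℂ] H} (hz : z ∈ M) : ‖star z Ω‖ = ‖z Ω‖ := by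
  have h1 := h.trace z hz _ (star_mem hz)
  simp only [mul_apply_eq_comp] at h1
  rw [inner_star_right, ← inner_star_left, inner_self_eq_norm_sq_to_K,
    inner_self_eq_norm_sq_to_K] at h1
  have h2 : ‖star z Ω‖ ^ 2 = ‖z Ω‖ ^ 2 := by exact_mod_cast h1
  exact (sq_eq_sq₀ (norm_nonneg _) (norm_nonneg _)).1 h2

/-- A vector bounded against a subspace is bounded after projection onto it. -/
theorem norm_starProjection_le_of_inner {K : Submodule ℂ H} [K.HasOrthogonalProjection]
    {S : Set H} (hS : (K : Set H) ⊆ closure S) {ζ : H} {c : ℝ} (hc : 0 ≤ c)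
    (h : ∀ η ∈ S, ‖⟪η, ζ⟫_ℂ‖ ≤ c * ‖η‖) : ‖K.starProjection ζ‖ ≤ c := by
  have hcl : IsClosed {η : H | ‖⟪η, ζ⟫_ℂ‖ ≤ c * ‖η‖} :=
    isClosed_le (by fun_prop) (by fun_prop)
  have h1 : ‖⟪K.starProjection ζ, ζ⟫_ℂ‖ ≤ c * ‖K.starProjection ζ‖ :=
    closure_minimal (s := S) h hcl (hS (K.starProjection_apply_mem ζ))
  have h2 : ⟪K.starProjection ζ, ζ⟫_ℂ = ((‖K.starProjection ζ‖ ^ 2 : ℝ) : ℂ) := by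
    have h3 := K.inner_starProjection_left_eq_right (K.starProjection ζ) ζ
    rw [Submodule.starProjection_eq_self_iff.2 (K.starProjection_apply_mem ζ)] at h3
    rw [h3, inner_self_eq_norm_sq_to_K]
    simp
  rw [h2, Complex.norm_real, Real.norm_of_nonneg (sq_nonneg _), sq] at h1
  rcases (norm_nonneg (K.starProjection ζ)).eq_or_lt with h0 | h0
  · rwa [← h0]
  · exact le_of_mul_le_mul_right h1 h0

theorem norm_le_of_inner_dense {S : Set H} (hS : Dense S) {ζ : H} {c : ℝ} (hc : 0 ≤ c)
    (h : ∀ η ∈ S, ‖⟪η, ζ⟫_ℂ‖ ≤ c * ‖η‖) : ‖ζ‖ ≤ c := by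
  have := norm_starProjection_le_of_inner (K := (⊤ : Submodule ℂ H)) (S := S)
    (fun x _ => hS x) hc h
  rwa [Submodule.starProjection_eq_self_iff.2 Submodule.mem_top] at this

/-- A criterion for `Ω` to be a trace vector: enough vectors `a Ω` with `a ∈ N` can be written as
`R Ω` with `R` in the commutant, compatibly with adjoints. It avoids any density theorem for
the algebra generated by such `a`. -/
theorem IsTraceVector.of_commutant {N : VonNeumannAlgebra H} {Ω : H} (h1 : ‖Ω‖ = 1)
    {S : Set (H →L[ℂ] H)} (hS : ∀ a ∈ S, a ∈ N)
    (hR : ∀ a ∈ S, ∃ R : H →L[ℂ] H, (∀ g ∈ N, g * R = R * g) ∧ R Ω = a Ω ∧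
      star R Ω = star a Ω)
    (hd : Dense (Submodule.span ℂ {ξ : H | ∃ a ∈ S, a Ω = ξ} : Set H)) :
    IsTraceVector N Ω := by
  let D : Submodule ℂ (H →L[ℂ] H) :=
    { carrier := {a | a ∈ N ∧ ∃ R : H →L[ℂ] H, (∀ g ∈ N, g * R = R * g) ∧ R Ω = a Ω ∧
        star R Ω = star a Ω}
      zero_mem' := ⟨zero_mem _, 0, fun g _ => by simp, by simp, by simp⟩
      add_mem' := by
        rintro a b ⟨ha, R, hR, h1, h2⟩ ⟨hb, R', hR', h1', h2'⟩
        refine ⟨add_mem ha hb, R + R', fun g hg => ?_, ?_, ?_⟩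
        · rw [mul_add, add_mul, hR g hg, hR' g hg]
        · simp [h1, h1']
        · simp [h2, h2', star_add]
      smul_mem' := by
        rintro c a ⟨ha, R, hR, h1, h2⟩
        refine ⟨N.toStarSubalgebra.smul_mem ha c, c • R, fun g hg => ?_, ?_, ?_⟩
        · rw [mul_smul_comm, smul_mul_assoc, hR g hg]
        · simp [h1]
        · simp [h2, star_smul] }
  have hSD : ∀ a ∈ S, a ∈ D := fun a ha => ⟨hS a ha, hR a ha⟩
  have hDd : Dense {ξ : H | ∃ a ∈ D, a Ω = ξ} := by
    refine hd.mono ?_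
    have : Submodule.span ℂ {ξ : H | ∃ a ∈ S, a Ω = ξ} ≤
        D.map (ContinuousLinearMap.apply ℂ H Ω).toLinearMap := by
      rw [Submodule.span_le]
      rintro _ ⟨a, ha, rfl⟩
      exact ⟨a, hSD a ha, rfl⟩
    exact fun ξ hξ => this hξ
  have htr : ∀ a ∈ D, ∀ x ∈ N, ⟪Ω, x (a Ω)⟫_ℂ = ⟪Ω, a (x Ω)⟫_ℂ := by
    rintro a ⟨-, R, hR, h1, h2⟩ x hx
    rw [← h1, comm_apply (hR x hx), ← inner_star_left, h2, inner_star_left]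
  have hDn : ∀ a ∈ D, ‖star a Ω‖ = ‖a Ω‖ := by
    intro a ha
    have h3 := htr a ha (star a) (star_mem ha.1)
    rw [inner_star_right, ← inner_star_left a Ω (star a Ω), inner_self_eq_norm_sq_to_K,
      inner_self_eq_norm_sq_to_K] at h3
    have h2 : ‖a Ω‖ ^ 2 = ‖star a Ω‖ ^ 2 := by exact_mod_cast h3
    exact ((sq_eq_sq₀ (norm_nonneg _) (norm_nonneg _)).1 h2).symm
  have hle : ∀ z ∈ N, ‖star z Ω‖ ≤ ‖z Ω‖ := by
    intro z hz
    refine norm_le_of_inner_dense hDd (norm_nonneg _) ?_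
    rintro _ ⟨a, ha, rfl⟩
    have h3 : ⟪a Ω, star z Ω⟫_ℂ = ⟪z Ω, star a Ω⟫_ℂ := by
      rw [← inner_conj_symm, inner_star_left, htr a ha z hz, ← inner_star_left, inner_conj_symm]
    rw [h3, ← hDn a ha]
    exact norm_inner_le_norm _ _
  have hn : ∀ z ∈ N, ‖star z Ω‖ = ‖z Ω‖ := fun z hz =>
    (hle z hz).antisymm (by simpa using hle _ (star_mem hz))
  refine ⟨h1, fun x hx y hy => ?_, hDd.mono ?_⟩
  · simp only [mul_apply_eq_comp]
    rw [← inner_star_left x Ω, ← inner_star_left y Ω]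
    have hx' : star x ∈ N := star_mem hx
    have key : ⟪star x Ω, y Ω⟫_ℂ = ⟪star y Ω, x Ω⟫_ℂ := by
      have hsm : ∀ z ∈ N, (Complex.I • z) ∈ N := fun z hz => N.toStarSubalgebra.smul_mem hz _
      have e1 := hn _ (add_mem hx' hy)
      have e2 := hn _ (sub_mem hx' hy)
      have e3 := hn _ (add_mem hx' (hsm y hy))
      have e4 := hn _ (sub_mem hx' (hsm y hy))
      simp only [star_add, star_sub, star_smul, star_star, add_apply, sub_apply, smul_apply, RCLike.star_def,
        Complex.conj_I] at e1 e2 e3 e4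
      rw [inner_eq_sum_norm_sq_div_four, ← inner_conj_symm (star y Ω),
        inner_eq_sum_norm_sq_div_four (x Ω)]
      simp only [RCLike.I_to_complex]
      rw [← e1, ← e2, ← e3, ← e4]
      simp [neg_smul, sub_eq_add_neg, map_ofNat]
      ring
    exact key
  · rintro _ ⟨a, ha, rfl⟩
    exact ⟨a, ha.1, rfl⟩

theorem mem_L2 {Q : VonNeumannAlgebra H} {x : H →L[ℂ] H} (hx : x ∈ Q) (Ω : H) :
    x Ω ∈ L2 Q Ω :=
  Submodule.le_topologicalClosure _ ⟨x, hx, rfl⟩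

theorem L2_subset_closure (Q : VonNeumannAlgebra H) (Ω : H) :
    (L2 Q Ω : Set H) ⊆ closure {ξ : H | ∃ x ∈ Q, x Ω = ξ} := fun _ hξ => hξ

/-- A closed subspace containing `Q Ω` contains `L²(Q)`. -/
theorem L2_le {Q : VonNeumannAlgebra H} {Ω : H} {K : Submodule ℂ H} (hK : IsClosed (K : Set H))
    (h : ∀ x ∈ Q, x Ω ∈ K) : L2 Q Ω ≤ K := fun _ hξ =>
  closure_minimal (by rintro _ ⟨x, hx, rfl⟩; exact h x hx) hK (L2_subset_closure Q Ω hξ)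

/-- An operator that, together with its adjoint, leaves a subspace invariant commutes with the
projection onto it. -/
theorem starProjection_comm {K : Submodule ℂ H} [K.HasOrthogonalProjection] {x : H →L[ℂ] H}
    (h1 : ∀ ξ ∈ K, x ξ ∈ K) (h2 : ∀ ξ ∈ K, star x ξ ∈ K) :
    x * K.starProjection = K.starProjection * x := by
  ext ξ
  simp only [mul_apply_eq_comp]
  refine (Submodule.eq_starProjection_of_mem_of_inner_eq_zero
    (h1 _ (K.starProjection_apply_mem ξ)) fun w hw => ?_).symm
  rw [← map_sub, ← inner_star_right, Submodule.starProjection_inner_eq_zero _ _ (h2 w hw)]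

/-- `L²(Q)` is a left `Q`-module. -/
theorem L2_comm {Q : VonNeumannAlgebra H} {Ω : H} {x : H →L[ℂ] H} (hx : x ∈ Q) :
    x * (L2 Q Ω).starProjection = (L2 Q Ω).starProjection * x := by
  have key : ∀ y ∈ Q, ∀ ξ ∈ L2 Q Ω, y ξ ∈ L2 Q Ω := fun y hy => by
    refine L2_le (K := (L2 Q Ω).comap y.toLinearMap)
      ((Submodule.isClosed_topologicalClosure _).preimage y.continuous) fun z hz => ?_
    exact mem_L2 (mul_mem hy hz) Ω
  exact starProjection_comm (key x hx) (key _ (star_mem hx))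

/-- Continuous maps agreeing on `M Ω` agree. -/
theorem IsTraceVector.ext {M : VonNeumannAlgebra H} {Ω : H} (h : IsTraceVector M Ω)
    {E : Type*} [NormedAddCommGroup E] {f g : H → E} (hf : Continuous f) (hg : Continuous g)
    (hfg : ∀ x ∈ M, f (x Ω) = g (x Ω)) (ξ : H) : f ξ = g ξ := by
  refine congrFun (Continuous.ext_on h.cyclic hf hg ?_) ξ
  rintro _ ⟨x, hx, rfl⟩
  exact hfg x hx

section RightMul

variable {M : VonNeumannAlgebra H} {Ω : H} (h : IsTraceVector M Ω)
include h

theorem rightMul_omega {y : H →L[ℂ] H} (hy : y ∈ M) : rightMul M Ω y Ω = y Ω :=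
  rightMul_apply h (one_mem M) hy

theorem comm_rightMul {x y : H →L[ℂ] H} (hx : x ∈ M) (hy : y ∈ M) :
    x * rightMul M Ω y = rightMul M Ω y * x := by
  ext ξ
  refine h.ext (by fun_prop) (by fun_prop) (fun z hz => ?_) ξ
  have e : x (z Ω) = (x * z) Ω := rfl
  simp only [mul_apply_eq_comp]
  rw [rightMul_apply h hz hy, e, rightMul_apply h (mul_mem hx hz) hy]
  rfl

theorem star_rightMul {y : H →L[ℂ] H} (hy : y ∈ M) :
    star (rightMul M Ω y) = rightMul M Ω (star y) := by
  ext ξ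
  refine ext_inner_left ℂ fun η => ?_
  rw [inner_star_right]
  refine h.ext (f := fun ξ => ⟪rightMul M Ω y η, ξ⟫_ℂ) (g := fun ξ => ⟪η, rightMul M Ω (star y) ξ⟫_ℂ)
    (by fun_prop) (by fun_prop) (fun x hx => ?_) ξ
  refine h.ext (f := fun η => ⟪rightMul M Ω y η, x Ω⟫_ℂ)
    (g := fun η => ⟪η, rightMul M Ω (star y) (x Ω)⟫_ℂ)
    (by fun_prop) (by fun_prop) (fun z hz => ?_) η
  rw [rightMul_apply h hz hy, rightMul_apply h hx (star_mem hy)]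
  have := h.trace _ (mul_mem (star_mem hz) hx) _ (star_mem hy)
  simp only [mul_apply_eq_comp] at this
  rw [← inner_star_left, ← inner_star_right z, this]
  simp [inner_star_left, inner_star_right]

theorem inner_rightMul_left {y : H →L[ℂ] H} (hy : y ∈ M) (ξ η : H) :
    ⟪rightMul M Ω y ξ, η⟫_ℂ = ⟪ξ, rightMul M Ω (star y) η⟫_ℂ := by
  rw [← star_rightMul h hy, inner_star_right]

end RightMul

end Standard

/-! ### Operators on tensor products -/

section Tensor

variable {H₁ H₂ : Type*} [NormedAddCommGroup H₁] [InnerProductSpace ℂ H₁] [CompleteSpace H₁]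
  [NormedAddCommGroup H₂] [InnerProductSpace ℂ H₂] [CompleteSpace H₂]

theorem vtmul_add_right (ξ : H₁) (η η' : H₂) : vtmul ξ (η + η') = vtmul ξ η + vtmul ξ η' := by
  simp only [vtmul, TensorProduct.tmul_add, UniformSpace.Completion.coe_add]

theorem vtmul_smul_right (c : ℂ) (ξ : H₁) (η : H₂) : vtmul ξ (c • η) = c • vtmul ξ η := by
  simp [vtmul]

theorem norm_vtmul (ξ : H₁) (η : H₂) : ‖vtmul ξ η‖ = ‖ξ‖ * ‖η‖ := by
  simp [vtmul]

theorem ext_inner_vtmul {a b : HTensor H₁ H₂}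
    (h : ∀ ξ η, ⟪vtmul ξ η, a⟫_ℂ = ⟪vtmul ξ η, b⟫_ℂ) : a = b := by
  refine ext_inner_right ℂ fun ζ => ?_
  refine DFunLike.congr_fun (ext_vtmul (S := innerSL ℂ a) (T := innerSL ℂ b) fun ξ η => ?_) ζ
  rw [innerSL_apply_apply, innerSL_apply_apply, ← inner_conj_symm, h, inner_conj_symm]

/-- The bounded operator `ξ ↦ ξ ⊗ η`. -/
def tensorRight (η : H₂) : H₁ →L[ℂ] HTensor H₁ H₂ :=
  LinearMap.mkContinuous
    { toFun := fun ξ => vtmul ξ η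
      map_add' := fun ξ ξ' => vtmul_add_left ξ ξ' η
      map_smul' := fun c ξ => vtmul_smul_left c ξ η } ‖η‖ fun ξ => by
    rw [mul_comm]
    exact (norm_vtmul ξ η).le

/-- The bounded operator `η ↦ ξ ⊗ η`. -/
def tensorLeft (ξ : H₁) : H₂ →L[ℂ] HTensor H₁ H₂ :=
  LinearMap.mkContinuous
    { toFun := fun η => vtmul ξ η
      map_add' := fun η η' => vtmul_add_right ξ η η'
      map_smul' := fun c η => vtmul_smul_right c ξ η } ‖ξ‖ fun η => (norm_vtmul ξ η).le

theorem otmul_mul_otmul (x x' : H₁ →L[ℂ] H₁) (y y' : H₂ →L[ℂ] H₂) :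
    otmul x y * otmul x' y' = otmul (x * x') (y * y') :=
  ext_vtmul fun ξ η => by simp [otmul_vtmul]

theorem otmul_comm {x x' : H₁ →L[ℂ] H₁} {y y' : H₂ →L[ℂ] H₂} (hx : x * x' = x' * x)
    (hy : y * y' = y' * y) : otmul x y * otmul x' y' = otmul x' y' * otmul x y := by
  rw [otmul_mul_otmul, otmul_mul_otmul, hx, hy]

theorem otmul_mem {M : VonNeumannAlgebra H₁} {N : VonNeumannAlgebra H₂} {x : H₁ →L[ℂ] H₁}
    {y : H₂ →L[ℂ] H₂} (hx : x ∈ M) (hy : y ∈ N) : otmul x y ∈ vnTensor M N :=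
  subset_vnGen _ ⟨x, hx, y, hy, rfl⟩

theorem vnTensor_mono {M : VonNeumannAlgebra H₁} {N N' : VonNeumannAlgebra H₂} (h : N ≤ N') :
    vnTensor M N ≤ vnTensor M N' :=
  vnGen_le fun _ ⟨_, hx, _, hy, e⟩ => e ▸ otmul_mem hx (h hy)

theorem vnTensor_comm {M : VonNeumannAlgebra H₁} {N : VonNeumannAlgebra H₂}
    {T : HTensor H₁ H₂ →L[ℂ] HTensor H₁ H₂}
    (h : ∀ x ∈ M, ∀ y ∈ N, otmul x y * T = T * otmul x y)
    {z : HTensor H₁ H₂ →L[ℂ] HTensor H₁ H₂} (hz : z ∈ vnTensor M N) : z * T = T * z := by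
  refine vnGen_comm ?_ hz
  rintro _ ⟨x, hx, y, hy, rfl⟩
  exact ⟨h x hx y hy, by rw [star_otmul]; exact h _ (star_mem hx) _ (star_mem hy)⟩

/-- Elementary tensors of vectors from total sets are total. -/
theorem dense_span_vtmul_of_dense {S₁ : Set H₁} {S₂ : Set H₂} (h₁ : Dense S₁) (h₂ : Dense S₂) :
    Dense (Submodule.span ℂ {ζ : HTensor H₁ H₂ | ∃ ξ ∈ S₁, ∃ η ∈ S₂, vtmul ξ η = ζ} :
      Set (HTensor H₁ H₂)) := by
  set K := Submodule.span ℂ {ζ : HTensor H₁ H₂ | ∃ ξ ∈ S₁, ∃ η ∈ S₂, vtmul ξ η = ζ}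
  have hcl : IsClosed (K.topologicalClosure : Set (HTensor H₁ H₂)) :=
    K.isClosed_topologicalClosure
  have e1 : ∀ ξ ∈ S₁, ∀ η, vtmul ξ η ∈ K.topologicalClosure := fun ξ hξ η => by
    refine closure_minimal (s := S₂) (t := {η | vtmul ξ η ∈ K.topologicalClosure}) ?_ ?_ (h₂ η)
    · exact fun η hη => K.le_topologicalClosure (Submodule.subset_span ⟨ξ, hξ, η, hη, rfl⟩)
    · exact hcl.preimage (tensorLeft ξ).continuous
  have e2 : ∀ ξ η, vtmul ξ η ∈ K.topologicalClosure := fun ξ η => by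
    refine closure_minimal (s := S₁) (t := {ξ | vtmul ξ η ∈ K.topologicalClosure}) ?_ ?_ (h₁ ξ)
    · exact fun ξ hξ => e1 ξ hξ η
    · exact hcl.preimage (tensorRight η).continuous
  have e3 : Submodule.span ℂ {ζ : HTensor H₁ H₂ | ∃ ξ η, ζ = vtmul ξ η} ≤
      K.topologicalClosure := by
    rw [Submodule.span_le]
    rintro _ ⟨ξ, η, rfl⟩
    exact e2 ξ η
  exact fun ζ => closure_minimal e3 hcl (dense_span_vtmul ζ)

theorem dense_span_otmul {M : VonNeumannAlgebra H₁} {N : VonNeumannAlgebra H₂} {Ω₁ : H₁}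
    {Ω₂ : H₂} (h₁ : IsTraceVector M Ω₁) (h₂ : IsTraceVector N Ω₂) :
    Dense (Submodule.span ℂ {ζ : HTensor H₁ H₂ | ∃ a ∈ {T | ∃ x ∈ M, ∃ y ∈ N, T = otmul x y},
      a (vtmul Ω₁ Ω₂) = ζ} : Set (HTensor H₁ H₂)) := by
  refine (dense_span_vtmul_of_dense h₁.cyclic h₂.cyclic).mono (Submodule.span_mono ?_)
  rintro _ ⟨_, ⟨x, hx, rfl⟩, _, ⟨y, hy, rfl⟩, rfl⟩
  exact ⟨_, ⟨x, hx, y, hy, rfl⟩, otmul_vtmul _ _ _ _⟩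

/-- `Ω₁ ⊗ Ω₂` is a trace vector for `M ⊗ N`. -/
theorem IsTraceVector.vnTensor {M : VonNeumannAlgebra H₁} {N : VonNeumannAlgebra H₂} {Ω₁ : H₁}
    {Ω₂ : H₂} (h₁ : IsTraceVector M Ω₁) (h₂ : IsTraceVector N Ω₂) :
    IsTraceVector (vnTensor M N) (vtmul Ω₁ Ω₂) := by
  refine .of_commutant (by rw [norm_vtmul, h₁.norm_eq_one, h₂.norm_eq_one, one_mul])
    (S := {T | ∃ x ∈ M, ∃ y ∈ N, T = otmul x y}) (subset_vnGen _) ?_ (dense_span_otmul h₁ h₂)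
  rintro _ ⟨x, hx, y, hy, rfl⟩
  refine ⟨otmul (rightMul M Ω₁ x) (rightMul N Ω₂ y), fun g hg => ?_, ?_, ?_⟩
  · exact vnTensor_comm (fun x' hx' y' hy' =>
      otmul_comm (comm_rightMul h₁ hx' hx) (comm_rightMul h₂ hy' hy)) hg
  · rw [otmul_vtmul, otmul_vtmul, rightMul_omega h₁ hx, rightMul_omega h₂ hy]
  · rw [star_otmul, star_otmul, otmul_vtmul, otmul_vtmul, star_rightMul h₁ hx,
      star_rightMul h₂ hy, rightMul_omega h₁ (star_mem hx), rightMul_omega h₂ (star_mem hy)]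

/-- An operator commuting with `g ⊗ 1` for generators `g` commutes with `x ⊗ 1` for all `x` in the
von Neumann algebra that they generate: its slices `(ι_{η'})* T ι_η`, `ι_η ξ = ξ ⊗ η`, commute
with the generators. -/
theorem otmul_one_comm {S : Set (H₁ →L[ℂ] H₁)} {T : HTensor H₁ H₂ →L[ℂ] HTensor H₁ H₂}
    (h : ∀ g ∈ S, otmul g 1 * T = T * otmul g 1 ∧ otmul (star g) 1 * T = T * otmul (star g) 1)
    {x : H₁ →L[ℂ] H₁} (hx : x ∈ vnGen S) : otmul x 1 * T = T * otmul x 1 := by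
  obtain ⟨sl, hsl⟩ : ∃ sl : H₂ → H₂ → (H₁ →L[ℂ] H₁),
      ∀ η η' ξ ξ', ⟪ξ', sl η η' ξ⟫_ℂ = ⟪vtmul ξ' η', T (vtmul ξ η)⟫_ℂ := by
    refine ⟨fun η η' => (ContinuousLinearMap.adjoint (tensorRight η' : H₁ →L[ℂ] HTensor H₁ H₂)).comp
      (T.comp (tensorRight η)), fun η η' ξ ξ' => ?_⟩
    rw [ContinuousLinearMap.comp_apply, ContinuousLinearMap.adjoint_inner_right]
    rfl
  have hco : ∀ (y : H₁ →L[ℂ] H₁), (∀ η η', y * sl η η' = sl η η' * y) ↔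
      otmul y 1 * T = T * otmul y 1 := by
    intro y
    have e1 : ∀ η η' ξ ξ', ⟪ξ', (y * sl η η') ξ⟫_ℂ =
        ⟪vtmul ξ' η', otmul y 1 (T (vtmul ξ η))⟫_ℂ := fun η η' ξ ξ' => by
      simp only [mul_apply_eq_comp]
      rw [← inner_star_left, hsl, ← inner_star_left (otmul y 1), star_otmul, otmul_vtmul, star_one]
      rfl
    have e2 : ∀ η η' ξ ξ', ⟪ξ', (sl η η' * y) ξ⟫_ℂ =
        ⟪vtmul ξ' η', T (otmul y 1 (vtmul ξ η))⟫_ℂ := fun η η' ξ ξ' => by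
      simp only [mul_apply_eq_comp]
      rw [hsl, otmul_vtmul]
      rfl
    constructor
    · intro hy
      refine ext_vtmul fun ξ η => ?_
      refine ext_inner_vtmul fun ξ' η' => ?_
      exact (e1 η η' ξ ξ').symm.trans (by rw [hy]; exact e2 η η' ξ ξ')
    · intro hy η η'
      ext ξ
      refine ext_inner_left ℂ fun ξ' => ?_
      rw [e1, e2, comm_apply hy]
  exact (hco x).1 fun η η' => vnGen_comm
    (fun g hg => ⟨(hco g).2 (h g hg).1 η η', (hco _).2 (h g hg).2 η η'⟩) hx

/-- `L²(M ⊗ Q)` is contained in the range of `1 ⊗ e_Q`. -/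
theorem otmul_one_starProjection_of_mem {M : VonNeumannAlgebra H₁} {Q : VonNeumannAlgebra H₂}
    {Ω₁ : H₁} {Ω₂ : H₂} {ζ : HTensor H₁ H₂} (hζ : ζ ∈ L2 (vnTensor M Q) (vtmul Ω₁ Ω₂)) :
    otmul 1 (L2 Q Ω₂).starProjection ζ = ζ := by
  set p : HTensor H₁ H₂ →L[ℂ] HTensor H₁ H₂ := otmul 1 (L2 Q Ω₂).starProjection with hp
  have hK : IsClosed (LinearMap.eqLocus p.toLinearMap LinearMap.id : Set (HTensor H₁ H₂)) :=
    isClosed_eq p.continuous continuous_id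
  refine L2_le (K := LinearMap.eqLocus p.toLinearMap LinearMap.id) hK (fun z hz => ?_) hζ
  change p (z _) = z _
  rw [← comm_apply (x := z) (T := p), hp, otmul_vtmul,
    Submodule.starProjection_eq_self_iff.2 (omega_mem_L2 Q Ω₂)]
  · rfl
  · exact vnTensor_comm (fun x _ y hy => otmul_comm (by simp) (L2_comm hy)) hz

theorem norm_starProjection_vnTensor_le (M : VonNeumannAlgebra H₁) (Q : VonNeumannAlgebra H₂)
    (Ω₁ : H₁) (Ω₂ : H₂) (ζ : HTensor H₁ H₂) :
    ‖(L2 (vnTensor M Q) (vtmul Ω₁ Ω₂)).starProjection ζ‖ ≤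
      ‖otmul 1 (L2 Q Ω₂).starProjection ζ‖ := by
  refine norm_starProjection_le_of_inner (S := L2 (vnTensor M Q) (vtmul Ω₁ Ω₂)) subset_closure
    (norm_nonneg _) fun η hη => ?_
  have : ⟪η, ζ⟫_ℂ = ⟪η, otmul 1 (L2 Q Ω₂).starProjection ζ⟫_ℂ := by
    rw [← inner_star_left, star_otmul, star_one, (isSelfAdjoint_starProjection _).star_eq,
      otmul_one_starProjection_of_mem hη]
  rw [this, mul_comm]
  exact norm_inner_le_norm _ _

end Tensor

/-! ### The crossed product on `ℓ²(Λ; H)` -/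

section Coordinates

variable {H : Type*} [NormedAddCommGroup H] [InnerProductSpace ℂ H] [CompleteSpace H]
  {Λ : Type*} [Group Λ]

theorem inner_delta_left (t : Λ) (ξ : H) (ζ : Ell2 Λ H) : ⟪delta t ξ, ζ⟫_ℂ = ⟪ξ, ζ t⟫_ℂ := by
  classical
  exact lp.inner_single_left (𝕜 := ℂ) (G := fun _ : Λ => H) t ξ ζ

theorem hasSum_delta (ξ : Ell2 Λ H) : HasSum (fun t => delta t (ξ t)) ξ := by
  classical
  have := lp.hasSum_single (E := fun _ : Λ => H) (p := 2) (by norm_num) ξ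
  exact this

theorem hasSum_norm_sq {ι : Type*} {E : Type*} [NormedAddCommGroup E] (ξ : lp (fun _ : ι => E) 2) :
    HasSum (fun t => ‖ξ t‖ ^ 2) (‖ξ‖ ^ 2) := by
  have h := lp.hasSum_norm (p := 2) (by simp) ξ
  simpa using h

theorem enorm_sq_eq_ofReal {E : Type*} [NormedAddCommGroup E] (x : E) :
    ‖x‖ₑ ^ 2 = ENNReal.ofReal (‖x‖ ^ 2) := by
  rw [ENNReal.ofReal_pow (norm_nonneg _), ofReal_norm]

theorem enorm_sq_eq_tsum {ι : Type*} {E : Type*} [NormedAddCommGroup E]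
    (ξ : lp (fun _ : ι => E) 2) : ‖ξ‖ₑ ^ 2 = ∑' t, ‖ξ t‖ₑ ^ 2 := by
  have h := hasSum_norm_sq ξ
  rw [enorm_sq_eq_ofReal, ← h.tsum_eq, ENNReal.ofReal_tsum_of_nonneg (fun t => sq_nonneg _) h.summable]
  exact tsum_congr fun t => (enorm_sq_eq_ofReal _).symm

theorem vOp_apply (s : Λ) (ξ : Ell2 Λ H) (t : Λ) : (vOp H s ξ) t = ξ (s⁻¹ * t) := rfl

theorem norm_vOp (s : Λ) (ξ : Ell2 Λ H) : ‖vOp H s ξ‖ = ‖ξ‖ := (shift s).norm_map ξ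

theorem vOp_one : vOp H (1 : Λ) = 1 := by
  ext ξ t
  rw [vOp_apply]
  simp

theorem vOp_mul (s t : Λ) : vOp H (s * t) = vOp H s * vOp H t := by
  ext ξ r
  simp only [mul_apply_eq_comp, vOp_apply, mul_inv_rev, mul_assoc]

theorem star_vOp (s : Λ) : star (vOp H s) = vOp H s⁻¹ := by
  ext ξ : 1
  refine ext_inner_left ℂ fun η => ?_
  rw [inner_star_right]
  have h := (shift (H := H) s).inner_map_map η (vOp H s⁻¹ ξ)
  have h2 : shift (H := H) s (vOp H s⁻¹ ξ) = ξ := by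
    change (vOp H s * vOp H s⁻¹) ξ = ξ
    rw [← vOp_mul, mul_inv_cancel, vOp_one]
    rfl
  rw [h2] at h
  exact h

/-- The projection of `ℓ²(Λ; H)` onto the vectors supported on `A`. -/
def coordProj (A : Set Λ) : Ell2 Λ H →L[ℂ] Ell2 Λ H :=
  open Classical in
  diagOp (fun t => if t ∈ A then 1 else 0) 1 fun t => by
    split_ifs
    · exact ContinuousLinearMap.norm_id_le
    · simp

open Classical in
theorem coordProj_apply (A : Set Λ) (ξ : Ell2 Λ H) (t : Λ) :
    (coordProj A ξ) t = if t ∈ A then ξ t else 0 := by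
  change (if t ∈ A then (1 : H →L[ℂ] H) else 0) (ξ t) = _
  split_ifs <;> rfl

theorem coordProj_eq_self {A : Set Λ} {ξ : Ell2 Λ H} (h : ∀ t, t ∉ A → ξ t = 0) :
    coordProj A ξ = ξ := by
  ext t
  rw [coordProj_apply]
  split_ifs with ht
  · rfl
  · exact (h t ht).symm

theorem coordProj_eq_zero {A : Set Λ} {ξ : Ell2 Λ H} (h : ∀ t, t ∈ A → ξ t = 0) :
    coordProj A ξ = 0 := by
  ext t
  rw [coordProj_apply]
  split_ifs with ht
  · exact h t ht
  · rfl

theorem apply_eq_zero_of_coordProj {A : Set Λ} {ξ : Ell2 Λ H} (h : coordProj A ξ = ξ) {t : Λ}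
    (ht : t ∉ A) : ξ t = 0 := by
  rw [← h, coordProj_apply, if_neg ht]

theorem coordProj_delta_of_mem {A : Set Λ} {t : Λ} (ht : t ∈ A) (ξ : H) :
    coordProj A (delta t ξ) = delta t ξ :=
  coordProj_eq_self fun s hs => by
    rw [delta_apply, if_neg]
    rintro rfl
    exact hs ht

theorem coordProj_delta_of_notMem {A : Set Λ} {t : Λ} (ht : t ∉ A) (ξ : H) :
    coordProj A (delta t ξ) = 0 :=
  coordProj_eq_zero fun s hs => by
    rw [delta_apply, if_neg]
    rintro rfl
    exact ht hs

theorem coordProj_idem (A : Set Λ) (ξ : Ell2 Λ H) : coordProj A (coordProj A ξ) = coordProj A ξ :=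
  coordProj_eq_self fun t ht => by rw [coordProj_apply, if_neg ht]

/-- Bounded operators on `ℓ²(Λ; H)` are determined by their matrix columns. -/
theorem ext_op_delta {E : Type*} [NormedAddCommGroup E] [NormedSpace ℂ E] {S T : Ell2 Λ H →L[ℂ] E}
    (h : ∀ t ξ, S (delta t ξ) = T (delta t ξ)) : S = T := by
  ext ξ
  refine ((hasSum_delta ξ).mapL S).unique ?_
  simp only [h]
  exact (hasSum_delta ξ).mapL T

theorem star_coordProj (A : Set Λ) :
    star (coordProj A : Ell2 Λ H →L[ℂ] Ell2 Λ H) = coordProj A := by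
  refine ext_op_delta fun t ξ => ?_
  refine ext_inner_right ℂ fun ζ => ?_
  rw [inner_star_left, inner_delta_left, coordProj_apply]
  by_cases ht : t ∈ A
  · rw [if_pos ht, coordProj_delta_of_mem ht, inner_delta_left]
  · rw [if_neg ht, coordProj_delta_of_notMem ht, inner_zero_left, inner_zero_right]

theorem inner_coordProj_self (A : Set Λ) (ξ : Ell2 Λ H) :
    ⟪ξ, coordProj A ξ⟫_ℂ = ((‖coordProj A ξ‖ ^ 2 : ℝ) : ℂ) := by
  have h : ⟪ξ, coordProj A (coordProj A ξ)⟫_ℂ = ⟪coordProj A ξ, coordProj A ξ⟫_ℂ := by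
    rw [← inner_star_left, star_coordProj]
  rw [coordProj_idem] at h
  rw [h, inner_self_eq_norm_sq_to_K]
  simp

/-- Pythagoras for the decomposition of `ℓ²(Λ; H)` along the fibres of a map. -/
theorem tsum_enorm_coordProj_sq {ι : Type*} (q : Λ → ι) (ξ : Ell2 Λ H) :
    ∑' k, ‖coordProj {t | q t = k} ξ‖ₑ ^ 2 = ‖ξ‖ₑ ^ 2 := by
  classical
  simp only [enorm_sq_eq_tsum]
  rw [ENNReal.tsum_comm]
  refine tsum_congr fun t => ?_
  rw [tsum_eq_single (q t)]
  · rw [coordProj_apply, if_pos]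
    rfl
  · intro k hk
    rw [coordProj_apply, if_neg (fun h => hk h.symm)]
    simp

/-- Translation on the other side, `(ρ_s ξ)(r) = ξ(r s⁻¹)`. -/
theorem exists_rightShift (s : Λ) : ∃ ρ : Ell2 Λ H →L[ℂ] Ell2 Λ H,
    ∀ ξ r, (ρ ξ) r = ξ (r * s⁻¹) := by
  have hm : ∀ ξ : Ell2 Λ H, Memℓp (fun r => ξ (r * s⁻¹)) 2 := fun ξ => by
    have h := (memℓp_gen_iff (E := fun _ : Λ => H) two_toReal_pos).1 (lp.memℓp ξ)
    exact (memℓp_gen_iff (E := fun _ : Λ => H) two_toReal_pos).2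
      ((Equiv.mulRight s⁻¹).summable_iff.2 h)
  refine ⟨LinearMap.mkContinuous
    { toFun := fun ξ => ⟨fun r => ξ (r * s⁻¹), hm ξ⟩
      map_add' := fun _ _ => rfl
      map_smul' := fun _ _ => rfl } 1 fun ξ => ?_, fun ξ r => rfl⟩
  rw [one_mul, lp.norm_eq_tsum_rpow two_toReal_pos, lp.norm_eq_tsum_rpow two_toReal_pos]
  refine le_of_eq (congrArg (· ^ (1 / (2 : ℝ≥0∞).toReal)) ?_)
  exact (Equiv.mulRight s⁻¹).tsum_eq fun t => ‖ξ t‖ ^ (2 : ℝ≥0∞).toReal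

end Coordinates

section Crossed

variable {H : Type*} [NormedAddCommGroup H] [InnerProductSpace ℂ H] [CompleteSpace H]
  {Λ : Type*} [Group Λ] {B : VonNeumannAlgebra H}
  {σ : Λ →* (B.toStarSubalgebra ≃⋆ₐ[ℂ] B.toStarSubalgebra)}

theorem piB_apply (b : B.toStarSubalgebra) (ξ : Ell2 Λ H) (t : Λ) :
    (piB σ b ξ) t = ((σ t⁻¹ b : B.toStarSubalgebra) : H →L[ℂ] H) (ξ t) := rfl

theorem star_piB (b : B.toStarSubalgebra) : star (piB σ b) = piB σ (star b) := by
  refine ext_op_delta fun t ξ => ?_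
  refine ext_inner_right ℂ fun ζ => ?_
  rw [inner_star_left, inner_delta_left, piB_delta, inner_delta_left, piB_apply, map_star,
    StarMemClass.coe_star, inner_star_left]

theorem piB_mem (S : Subgroup Λ) (b : B.toStarSubalgebra) : piB σ b ∈ crossed σ S :=
  subset_vnGen _ (Or.inl ⟨b, rfl⟩)

theorem vOp_mem {S : Subgroup Λ} {s : Λ} (hs : s ∈ S) : vOp H s ∈ crossed σ S :=
  subset_vnGen _ (Or.inr ⟨s, hs, rfl⟩)

theorem crossed_mono {S S' : Subgroup Λ} (h : S ≤ S') : crossed σ S ≤ crossed σ S' := by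
  refine vnGen_le ?_
  rintro _ (⟨b, rfl⟩ | ⟨s, hs, rfl⟩)
  exacts [piB_mem S' b, vOp_mem (h hs)]

theorem crossed_comm {S : Subgroup Λ} {T : Ell2 Λ H →L[ℂ] Ell2 Λ H}
    (h1 : ∀ b, piB σ b * T = T * piB σ b) (h2 : ∀ s ∈ S, vOp H s * T = T * vOp H s)
    {x : Ell2 Λ H →L[ℂ] Ell2 Λ H} (hx : x ∈ crossed σ S) : x * T = T * x := by
  refine vnGen_comm ?_ hx
  rintro _ (⟨b, rfl⟩ | ⟨s, hs, rfl⟩)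
  · exact ⟨h1 b, by rw [star_piB]; exact h1 _⟩
  · exact ⟨h2 s hs, by rw [star_vOp]; exact h2 _ (inv_mem hs)⟩

variable {Ω : H}

theorem vOp_piB_omega (s : Λ) (b : B.toStarSubalgebra) :
    vOp H s (piB σ b (delta 1 Ω)) = delta s ((b : H →L[ℂ] H) Ω) := by
  rw [piB_delta, vOp_delta, mul_one, inv_one, map_one]
  rfl

theorem piB_vOp_omega (s : Λ) (b : B.toStarSubalgebra) :
    piB σ (σ s b) (vOp H s (delta 1 Ω)) = delta s ((b : H →L[ℂ] H) Ω) := by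
  rw [vOp_delta, mul_one, piB_delta, map_inv]
  congr 2
  exact congrArg Subtype.val ((σ s).symm_apply_apply b)

/-- Vectors and operators can be tested on the vectors `δ_t ⊗ b Ω`. -/
theorem ext_op_omega (hΩ : IsTraceVector B Ω) {E : Type*} [NormedAddCommGroup E] [NormedSpace ℂ E]
    {S T : Ell2 Λ H →L[ℂ] E}
    (h : ∀ (t : Λ) (b : B.toStarSubalgebra),
      S (delta t ((b : H →L[ℂ] H) Ω)) = T (delta t ((b : H →L[ℂ] H) Ω))) : S = T := by
  refine ext_op_delta fun t ξ => ?_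
  exact hΩ.ext (f := fun ξ => S (delta t ξ)) (g := fun ξ => T (delta t ξ))
    (S.continuous.comp (delta t).continuous) (T.continuous.comp (delta t).continuous)
    (fun x hx => h t ⟨x, hx⟩) ξ

theorem dense_span_crossed (hΩ : IsTraceVector B Ω) :
    Dense (Submodule.span ℂ {ξ : Ell2 Λ H | ∃ a ∈ {a | ∃ (s : Λ) (b : B.toStarSubalgebra),
      a = vOp H s * piB σ b}, a (delta 1 Ω) = ξ} : Set (Ell2 Λ H)) := by
  set K := Submodule.span ℂ {ξ : Ell2 Λ H | ∃ a ∈ {a | ∃ (s : Λ) (b : B.toStarSubalgebra),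
      a = vOp H s * piB σ b}, a (delta 1 Ω) = ξ}
  have hcl : IsClosed (K.topologicalClosure : Set (Ell2 Λ H)) := K.isClosed_topologicalClosure
  have e1 : ∀ t ξ, delta t ξ ∈ K.topologicalClosure := fun t ξ => by
    refine closure_minimal (t := {ξ | delta t ξ ∈ K.topologicalClosure}) ?_ ?_ (hΩ.cyclic ξ)
    · rintro _ ⟨x, hx, rfl⟩
      exact K.le_topologicalClosure (Submodule.subset_span ⟨vOp H t * piB σ ⟨x, hx⟩,
        ⟨t, ⟨x, hx⟩, rfl⟩, vOp_piB_omega t _⟩)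
    · exact hcl.preimage (delta t).continuous
  intro ξ
  exact hcl.mem_of_tendsto (hasSum_delta ξ)
    (Filter.Eventually.of_forall fun F => Submodule.sum_mem _ fun t _ => e1 t _)

theorem norm_action_omega
    (hσ : ∀ (s : Λ) (b : B.toStarSubalgebra),
      ⟪Ω, ((σ s b : B.toStarSubalgebra) : H →L[ℂ] H) Ω⟫_ℂ = ⟪Ω, (b : H →L[ℂ] H) Ω⟫_ℂ)
    (s : Λ) (b : B.toStarSubalgebra) :
    ‖((σ s b : B.toStarSubalgebra) : H →L[ℂ] H) Ω‖ = ‖(b : H →L[ℂ] H) Ω‖ := by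
  have hn : ∀ b : B.toStarSubalgebra, ((‖(b : H →L[ℂ] H) Ω‖ ^ 2 : ℝ) : ℂ) =
      ⟪Ω, ((star b * b : B.toStarSubalgebra) : H →L[ℂ] H) Ω⟫_ℂ := fun b => by
    change _ = ⟪Ω, star (b : H →L[ℂ] H) ((b : H →L[ℂ] H) Ω)⟫_ℂ
    rw [inner_star_right, inner_self_eq_norm_sq_to_K]
    simp
  have h := hσ s (star b * b)
  rw [map_mul, map_star, ← hn, ← hn] at h
  have h2 : ‖((σ s b : B.toStarSubalgebra) : H →L[ℂ] H) Ω‖ ^ 2 = ‖(b : H →L[ℂ] H) Ω‖ ^ 2 := by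
    exact_mod_cast h
  exact (sq_eq_sq₀ (norm_nonneg _) (norm_nonneg _)).1 h2

/-- The unitary implementing a trace preserving automorphism. -/
theorem exists_implementing (hΩ : IsTraceVector B Ω)
    (hσ : ∀ (s : Λ) (b : B.toStarSubalgebra),
      ⟪Ω, ((σ s b : B.toStarSubalgebra) : H →L[ℂ] H) Ω⟫_ℂ = ⟪Ω, (b : H →L[ℂ] H) Ω⟫_ℂ) (s : Λ) :
    ∃ U : H →L[ℂ] H, ∀ (b : B.toStarSubalgebra),
      U ((b : H →L[ℂ] H) Ω) = ((σ s b : B.toStarSubalgebra) : H →L[ℂ] H) Ω := by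
  let e : B.toStarSubalgebra →ₗ[ℂ] H :=
    (ContinuousLinearMap.apply ℂ H Ω).toLinearMap ∘ₗ
      B.toStarSubalgebra.toSubalgebra.toSubmodule.subtype
  let f : B.toStarSubalgebra →ₗ[ℂ] H := e ∘ₗ (σ s : B.toStarSubalgebra →ₗ[ℂ] B.toStarSubalgebra)
  have hfe : ∀ b, ‖f b‖ ≤ 1 * ‖e b‖ := fun b => by
    rw [one_mul]
    exact (norm_action_omega hσ s b).le
  refine ⟨f.extendOfNorm e, fun b => LinearMap.extendOfNorm_eq (f := f) (e := e) ?_ ⟨1, hfe⟩ b⟩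
  refine hΩ.cyclic.mono ?_
  rintro _ ⟨z, hz, rfl⟩
  exact ⟨⟨z, hz⟩, rfl⟩

/-- `δ_1 ⊗ Ω` is a trace vector for `B ⋊ Λ`. -/
theorem IsTraceVector.crossed (hΩ : IsTraceVector B Ω)
    (hσ : ∀ (s : Λ) (b : B.toStarSubalgebra),
      ⟪Ω, ((σ s b : B.toStarSubalgebra) : H →L[ℂ] H) Ω⟫_ℂ = ⟪Ω, (b : H →L[ℂ] H) Ω⟫_ℂ) :
    IsTraceVector (crossed σ ⊤) (delta 1 Ω) := by
  refine .of_commutant (by rw [LinearIsometry.norm_map, hΩ.norm_eq_one])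
    (S := {a | ∃ (s : Λ) (b : B.toStarSubalgebra), a = vOp H s * piB σ b}) ?_ ?_
    (dense_span_crossed hΩ)
  · rintro _ ⟨s, b, rfl⟩
    exact mul_mem (vOp_mem trivial) (piB_mem ⊤ b)
  rintro _ ⟨s, b, rfl⟩
  -- `R` is the right multiplication by `v_s b`, with `(R ξ)(r) = σ_{s⁻¹}(ξ(r s⁻¹)) b`.
  obtain ⟨ρ, hρ⟩ := exists_rightShift (H := H) s
  obtain ⟨U, hU⟩ := exists_implementing hΩ hσ s⁻¹
  have hUc : ∀ (c : B.toStarSubalgebra) (ξ : H), U ((c : H →L[ℂ] H) ξ) =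
      ((σ s⁻¹ c : B.toStarSubalgebra) : H →L[ℂ] H) (U ξ) := fun c ξ => by
    refine hΩ.ext (f := fun ξ => U ((c : H →L[ℂ] H) ξ))
      (g := fun ξ => ((σ s⁻¹ c : B.toStarSubalgebra) : H →L[ℂ] H) (U ξ)) (by fun_prop)
      (by fun_prop) (fun x hx => ?_) ξ
    have h1 := hU (c * ⟨x, hx⟩)
    rw [map_mul] at h1
    have h2 := hU ⟨x, hx⟩
    dsimp only at h2 ⊢
    rw [h2]
    exact h1
  set X : H →L[ℂ] H := rightMul B Ω (b : H →L[ℂ] H) * U with hX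
  let R : Ell2 Λ H →L[ℂ] Ell2 Λ H := diagOp (fun _ => X) ‖X‖ (fun _ => le_rfl) * ρ
  have hR : ∀ ξ r, (R ξ) r = X (ξ (r * s⁻¹)) := fun ξ r => congrArg X (hρ ξ r)
  have hRd : ∀ t ξ, R (delta t ξ) = delta (t * s) (X ξ) := fun t ξ => by
    ext r
    rw [hR, delta_apply, delta_apply]
    by_cases h : r = t * s
    · rw [if_pos h, if_pos (by rw [h, mul_inv_cancel_right])]
    · rw [if_neg h, if_neg fun h' => h (by rw [← h', inv_mul_cancel_right]), map_zero]
  have hXc : ∀ c : B.toStarSubalgebra, X ((c : H →L[ℂ] H) Ω) =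
      ((σ s⁻¹ c : B.toStarSubalgebra) : H →L[ℂ] H) ((b : H →L[ℂ] H) Ω) := fun c => by
    rw [hX, mul_apply_eq_comp, hU, rightMul_apply hΩ (σ s⁻¹ c).2 b.2]
  refine ⟨R, fun g hg => ?_, ?_, ?_⟩
  · refine crossed_comm (fun c => ?_) (fun t _ => ?_) hg
    · refine ext_op_delta fun t ξ => ?_
      have e : (σ s⁻¹) ((σ t⁻¹) c) = (σ (t * s)⁻¹) c := by
        rw [mul_inv_rev, map_mul]
        rfl
      simp only [mul_apply_eq_comp]
      rw [hRd, piB_delta, piB_delta, hRd, hX, mul_apply_eq_comp, mul_apply_eq_comp, hUc,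
        comm_apply (comm_rightMul hΩ (σ (t * s)⁻¹ c).2 b.2), e]
    · refine ext_op_delta fun r ξ => ?_
      simp only [mul_apply_eq_comp]
      rw [hRd, vOp_delta, vOp_delta, hRd, mul_assoc]
  · have h1 := hXc 1
    rw [map_one] at h1
    change R _ = vOp H s (piB σ b _)
    rw [hRd, one_mul, vOp_piB_omega]
    exact congrArg _ h1
  · refine ext_inner_right ℂ fun ζ => ?_
    rw [inner_star_left, inner_star_left]
    refine DFunLike.congr_fun (ext_op_omega hΩ (S := (innerSL ℂ (delta 1 Ω)).comp R)
      (T := (innerSL ℂ (delta 1 Ω)).comp (vOp H s * piB σ b)) fun t c => ?_) ζ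
    change ⟪_, R _⟫_ℂ = ⟪_, vOp H s (piB σ b _)⟫_ℂ
    rw [hRd, piB_delta, vOp_delta, inner_delta_left, inner_delta_left, delta_apply, delta_apply,
      hXc]
    by_cases hst : t = s⁻¹
    · subst hst
      rw [if_pos (by simp), if_pos (by simp), inv_inv]
      have h1 := hσ s⁻¹ (c * σ s b)
      have h2 := hΩ.trace _ c.2 _ (σ s b).2
      have h3 : (σ s⁻¹) ((σ s) b) = b := by
        rw [map_inv]
        exact (σ s).symm_apply_apply b
      rw [map_mul, h3] at h1
      exact h1.trans h2
    · rw [if_neg fun h => hst (eq_inv_of_mul_eq_one_left h.symm),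
        if_neg fun h => hst (eq_inv_of_mul_eq_one_right h.symm)]

end Crossed

/-! ### `L²(B ⋊ Λ)` as a right module over `B ⋊ S` -/

section Cosets

variable {H : Type*} [NormedAddCommGroup H] [InnerProductSpace ℂ H] [CompleteSpace H]
  {Λ : Type*} [Group Λ] {B : VonNeumannAlgebra H}
  {σ : Λ →* (B.toStarSubalgebra ≃⋆ₐ[ℂ] B.toStarSubalgebra)} {Ω : H}

theorem coordProj_comm_of_mem {S : Subgroup Λ} {z : Ell2 Λ H →L[ℂ] Ell2 Λ H}
    (hz : z ∈ crossed σ S) : z * coordProj (S : Set Λ) = coordProj (S : Set Λ) * z := by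
  refine crossed_comm (fun b => ?_) (fun s hs => ?_) hz
  · refine ext_op_delta fun t ξ => ?_
    simp only [mul_apply_eq_comp]
    by_cases ht : t ∈ (S : Set Λ)
    · rw [coordProj_delta_of_mem ht, piB_delta, coordProj_delta_of_mem ht]
    · rw [coordProj_delta_of_notMem ht, piB_delta, coordProj_delta_of_notMem ht, map_zero]
  · refine ext_op_delta fun t ξ => ?_
    simp only [mul_apply_eq_comp]
    by_cases ht : t ∈ (S : Set Λ)
    · rw [coordProj_delta_of_mem ht, vOp_delta, coordProj_delta_of_mem (S.mul_mem hs ht)]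
    · rw [coordProj_delta_of_notMem ht, vOp_delta,
        coordProj_delta_of_notMem (fun h => ht ((S.mul_mem_cancel_left hs).1 h)), map_zero]

/-- Elements of `B ⋊ S` are supported on `S`. -/
theorem apply_omega_eq_zero {S : Subgroup Λ} {z : Ell2 Λ H →L[ℂ] Ell2 Λ H}
    (hz : z ∈ crossed σ S) {t : Λ} (ht : t ∉ S) : (z (delta 1 Ω)) t = 0 := by
  refine apply_eq_zero_of_coordProj (A := (S : Set Λ)) ?_ ht
  rw [← comm_apply (coordProj_comm_of_mem hz), coordProj_delta_of_mem S.one_mem]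

/-- `L²(B ⋊ S)` contains all vectors supported on `S`. -/
theorem mem_L2_crossed (hΩ : IsTraceVector B Ω) {S : Subgroup Λ} {ξ : Ell2 Λ H}
    (h : ∀ t ∉ S, ξ t = 0) : ξ ∈ L2 (crossed σ S) (delta 1 Ω) := by
  have hcl : IsClosed (L2 (crossed σ S) (delta 1 Ω) : Set (Ell2 Λ H)) :=
    Submodule.isClosed_topologicalClosure _
  refine hcl.mem_of_tendsto (hasSum_delta ξ)
    (Filter.Eventually.of_forall fun F => Submodule.sum_mem _ fun t _ => ?_)
  by_cases ht : t ∈ S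
  · refine closure_minimal (t := {η | delta t η ∈ L2 (crossed σ S) (delta 1 Ω)}) ?_ ?_
      (hΩ.cyclic (ξ t))
    · rintro _ ⟨x, hx, rfl⟩
      have := mem_L2 (mul_mem (vOp_mem (σ := σ) ht) (piB_mem S ⟨x, hx⟩)) (delta 1 Ω)
      rw [mul_apply_eq_comp, vOp_piB_omega] at this
      exact this
    · exact hcl.preimage (delta t).continuous
  · rw [h t ht, map_zero]
    exact zero_mem _

/-- The projection onto the vectors supported on a left coset of `S`. -/
def cosetProj (S : Subgroup Λ) (k : Λ ⧸ S) : Ell2 Λ H →L[ℂ] Ell2 Λ H :=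
  coordProj {t | (t : Λ ⧸ S) = k}

/-- Right multiplication by `B ⋊ S` preserves the left cosets of `S`. -/
theorem cosetProj_comm_rightMul (hΩ : IsTraceVector B Ω)
    (hM : IsTraceVector (crossed σ ⊤) (delta 1 Ω)) {S : Subgroup Λ} (k : Λ ⧸ S)
    {z : Ell2 Λ H →L[ℂ] Ell2 Λ H} (hz : z ∈ crossed σ S) :
    cosetProj S k * rightMul (crossed σ ⊤) (delta 1 Ω) z =
      rightMul (crossed σ ⊤) (delta 1 Ω) z * cosetProj S k := by
  refine ext_op_omega hΩ fun t b => ?_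
  simp only [mul_apply_eq_comp]
  have hb : rightMul (crossed σ ⊤) (delta 1 Ω) z (delta t ((b : H →L[ℂ] H) Ω)) =
      vOp H t (piB σ b (z (delta 1 Ω))) := by
    rw [← vOp_piB_omega]
    exact rightMul_apply hM (mul_mem (vOp_mem (σ := σ) (Subgroup.mem_top t)) (piB_mem ⊤ b))
      (crossed_mono le_top hz)
  have hsupp : ∀ r : Λ, (r : Λ ⧸ S) ≠ t → (vOp H t (piB σ b (z (delta 1 Ω)))) r = 0 := by
    intro r hr
    rw [vOp_apply, piB_apply, apply_omega_eq_zero hz, map_zero]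
    exact fun h => hr (QuotientGroup.eq.2 h).symm
  by_cases ht : (t : Λ ⧸ S) = k
  · rw [cosetProj, coordProj_delta_of_mem (A := {t : Λ | (t : Λ ⧸ S) = k}) ht, hb]
    exact coordProj_eq_self fun r hr => hsupp r fun h => hr (h.trans ht)
  · rw [cosetProj, coordProj_delta_of_notMem (A := {t : Λ | (t : Λ ⧸ S) = k}) ht, hb, map_zero]
    exact coordProj_eq_zero fun r hr => hsupp r fun h => ht (h.symm.trans hr)

/-- Translating a coset back to `S` identifies the vectors that it supports with `L²(B ⋊ S)`. -/
theorem vOp_inv_cosetProj_mem (hΩ : IsTraceVector B Ω) {S : Subgroup Λ} (k : Λ ⧸ S)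
    (ξ : Ell2 Λ H) : vOp H (k.out)⁻¹ (cosetProj S k ξ) ∈ L2 (crossed σ S) (delta 1 Ω) := by
  refine mem_L2_crossed hΩ fun t ht => ?_
  rw [vOp_apply, inv_inv, cosetProj, coordProj_apply, if_neg]
  intro h
  refine ht ?_
  have h2 : ((k.out * t : Λ) : Λ ⧸ S) = (k.out : Λ ⧸ S) := by
    rw [QuotientGroup.out_eq']
    exact h
  have := QuotientGroup.eq.1 h2.symm
  rwa [inv_mul_cancel_left] at this

variable (σ Ω) in
/-- The operators on `L²(B ⋊ Λ)` that commute with the right multiplications by `B ⋊ S`. -/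
def RightLinear (S : Subgroup Λ) (T : Ell2 Λ H →L[ℂ] Ell2 Λ H) : Prop :=
  ∀ z ∈ crossed σ S, T * rightMul (crossed σ ⊤) (delta 1 Ω) z =
    rightMul (crossed σ ⊤) (delta 1 Ω) z * T

theorem RightLinear.star (hM : IsTraceVector (crossed σ ⊤) (delta 1 Ω)) {S : Subgroup Λ}
    {T : Ell2 Λ H →L[ℂ] Ell2 Λ H} (hT : RightLinear σ Ω S T) : RightLinear σ Ω S (star T) := by
  intro z hz
  have h := congrArg Star.star (hT _ (star_mem hz))
  rw [star_mul, star_mul, star_rightMul hM (crossed_mono le_top (star_mem hz)), star_star] at h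
  exact h.symm

theorem vOp_omega (t : Λ) : vOp H t (delta 1 Ω) = delta t Ω := by rw [vOp_delta, mul_one]

theorem vOp_apply_omega (hM : IsTraceVector (crossed σ ⊤) (delta 1 Ω)) {S : Subgroup Λ} (k : Λ)
    {z : Ell2 Λ H →L[ℂ] Ell2 Λ H} (hz : z ∈ crossed σ S) :
    vOp H k (z (delta 1 Ω)) = rightMul (crossed σ ⊤) (delta 1 Ω) z (delta k Ω) := by
  rw [← vOp_omega k, rightMul_apply hM (vOp_mem (Subgroup.mem_top k)) (crossed_mono le_top hz)]

theorem cosetProj_vOp (hΩ : IsTraceVector B Ω)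
    (hM : IsTraceVector (crossed σ ⊤) (delta 1 Ω)) {S : Subgroup Λ} (k : Λ ⧸ S)
    {z : Ell2 Λ H →L[ℂ] Ell2 Λ H} (hz : z ∈ crossed σ S) :
    cosetProj S k (vOp H k.out (z (delta 1 Ω))) = vOp H k.out (z (delta 1 Ω)) := by
  rw [vOp_apply_omega hM _ hz, comm_apply (cosetProj_comm_rightMul hΩ hM k hz), cosetProj,
    coordProj_delta_of_mem]
  exact QuotientGroup.out_eq' k

theorem inner_vOp_inv_cosetProj (hΩ : IsTraceVector B Ω)
    (hM : IsTraceVector (crossed σ ⊤) (delta 1 Ω)) {S : Subgroup Λ} (k : Λ ⧸ S)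
    {z : Ell2 Λ H →L[ℂ] Ell2 Λ H} (hz : z ∈ crossed σ S) (ξ : Ell2 Λ H) :
    ⟪z (delta 1 Ω), vOp H (k.out)⁻¹ (cosetProj S k ξ)⟫_ℂ =
      ⟪delta k.out Ω, rightMul (crossed σ ⊤) (delta 1 Ω) (star z) ξ⟫_ℂ := by
  have hs : star (cosetProj S k : Ell2 Λ H →L[ℂ] Ell2 Λ H) = cosetProj S k := star_coordProj _
  rw [← star_vOp, inner_star_right, ← hs, inner_star_right, cosetProj_vOp hΩ hM k hz,
    vOp_apply_omega hM _ hz, inner_rightMul_left hM (crossed_mono le_top hz)]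

theorem norm_cosetProj_le (hΩ : IsTraceVector B Ω)
    (hM : IsTraceVector (crossed σ ⊤) (delta 1 Ω)) {S : Subgroup Λ}
    {T : Ell2 Λ H →L[ℂ] Ell2 Λ H} (hT : RightLinear σ Ω S T) (k l : Λ ⧸ S) :
    ‖cosetProj S l (T (delta k.out Ω))‖ ≤ ‖cosetProj S k (star T (delta l.out Ω))‖ := by
  rw [← norm_vOp (l.out)⁻¹]
  have hmem := vOp_inv_cosetProj_mem (σ := σ) hΩ l (T (delta k.out Ω))
  rw [← Submodule.starProjection_eq_self_iff.2 hmem]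
  refine norm_starProjection_le_of_inner (L2_subset_closure _ _) (norm_nonneg _) ?_
  rintro _ ⟨z, hz, rfl⟩
  have hz' := crossed_mono (σ := σ) le_top hz
  have hs : star (cosetProj S k : Ell2 Λ H →L[ℂ] Ell2 Λ H) = cosetProj S k := star_coordProj _
  have e : ⟪z (delta 1 Ω), vOp H (l.out)⁻¹ (cosetProj S l (T (delta k.out Ω)))⟫_ℂ =
      ⟪cosetProj S k (star T (delta l.out Ω)), vOp H k.out (star z (delta 1 Ω))⟫_ℂ := by
    rw [inner_vOp_inv_cosetProj hΩ hM l hz, ← comm_apply (hT _ (star_mem hz)), ← hs,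
      inner_star_left, cosetProj_vOp hΩ hM k (star_mem hz), vOp_apply_omega hM _ (star_mem hz),
      inner_star_left]
  rw [e]
  refine (norm_inner_le_norm _ _).trans ?_
  rw [norm_vOp, norm_star_apply hM hz']

/-- The trace of `T* T` for the semifinite trace on the operators commuting with the right action
of `B ⋊ S`, computed in the basis `δ_k ⊗ Ω`, where `k` runs through the cosets. -/
theorem tsum_coset_star (hΩ : IsTraceVector B Ω)
    (hM : IsTraceVector (crossed σ ⊤) (delta 1 Ω)) {S : Subgroup Λ}
    {T : Ell2 Λ H →L[ℂ] Ell2 Λ H} (hT : RightLinear σ Ω S T) :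
    ∑' k : Λ ⧸ S, ‖star T (delta k.out Ω)‖ₑ ^ 2 = ∑' k : Λ ⧸ S, ‖T (delta k.out Ω)‖ₑ ^ 2 := by
  have h : ∀ k l : Λ ⧸ S, ‖cosetProj S l (T (delta k.out Ω))‖ₑ ^ 2 =
      ‖cosetProj S k (star T (delta l.out Ω))‖ₑ ^ 2 := fun k l => by
    rw [enorm_sq_eq_ofReal, enorm_sq_eq_ofReal, (norm_cosetProj_le hΩ hM hT k l).antisymm]
    simpa using norm_cosetProj_le hΩ hM (hT.star hM) l k
  have e : ∀ ξ : Ell2 Λ H, ‖ξ‖ₑ ^ 2 = ∑' l : Λ ⧸ S, ‖cosetProj S l ξ‖ₑ ^ 2 := fun ξ =>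
    (tsum_enorm_coordProj_sq _ ξ).symm
  calc ∑' k : Λ ⧸ S, ‖star T (delta k.out Ω)‖ₑ ^ 2
      = ∑' (k : Λ ⧸ S) (l : Λ ⧸ S), ‖cosetProj S l (star T (delta k.out Ω))‖ₑ ^ 2 :=
        tsum_congr fun k => e _
    _ = ∑' (l : Λ ⧸ S) (k : Λ ⧸ S), ‖cosetProj S l (star T (delta k.out Ω))‖ₑ ^ 2 :=
        ENNReal.tsum_comm
    _ = ∑' k : Λ ⧸ S, ‖T (delta k.out Ω)‖ₑ ^ 2 :=
        tsum_congr fun k => by rw [e (T _)]; exact tsum_congr fun l => (h k l).symm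

/-- The vectors `δ_k ⊗ Ω` generate `L²(B ⋊ Λ)` as a right `B ⋊ S`-module. -/
theorem dense_span_rightMul_delta (hΩ : IsTraceVector B Ω)
    (hM : IsTraceVector (crossed σ ⊤) (delta 1 Ω)) (S : Subgroup Λ) :
    Dense (Submodule.span ℂ {ξ : Ell2 Λ H | ∃ z ∈ crossed σ S, ∃ k : Λ ⧸ S,
      rightMul (crossed σ ⊤) (delta 1 Ω) z (delta k.out Ω) = ξ} : Set (Ell2 Λ H)) := by
  refine (dense_span_crossed (σ := σ) hΩ).mono (Submodule.span_mono ?_)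
  rintro _ ⟨_, ⟨t, b, rfl⟩, rfl⟩
  set k : Λ ⧸ S := (t : Λ ⧸ S) with hk
  have hs : k.out⁻¹ * t ∈ S := QuotientGroup.eq.1 (by rw [QuotientGroup.out_eq'])
  have hz : vOp H (k.out⁻¹ * t) * piB σ b ∈ crossed σ S := mul_mem (vOp_mem hs) (piB_mem S b)
  refine ⟨_, hz, k, ?_⟩
  rw [← vOp_apply_omega hM _ hz, mul_apply_eq_comp, mul_apply_eq_comp, vOp_piB_omega,
    vOp_piB_omega, vOp_delta, mul_inv_cancel_left]

/-- The coefficient `u_{s h}` of `u` is controlled by the coefficient at `s` of the right translate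
`u v_{h⁻¹}`. -/
theorem norm_apply_mul_le (hΩ : IsTraceVector B Ω)
    (hσ : ∀ (s : Λ) (b : B.toStarSubalgebra),
      ⟪Ω, ((σ s b : B.toStarSubalgebra) : H →L[ℂ] H) Ω⟫_ℂ = ⟪Ω, (b : H →L[ℂ] H) Ω⟫_ℂ)
    {u : Ell2 Λ H →L[ℂ] Ell2 Λ H} (hu : u ∈ crossed σ ⊤) (s h : Λ) :
    ‖(u (delta 1 Ω)) (s * h)‖ ≤ ‖(u (delta h⁻¹ Ω)) s‖ := by
  have hM := hΩ.crossed hσ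
  refine norm_le_of_inner_dense hΩ.cyclic (norm_nonneg _) ?_
  rintro _ ⟨x, hx, rfl⟩
  lift x to B.toStarSubalgebra using hx
  have hn := norm_action_omega hσ h x
  have e1 : (delta (s * h) ((x : H →L[ℂ] H) Ω) : Ell2 Λ H) =
      rightMul (crossed σ ⊤) (delta 1 Ω) (vOp H h)
        (delta s (((σ h x : B.toStarSubalgebra) : H →L[ℂ] H) Ω)) := by
    have e := rightMul_apply hM (x := vOp H s * piB σ (σ h x))
      (mul_mem (vOp_mem (Subgroup.mem_top s)) (piB_mem ⊤ _)) (vOp_mem (Subgroup.mem_top h))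
    rw [mul_apply_eq_comp, mul_apply_eq_comp, vOp_piB_omega, piB_vOp_omega, vOp_delta] at e
    exact e.symm
  rw [← inner_delta_left, e1, inner_rightMul_left hM (vOp_mem (Subgroup.mem_top h)), star_vOp,
    ← comm_apply (comm_rightMul hM hu (vOp_mem (Subgroup.mem_top h⁻¹))),
    rightMul_omega hM (vOp_mem (Subgroup.mem_top h⁻¹)), vOp_omega, inner_delta_left, mul_comm, ← hn,
    mul_comm]
  rw [mul_comm]
  exact norm_inner_le_norm _ _

theorem hasSum_cosetProj {S : Subgroup Λ} (ξ : Ell2 Λ H) :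
    HasSum (fun k : Λ ⧸ S => ‖cosetProj S k ξ‖ ^ 2) (‖ξ‖ ^ 2) := by
  have h : ∑' k : Λ ⧸ S, ‖cosetProj S k ξ‖ₑ ^ 2 = ‖ξ‖ₑ ^ 2 := tsum_enorm_coordProj_sq _ ξ
  simp only [enorm_sq_eq_ofReal] at h
  have hs : Summable fun k : Λ ⧸ S => ‖cosetProj S k ξ‖ ^ 2 := by
    have h2 := ENNReal.summable_toReal (h.trans_ne ENNReal.ofReal_ne_top)
    simpa only [ENNReal.toReal_ofReal (sq_nonneg _)] using h2
  rw [← ENNReal.ofReal_tsum_of_nonneg (fun _ => sq_nonneg _) hs,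
    ENNReal.ofReal_eq_ofReal_iff (tsum_nonneg fun _ => sq_nonneg _) (sq_nonneg _)] at h
  rw [← h]
  exact hs.hasSum

/-- A right `B ⋊ S`-submodule of `L²(B ⋊ Λ) = ⨁_k v_k L²(B ⋊ S)` whose projection has finite
trace is contained in countably many of the summands, and it has finite right dimension. -/
theorem hasFiniteRightDim_of_tsum_ne_top (hΩ : IsTraceVector B Ω)
    (hM : IsTraceVector (crossed σ ⊤) (delta 1 Ω)) {S : Subgroup Λ}
    (K : Submodule ℂ (Ell2 Λ H)) [K.HasOrthogonalProjection]
    (hK : ∀ y ∈ crossed σ S, ∀ ξ ∈ K, rightMul (crossed σ ⊤) (delta 1 Ω) y ξ ∈ K)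
    (hfin : ∑' k : Λ ⧸ S, ‖K.starProjection (delta k.out Ω)‖ₑ ^ 2 ≠ ⊤) :
    HasFiniteRightDim (crossed σ ⊤) (delta 1 Ω) (crossed σ S) K := by
  set I : Set (Λ ⧸ S) := Function.support fun k : Λ ⧸ S =>
    ‖K.starProjection (delta k.out Ω)‖ₑ ^ 2 with hI
  have hIc : I.Countable := Summable.countable_support_ennreal hfin
  have := hIc.to_subtype
  obtain ⟨g, hg⟩ := exists_injective_nat I
  have hproj : ∀ (k : Λ ⧸ S) (ξ : Ell2 Λ H), ξ ∈ K →
      ⟪delta k.out Ω, ξ⟫_ℂ = ⟪K.starProjection (delta k.out Ω), ξ⟫_ℂ := fun k ξ hξ => by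
    rw [Submodule.inner_starProjection_left_eq_right, Submodule.starProjection_eq_self_iff.2 hξ]
  have hzero : ∀ k ∉ I, ∀ ξ ∈ K, cosetProj S k ξ = 0 := by
    intro k hk ξ hξ
    have hk0 : K.starProjection (delta k.out Ω) = 0 := by
      simpa [hI] using hk
    have hmem := vOp_inv_cosetProj_mem (σ := σ) hΩ k ξ
    rw [← norm_eq_zero, ← norm_vOp (k.out)⁻¹, ← Submodule.starProjection_eq_self_iff.2 hmem]
    refine le_antisymm ?_ (norm_nonneg _)
    refine norm_starProjection_le_of_inner (L2_subset_closure _ _) le_rfl ?_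
    rintro _ ⟨z, hz, rfl⟩
    rw [inner_vOp_inv_cosetProj hΩ hM k hz, hproj k _ (hK _ (star_mem hz) _ hξ), hk0,
      inner_zero_left, norm_zero, zero_mul]
  let C : I → (Ell2 Λ H →L[ℂ] L2 (crossed σ S) (delta 1 Ω)) := fun k =>
    (vOp H ((k : Λ ⧸ S).out)⁻¹ * cosetProj S k).codRestrict _
      fun ξ => vOp_inv_cosetProj_mem hΩ (k : Λ ⧸ S) ξ
  let D : ℕ → (Ell2 Λ H →L[ℂ] L2 (crossed σ S) (delta 1 Ω)) := Function.extend g C 0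
  have hDg : ∀ k, D (g k) = C k := fun k => hg.extend_apply _ _ _
  have hD0 : ∀ n, (¬ ∃ k, g k = n) → D n = 0 := fun n hn => Function.extend_apply' _ _ _ hn
  have hCn : ∀ k ξ, ‖C k ξ‖ = ‖cosetProj S (k : Λ ⧸ S) ξ‖ := fun k ξ => norm_vOp _ _
  have hsum : ∀ ξ ∈ K, HasSum (fun n => ‖D n ξ‖ ^ 2) (‖ξ‖ ^ 2) := by
    intro ξ hξ
    have h1 : HasSum (fun k : I => ‖cosetProj S (k : Λ ⧸ S) ξ‖ ^ 2) (‖ξ‖ ^ 2) := by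
      refine (hasSum_subtype_iff_of_support_subset
        (f := fun k : Λ ⧸ S => ‖cosetProj S k ξ‖ ^ 2) ?_).2 (hasSum_cosetProj ξ)
      intro k hk
      by_contra hkI
      exact hk (by simp [hzero k hkI ξ hξ])
    rw [← hasSum_extend_zero hg] at h1
    convert h1 using 2 with n
    by_cases hn : ∃ k, g k = n
    · obtain ⟨k, rfl⟩ := hn
      rw [hDg, hCn, hg.extend_apply]
    · rw [hD0 n hn, Function.extend_apply' _ _ _ hn]
      simp
  let V : K →ₗᵢ[ℂ] lp (fun _ : ℕ => L2 (crossed σ S) (delta 1 Ω)) 2 :=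
    { toFun := fun ξ => ⟨fun n => D n ξ, by
        refine (memℓp_gen_iff two_toReal_pos).2 ?_
        simpa using (hsum ξ ξ.2).summable⟩
      map_add' := fun ξ η => by
        ext n : 2
        exact map_add (D n) _ _
      map_smul' := fun c ξ => by
        ext n : 2
        exact map_smul (D n) _ _
      norm_map' := fun ξ => by
        refine (sq_eq_sq₀ (norm_nonneg _) (norm_nonneg _)).1 ?_
        exact (hasSum_norm_sq _).unique (hsum ξ ξ.2) }
  refine ⟨V, ?_, ?_⟩
  · intro y hy ξ η hη n
    change (D n (η : Ell2 Λ H) : Ell2 Λ H) = rightMul _ _ y (D n (ξ : Ell2 Λ H) : Ell2 Λ H)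
    by_cases hn : ∃ k, g k = n
    · obtain ⟨k, rfl⟩ := hn
      rw [hDg, hη]
      change vOp H _ (cosetProj S (k : Λ ⧸ S) _) =
        rightMul _ _ y (vOp H _ (cosetProj S (k : Λ ⧸ S) _))
      rw [comm_apply (cosetProj_comm_rightMul hΩ hM _ hy),
        comm_apply (comm_rightMul hM (vOp_mem (Subgroup.mem_top _)) (crossed_mono le_top hy))]
    · rw [hD0 n hn]
      simp
  · have hs1 : Summable fun k : I => ‖K.starProjection (delta (k : Λ ⧸ S).out Ω)‖ ^ 2 := by
      have h2 := ENNReal.summable_toReal hfin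
      simp only [enorm_sq_eq_ofReal, ENNReal.toReal_ofReal (sq_nonneg _)] at h2
      exact h2.subtype I
    have hs2 := ((hasSum_extend_zero hg).2 hs1.hasSum).summable
    have hq : ∀ (n : ℕ) (c : ℝ), 0 ≤ c →
        (∀ ξ ∈ K, ‖⟪(D n ξ : Ell2 Λ H), delta 1 Ω⟫_ℂ‖ ≤ c * ‖ξ‖) →
        ‖(LinearMap.range V.toLinearMap).topologicalClosure.starProjection
          (lp.single 2 n (⟨delta 1 Ω, omega_mem_L2 (crossed σ S) (delta 1 Ω)⟩ :
            L2 (crossed σ S) (delta 1 Ω)))‖ ≤ c := by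
      intro n c hc h
      refine norm_starProjection_le_of_inner
        (S := (LinearMap.range V.toLinearMap : Set _)) subset_rfl hc ?_
      rintro _ ⟨ξ, rfl⟩
      have e := lp.inner_single_right (𝕜 := ℂ) (G := fun _ : ℕ => L2 (crossed σ S) (delta 1 Ω)) n
        (⟨delta 1 Ω, omega_mem_L2 (crossed σ S) (delta 1 Ω)⟩ : L2 (crossed σ S) (delta 1 Ω)) (V ξ)
      change ‖⟪V ξ, _⟫_ℂ‖ ≤ c * ‖V ξ‖
      rw [e, V.norm_map]
      exact h ξ ξ.2
    refine Summable.of_nonneg_of_le (fun _ => sq_nonneg _) (fun n => ?_) hs2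
    by_cases hn : ∃ k, g k = n
    · obtain ⟨k, rfl⟩ := hn
      rw [hg.extend_apply]
      refine pow_le_pow_left₀ (norm_nonneg _) (hq _ _ (norm_nonneg _) fun ξ hξ => ?_) 2
      have e := inner_vOp_inv_cosetProj hΩ hM (k : Λ ⧸ S) (one_mem (crossed σ S)) ξ
      rw [hDg, ← inner_conj_symm, RCLike.norm_conj]
      refine (congrArg norm e).trans_le ?_
      rw [star_one, hproj _ _ (hK _ (one_mem _) _ hξ)]
      refine (norm_inner_le_norm _ _).trans_eq ?_
      congr 2
      exact hM.ext (f := fun ξ => rightMul (crossed σ ⊤) (delta 1 Ω) 1 ξ) (g := fun ξ => ξ)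
        (by fun_prop) (by fun_prop) (fun x hx => rightMul_apply hM hx (one_mem _)) ξ
    · rw [Function.extend_apply' _ _ _ hn]
      refine (pow_le_pow_left₀ (norm_nonneg _) (hq _ 0 le_rfl fun ξ hξ => ?_) 2).trans_eq
        (by simp)
      rw [hD0 n hn]
      simp

end Cosets

/-! ### Invariant operators of finite trace -/

section FixedPoint

open Filter Topology

variable {H : Type*} [NormedAddCommGroup H] [InnerProductSpace ℂ H] [CompleteSpace H]

theorem enorm_sq_parallelogram (x y : H) :
    ‖x - y‖ₑ ^ 2 + ‖x + y‖ₑ ^ 2 = 2 * ‖x‖ₑ ^ 2 + 2 * ‖y‖ₑ ^ 2 := by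
  have h := parallelogram_law_with_norm ℂ x y
  simp only [enorm_sq_eq_ofReal]
  rw [← ENNReal.ofReal_add (sq_nonneg _) (sq_nonneg _),
    show (2 : ℝ≥0∞) = ENNReal.ofReal 2 by simp, ← ENNReal.ofReal_mul zero_le_two,
    ← ENNReal.ofReal_mul zero_le_two, ← ENNReal.ofReal_add (by positivity) (by positivity)]
  congr 1
  linarith

/-- A nonzero self-adjoint operator has a spectral subspace, on which it is bounded from below. -/
theorem exists_spectral_subspace {T : H →L[ℂ] H} (hT : IsSelfAdjoint T) (h0 : T ≠ 0) :
    ∃ K : Submodule ℂ H, IsClosed (K : Set H) ∧ K ≠ ⊥ ∧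
      (∀ X : H →L[ℂ] H, T * X = X * T → ∀ ξ ∈ K, X ξ ∈ K) ∧
      ∃ C : ℝ, ∀ [K.HasOrthogonalProjection] (ξ : H), ‖K.starProjection ξ‖ ≤ C * ‖T ξ‖ := by
  set c : ℝ := ‖T‖ / 2 with hc
  have hTn : 0 < ‖T‖ := norm_pos_iff.2 h0
  have hc0 : 0 < c := by positivity
  -- On the spectral subspace `|T| ≥ c` the operator `h(T)` is an inverse of `T`; it contains
  -- the range of `f(T) ≠ 0`.
  set f : ℝ → ℝ := fun t => max (|t| - c) 0
  set h : ℝ → ℝ := fun t => t / max (t ^ 2) (c ^ 2)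
  have hpos : ∀ t : ℝ, 0 < max (t ^ 2) (c ^ 2) := fun t => lt_max_of_lt_right (by positivity)
  have hf : Continuous f := by fun_prop
  have hh : Continuous h := continuous_id.div (by fun_prop) fun t => (hpos t).ne'
  have hf0 : cfc f T ≠ 0 := by
    intro hz
    have h1 : ‖T‖ ≤ c := by
      have : cfc (id : ℝ → ℝ) T = T := cfc_id ℝ T
      rw [← this]
      refine (norm_cfc_le_iff (𝕜 := ℝ) id T hc0.le).2 fun x hx => ?_
      have h2 : ‖f x‖ ≤ 0 := by
        refine (norm_cfc_le_iff (𝕜 := ℝ) f T le_rfl (hf.continuousOn)).1 ?_ x hx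
        rw [hz, norm_zero]
      have h3 := norm_le_zero_iff.1 h2
      have h4 : |x| - c ≤ 0 := by rw [← h3]; exact le_max_left _ _
      simpa using h4
    linarith
  set A : H →L[ℂ] H := cfc h T * T with hA
  have hAc : ∀ X : H →L[ℂ] H, T * X = X * T → A * X = X * A := fun X hX => by
    have h1 : cfc h T * X = X * cfc h T := hT.commute_cfc hX h
    rw [hA, mul_assoc, hX, ← mul_assoc, h1, mul_assoc]
  have hAs : star A = A := by
    have h1 : cfc h T * T = T * cfc h T := hT.commute_cfc (Commute.refl T) h
    have h2 : IsSelfAdjoint (cfc h T) := cfc_predicate h T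
    rw [hA, star_mul, hT.star_eq, h2.star_eq, h1]
  have hAf : A * cfc f T = cfc f T := by
    have h1 : A = cfc (fun t => h t * t) T := by
      rw [cfc_mul h (fun t => t) T hh.continuousOn continuousOn_id, cfc_id' ℝ T]
    rw [h1, ← cfc_mul _ f T (by fun_prop) hf.continuousOn]
    refine cfc_congr fun x _ => ?_
    simp only [f, h]
    rcases le_total |x| c with hx | hx
    · rw [max_eq_right (a := |x| - c) (by linarith), mul_zero]
    · have h3 : c ^ 2 ≤ x ^ 2 := by rw [← sq_abs x]; gcongr
      have h4 : x ^ 2 ≠ 0 := (lt_of_lt_of_le (by positivity) h3).ne'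
      rw [max_eq_left h3, div_mul_eq_mul_div, ← sq, div_self h4, one_mul]
  refine ⟨LinearMap.eqLocus (A : H →ₗ[ℂ] H) LinearMap.id, ?_, ?_, ?_, ‖cfc h T‖, ?_⟩
  · exact isClosed_eq A.continuous continuous_id
  · intro hbot
    refine hf0 ?_
    ext ξ
    have : cfc f T ξ ∈ LinearMap.eqLocus (A : H →ₗ[ℂ] H) LinearMap.id :=
      DFunLike.congr_fun hAf ξ
    rw [hbot] at this
    exact (Submodule.mem_bot ℂ).1 this
  · intro X hX ξ hξ
    change A ξ = ξ at hξ
    change A (X ξ) = X ξ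
    rw [comm_apply (hAc X hX), hξ]
  · intro _ ξ
    refine norm_starProjection_le_of_inner subset_closure (by positivity) fun η hη => ?_
    have h1 : A η = η := hη
    have h2 : ⟪η, ξ⟫_ℂ = ⟪η, A ξ⟫_ℂ := by
      rw [← inner_star_left, hAs, h1]
    rw [h2]
    refine (norm_inner_le_norm _ _).trans ?_
    rw [mul_comm]
    gcongr
    exact (cfc h T).le_opNorm (T ξ)

theorem cauchySeq_of_dense_span {T : ℕ → (H →L[ℂ] H)} {c : ℝ} (hc : ∀ n, ‖T n‖ ≤ c) {S : Set H}
    (hS : Dense (Submodule.span ℂ S : Set H)) (h : ∀ ξ ∈ S, CauchySeq fun n => T n ξ) (ξ : H) :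
    CauchySeq fun n => T n ξ := by
  have h1 : ∀ ξ ∈ Submodule.span ℂ S, CauchySeq fun n => T n ξ := fun ξ hξ => by
    induction hξ using Submodule.span_induction with
    | mem ξ hξ => exact h ξ hξ
    | zero => simpa using cauchySeq_const (0 : H)
    | add ξ η _ _ h1 h2 =>
      simp only [map_add]
      exact h1.add h2
    | smul a ξ _ h1 =>
      simp only [map_smul]
      exact (uniformContinuous_const_smul a).comp_cauchySeq h1
  have hc0 : 0 ≤ c := (norm_nonneg _).trans (hc 0)
  rw [Metric.cauchySeq_iff]
  intro ε hε
  obtain ⟨η, hη, hd⟩ := Metric.dense_iff.1 hS ξ (ε / (3 * (c + 1))) (by positivity)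
  rw [Metric.mem_ball, dist_comm, dist_eq_norm] at hη
  obtain ⟨N, hN⟩ := Metric.cauchySeq_iff.1 (h1 η hd) (ε / 3) (by positivity)
  have hb : ∀ n, ‖T n (ξ - η)‖ ≤ ε / 3 := fun n => by
    refine ((T n).le_of_opNorm_le (hc n) _).trans ?_
    calc c * ‖ξ - η‖ ≤ (c + 1) * (ε / (3 * (c + 1))) := by gcongr; linarith
      _ = ε / 3 := by field_simp
  refine ⟨N, fun m hm n hn => ?_⟩
  have h2 := hN m hm n hn
  rw [dist_eq_norm] at h2 ⊢
  have e : T m ξ - T n ξ = T m (ξ - η) + (T m η - T n η) - T n (ξ - η) := by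
    simp only [map_sub]; abel
  rw [e]
  have h3 := norm_sub_le (T m (ξ - η) + (T m η - T n η)) (T n (ξ - η))
  have h4 := norm_add_le (T m (ξ - η)) (T m η - T n η)
  have := hb m
  have := hb n
  linarith

/-- The value `∑_j ‖T_{π j} ζ_j‖²` of a trace on `T* T`, for a family `T = (T_i)` of operators, where
the trace on the `i`-th operators is given by the vectors `ζ_j`, `π j = i`. -/
def sqTrace {ι J : Type*} (π : J → ι) (ζ : J → H) (T : ι → (H →L[ℂ] H)) : ℝ≥0∞ :=
  ∑' j, ‖T (π j) (ζ j)‖ₑ ^ 2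

/-- Almost minimal elements of a convex set are close to each other, by the parallelogram law. -/
theorem sqTrace_sub_le {ι J : Type*} {π : J → ι} {ζ : J → H} {C : Set (ι → (H →L[ℂ] H))}
    (hC : Convex ℝ C) {m δ : ℝ≥0∞} (hmtop : m ≠ ⊤) (hmle : ∀ T ∈ C, m ≤ sqTrace π ζ T)
    {S T : ι → (H →L[ℂ] H)} (hS : S ∈ C) (hT : T ∈ C) (h1 : sqTrace π ζ S ≤ m + δ)
    (h2 : sqTrace π ζ T ≤ m + δ) : sqTrace π ζ (S - T) ≤ 4 * δ := by
  have e1 : sqTrace π ζ (S - T) + sqTrace π ζ (S + T) = 2 * sqTrace π ζ S + 2 * sqTrace π ζ T := by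
    simp only [sqTrace]
    rw [← ENNReal.tsum_add, ← ENNReal.tsum_mul_left, ← ENNReal.tsum_mul_left, ← ENNReal.tsum_add]
    exact tsum_congr fun j => enorm_sq_parallelogram _ _
  have e2 : 4 * m ≤ sqTrace π ζ (S + T) := by
    have hmid : (1 / 2 : ℝ) • S + (1 / 2 : ℝ) • T ∈ C :=
      hC hS hT (by norm_num) (by norm_num) (by norm_num)
    have h3 := hmle _ hmid
    have e3 : sqTrace π ζ (S + T) = 4 * sqTrace π ζ ((1 / 2 : ℝ) • S + (1 / 2 : ℝ) • T) := by
      simp only [sqTrace]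
      rw [← ENNReal.tsum_mul_left]
      refine tsum_congr fun j => ?_
      have e4 : ((S + T) (π j)) (ζ j) =
          (2 : ℝ) • ((((1 / 2 : ℝ) • S + (1 / 2 : ℝ) • T) (π j)) (ζ j)) := by
        simp [smul_smul]
      rw [e4, enorm_smul, mul_pow]
      congr 1
      rw [enorm_sq_eq_ofReal]
      norm_num
    rw [e3]
    gcongr
  refine ENNReal.le_of_add_le_add_right (a := 4 * m) (ENNReal.mul_ne_top (by simp) hmtop) ?_
  calc sqTrace π ζ (S - T) + 4 * m ≤ sqTrace π ζ (S - T) + sqTrace π ζ (S + T) := by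
        gcongr
    _ = 2 * sqTrace π ζ S + 2 * sqTrace π ζ T := e1
    _ ≤ 2 * (m + δ) + 2 * (m + δ) := by gcongr
    _ = 4 * δ + 4 * m := by ring

/-- A minimizing sequence for the `2`-norm in a convex set. -/
theorem exists_minimizing_sequence {ι J : Type*} {π : J → ι} {ζ : J → H}
    {C : Set (ι → (H →L[ℂ] H))} (hC : Convex ℝ C) {d : ι → (H →L[ℂ] H)} (hdC : d ∈ C)
    (hd : sqTrace π ζ d ≠ ⊤) :
    ∃ T : ℕ → ι → (H →L[ℂ] H), (∀ n, T n ∈ C) ∧ (∃ M : ℝ≥0∞, M ≠ ⊤ ∧ ∀ n, sqTrace π ζ (T n) ≤ M) ∧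
      ∀ n k, n ≤ k → ∀ S ∈ C, sqTrace π ζ S = sqTrace π ζ (T k) →
        ∀ j, ‖T n (π j) (ζ j) - S (π j) (ζ j)‖ ^ 2 ≤ 4 * (1 / ((n : ℝ) + 1)) := by
  set m : ℝ≥0∞ := ⨅ T : C, sqTrace π ζ T with hm
  have hmle : ∀ T ∈ C, m ≤ sqTrace π ζ T := fun T hT => iInf_le (fun T : C => sqTrace π ζ T) ⟨T, hT⟩
  have hmtop : m ≠ ⊤ := ne_top_of_le_ne_top hd (hmle d hdC)
  have hex : ∀ n : ℕ, ∃ T ∈ C, sqTrace π ζ T ≤ m + ENNReal.ofReal (1 / ((n : ℝ) + 1)) := fun n => by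
    have h1 : m < m + ENNReal.ofReal (1 / ((n : ℝ) + 1)) :=
      ENNReal.lt_add_right hmtop (by simp; positivity)
    obtain ⟨T, hT⟩ := iInf_lt_iff.1 h1
    exact ⟨T, T.2, hT.le⟩
  choose T hTC hT using hex
  have hmono : ∀ n k : ℕ, n ≤ k → sqTrace π ζ (T k) ≤ m + ENNReal.ofReal (1 / ((n : ℝ) + 1)) :=
    fun n k hnk => (hT k).trans (by gcongr)
  refine ⟨T, hTC, ⟨m + ENNReal.ofReal (1 / (((0 : ℕ) : ℝ) + 1)), by simp [hmtop],
    fun n => hmono 0 n n.zero_le⟩, fun n k hnk S hS hSk j => ?_⟩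
  have h3 := (ENNReal.le_tsum j).trans
    (sqTrace_sub_le hC hmtop hmle (hTC n) hS (hT n) (hSk.trans_le (hmono n k hnk)))
  rw [enorm_sq_eq_ofReal, show (4 : ℝ≥0∞) = ENNReal.ofReal 4 by simp,
    ← ENNReal.ofReal_mul (by norm_num), ENNReal.ofReal_le_ofReal_iff (by positivity)] at h3
  exact h3

/-- A pointwise limit of uniformly bounded operators that converge on a total set. -/
theorem exists_strong_limit {T : ℕ → (H →L[ℂ] H)} {c : ℝ} (hc : ∀ n, ‖T n‖ ≤ c) {S : Set H}
    (hS : Dense (Submodule.span ℂ S : Set H)) (h : ∀ ξ ∈ S, CauchySeq fun n => T n ξ) :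
    ∃ T' : H →L[ℂ] H, ∀ ξ, Tendsto (fun n => T n ξ) atTop (𝓝 (T' ξ)) := by
  choose f hf using fun ξ => cauchySeq_tendsto_of_complete (cauchySeq_of_dense_span hc hS h ξ)
  exact ⟨continuousLinearMapOfTendsto T (tendsto_pi_nhds.2 hf), hf⟩

theorem convex_commutant_family {ι : Type*} (𝓡 : ι → Set (H →L[ℂ] H)) :
    Convex ℝ {T : ι → (H →L[ℂ] H) | ∀ i, ∀ R ∈ 𝓡 i, T i * R = R * T i} := by
  intro S hS T hT a b ha hb hab i R hR
  simp only [Pi.add_apply, Pi.smul_apply, add_mul, mul_add, smul_mul_assoc, mul_smul_comm,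
    hS i R hR, hT i R hR]

theorem convex_norm_family {ι : Type*} (c : ι → ℝ) :
    Convex ℝ {T : ι → (H →L[ℂ] H) | ∀ i, ‖T i‖ ≤ c i} := by
  intro S hS T hT a b ha hb hab i
  refine (norm_add_le _ _).trans ?_
  simp only [Pi.smul_apply]
  rw [norm_smul, norm_smul, Real.norm_of_nonneg ha, Real.norm_of_nonneg hb]
  calc a * ‖S i‖ + b * ‖T i‖ ≤ a * c i + b * c i := by
        gcongr
        exacts [hS i, hT i]
    _ = c i := by rw [← add_mul, hab, one_mul]

theorem convex_star_family {ι : Type*} :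
    Convex ℝ {T : ι → (H →L[ℂ] H) | ∀ i, star (T i) = T i} := by
  intro S hS T hT a b ha hb hab i
  simp only [Pi.add_apply, Pi.smul_apply, star_add, star_smul, star_trivial]
  rw [hS i, hT i]

theorem convex_inner_family {ι : Type*} [Fintype ι] (η : ι → H) (ε : ℝ) :
    Convex ℝ {T : ι → (H →L[ℂ] H) | ε ≤ ∑ i, RCLike.re ⟪η i, T i (η i)⟫_ℂ} := by
  refine convex_halfSpace_ge (f := fun T : ι → (H →L[ℂ] H) => ∑ i, RCLike.re ⟪η i, T i (η i)⟫_ℂ)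
    ⟨fun S T => ?_, fun a T => ?_⟩ ε
  · simp only [Pi.add_apply, add_apply, inner_add_right, map_add, Finset.sum_add_distrib]
  · simp only [Pi.smul_apply, smul_apply, inner_smul_right_eq_smul, RCLike.smul_re, Finset.smul_sum]
    rfl

theorem convex_conj_family {ι : Type*} {C : Set (ι → (H →L[ℂ] H))} (hC : Convex ℝ C)
    (u : H →L[ℂ] H) : Convex ℝ {T : ι → (H →L[ℂ] H) | (fun i => star u * T i * u) ∈ C} := by
  intro S hS T hT a b ha hb hab
  have e : (fun i => star u * (a • S + b • T) i * u) =
      a • (fun i => star u * S i * u) + b • fun i => star u * T i * u := by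
    funext i
    simp only [Pi.add_apply, Pi.smul_apply, mul_add, add_mul, smul_mul_assoc, mul_smul_comm]
  change (fun i => star u * (a • S + b • T) i * u) ∈ C
  rw [e]
  exact hC hS hT ha hb hab

/-- Let `G` be a group of unitaries and let `d = (d_i)` be a finite family of self-adjoint
operators commuting with `𝓡 i`, and let the commutant of `𝓡 i` contain `G` and carry a trace, given
by the vectors `ζ_j`, `π j = i`. Averaging `d` over `G` yields a `G`-invariant family of finite
trace: it is the element of minimal `2`-norm in the closed convex hull of the orbit of `d`. -/
theorem exists_invariant_of_finite_trace {ι J : Type*} [Fintype ι] (π : J → ι) (ζ : J → H)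
    (𝓡 : ι → Set (H →L[ℂ] H)) (G : Set (H →L[ℂ] H))
    (hGone : 1 ∈ G) (hGmul : ∀ u ∈ G, ∀ v ∈ G, u * v ∈ G) (hGstar : ∀ u ∈ G, star u ∈ G)
    (hGu : ∀ u ∈ G, star u * u = 1)
    (hdense : ∀ i,
      Dense (Submodule.span ℂ {ξ : H | ∃ R ∈ 𝓡 i, ∃ j, π j = i ∧ R (ζ j) = ξ} : Set H))
    (hG : ∀ i, ∀ u ∈ G, ∀ R ∈ 𝓡 i, u * R = R * u)
    (htr : ∀ T : ι → (H →L[ℂ] H), (∀ i, ∀ R ∈ 𝓡 i, T i * R = R * T i) →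
      sqTrace π ζ (star T) = sqTrace π ζ T)
    (d : ι → (H →L[ℂ] H)) (hd : ∀ i, ∀ R ∈ 𝓡 i, d i * R = R * d i) (hds : ∀ i, star (d i) = d i)
    (hdfin : sqTrace π ζ d ≠ ⊤) (η : ι → H) (ε : ℝ)
    (hε : ∀ u ∈ G, ε ≤ ∑ i, RCLike.re ⟪u (η i), d i (u (η i))⟫_ℂ) :
    ∃ T : ι → (H →L[ℂ] H), (∀ i, ∀ R ∈ 𝓡 i, T i * R = R * T i) ∧ (∀ i, star (T i) = T i) ∧
      (∀ i, ∀ u ∈ G, T i * u = u * T i) ∧ sqTrace π ζ T ≠ ⊤ ∧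
      ε ≤ ∑ i, RCLike.re ⟪η i, T i (η i)⟫_ℂ := by
  have hmul : ∀ i, ∀ S T : H →L[ℂ] H, (∀ R ∈ 𝓡 i, S * R = R * S) → (∀ R ∈ 𝓡 i, T * R = R * T) →
      ∀ R ∈ 𝓡 i, S * T * R = R * (S * T) := fun i S T hS hT R hR => by
    rw [mul_assoc, hT R hR, ← mul_assoc, hS R hR, mul_assoc]
  have hiso : ∀ u ∈ G, ∀ ξ : H, ‖u ξ‖ = ‖ξ‖ := fun u hu ξ => by
    have h1 : ⟪u ξ, u ξ⟫_ℂ = ⟪ξ, ξ⟫_ℂ := by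
      rw [← inner_star_right, ← mul_apply_eq_comp, hGu u hu]
      rfl
    rw [inner_self_eq_norm_sq_to_K, inner_self_eq_norm_sq_to_K] at h1
    have h2 : ‖u ξ‖ ^ 2 = ‖ξ‖ ^ 2 := by exact_mod_cast h1
    exact (sq_eq_sq₀ (norm_nonneg _) (norm_nonneg _)).1 h2
  have hnorm : ∀ u ∈ G, ‖u‖ ≤ 1 := fun u hu =>
    u.opNorm_le_bound zero_le_one fun ξ => by rw [hiso u hu, one_mul]
  set orb : Set (ι → (H →L[ℂ] H)) := {T | ∃ u ∈ G, T = fun i => star u * d i * u} with horb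
  set C := convexHull ℝ orb with hC
  have hCc : Convex ℝ C := convex_convexHull ℝ orb
  have hdC : d ∈ C := subset_convexHull ℝ _ ⟨1, hGone, by simp⟩
  have hC1 : C ⊆ {T | ∀ i, ∀ R ∈ 𝓡 i, T i * R = R * T i} := by
    refine convexHull_min ?_ (convex_commutant_family 𝓡)
    rintro _ ⟨u, hu, rfl⟩ i
    exact hmul i _ _ (hmul i _ _ (hG i _ (hGstar u hu)) (hd i)) (hG i u hu)
  have hC2 : C ⊆ {T | ∀ i, star (T i) = T i} := by
    refine convexHull_min ?_ convex_star_family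
    rintro _ ⟨u, hu, rfl⟩ i
    simp only [star_mul, star_star, hds, mul_assoc]
  have hC3 : C ⊆ {T | ∀ i, ‖T i‖ ≤ ‖d i‖} := by
    refine convexHull_min ?_ (convex_norm_family fun i => ‖d i‖)
    rintro _ ⟨u, hu, rfl⟩ i
    refine (norm_mul_le _ _).trans ?_
    refine (mul_le_of_le_one_right (norm_nonneg _) (hnorm u hu)).trans ?_
    refine (norm_mul_le _ _).trans ?_
    exact mul_le_of_le_one_left (norm_nonneg _) (hnorm _ (hGstar u hu))
  have hC4 : C ⊆ {T | ε ≤ ∑ i, RCLike.re ⟪η i, T i (η i)⟫_ℂ} := by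
    refine convexHull_min ?_ (convex_inner_family η ε)
    rintro _ ⟨u, hu, rfl⟩
    refine (hε u hu).trans_eq (Finset.sum_congr rfl fun i _ => ?_)
    simp only [mul_apply_eq_comp]
    rw [inner_star_right]
  have hconj : ∀ u ∈ G, C ⊆ {T | (fun i => star u * T i * u) ∈ C} := by
    refine fun u hu => convexHull_min ?_ (convex_conj_family hCc u)
    rintro _ ⟨v, hv, rfl⟩
    refine subset_convexHull ℝ _ ⟨v * u, hGmul v hv u hu, ?_⟩
    ext1 i
    simp only [star_mul, mul_assoc]
  have hNconj : ∀ u ∈ G, ∀ T ∈ C, sqTrace π ζ (fun i => star u * T i * u) = sqTrace π ζ T := by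
    intro u hu T hT
    have e1 : sqTrace π ζ (fun i => star u * T i * u) = sqTrace π ζ fun i => T i * u := by
      refine tsum_congr fun j => ?_
      simp only [mul_apply_eq_comp, enorm_sq_eq_ofReal]
      rw [hiso _ (hGstar u hu)]
    have e2 : sqTrace π ζ (star fun i => T i * u) = sqTrace π ζ (star T) := by
      refine tsum_congr fun j => ?_
      simp only [Pi.star_apply, star_mul, mul_apply_eq_comp, enorm_sq_eq_ofReal]
      rw [hiso _ (hGstar u hu)]
    rw [e1, ← htr _ fun i => hmul i _ _ (hC1 hT i) (hG i u hu), e2, htr _ (hC1 hT)]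
  obtain ⟨T, hTC, ⟨M, hM, hTM⟩, hTclose⟩ := exists_minimizing_sequence hCc hdC hdfin
  have hlim0 : Tendsto (fun n : ℕ => √(4 * (1 / ((n : ℝ) + 1)))) atTop (𝓝 0) := by
    have := (tendsto_one_div_add_atTop_nhds_zero_nat (𝕜 := ℝ)).const_mul 4
    simpa using this.sqrt
  have hcauchy : ∀ j, CauchySeq fun n => T n (π j) (ζ j) := by
    intro j
    refine cauchySeq_of_le_tendsto_0 (fun n : ℕ => 2 * √(4 * (1 / ((n : ℝ) + 1)))) ?_
      (by simpa using hlim0.const_mul 2)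
    intro n m k hn hm
    have h1 := Real.le_sqrt_of_sq_le (hTclose k n hn _ (hTC n) rfl j)
    have h2 := Real.le_sqrt_of_sq_le (hTclose k m hm _ (hTC m) rfl j)
    rw [← dist_eq_norm] at h1 h2
    have h3 := dist_triangle_left (T n (π j) (ζ j)) (T m (π j) (ζ j)) (T k (π j) (ζ j))
    linarith
  have hlim : ∀ i, ∃ T' : H →L[ℂ] H, ∀ ξ, Tendsto (fun n => T n i ξ) atTop (𝓝 (T' ξ)) := by
    intro i
    refine exists_strong_limit (fun n => hC3 (hTC n) i) (hdense i) ?_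
    rintro _ ⟨R, hR, j, rfl, rfl⟩
    have h1 := R.uniformContinuous.comp_cauchySeq (hcauchy j)
    have e : (fun n => T n (π j) (R (ζ j))) = R ∘ fun n => T n (π j) (ζ j) :=
      funext fun n => comm_apply (hC1 (hTC n) _ R hR) _
    rw [e]
    exact h1
  choose T' hT' using hlim
  have hT'1 : ∀ i, ∀ R ∈ 𝓡 i, T' i * R = R * T' i := by
    intro i R hR
    ext ξ
    refine tendsto_nhds_unique (hT' i (R ξ)) ?_
    simp only [fun n => comm_apply (hC1 (hTC n) i R hR) ξ]
    exact (R.continuous.tendsto _).comp (hT' i ξ)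
  refine ⟨T', hT'1, fun i => ?_, fun i u hu => ?_, ?_, ?_⟩
  · ext ξ
    refine ext_inner_right ℂ fun ζ => ?_
    rw [inner_star_left]
    refine tendsto_nhds_unique (tendsto_const_nhds.inner (hT' i ζ)) ?_
    refine ((hT' i ξ).inner tendsto_const_nhds).congr fun n => ?_
    rw [← inner_star_left, hC2 (hTC n)]
  · -- `u* T' u` agrees with `T'` on the vectors `ζ_j`, because the conjugate of the minimizing
    -- sequence is minimizing as well.
    have h1 : star u * T' i * u = T' i := by
      have hS : ∀ R ∈ 𝓡 i, star u * T' i * u * R = R * (star u * T' i * u) :=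
        hmul i _ _ (hmul i _ _ (hG i _ (hGstar u hu)) (hT'1 i)) (hG i u hu)
      refine ContinuousLinearMap.ext_on (hdense i) ?_
      rintro _ ⟨R, hR, j, rfl, rfl⟩
      rw [comm_apply (hS R hR), comm_apply (hT'1 _ R hR)]
      congr 1
      have h2 : Tendsto (fun n => T n (π j) (ζ j) - (star u * T n (π j) * u) (ζ j)) atTop
          (𝓝 0) := by
        refine squeeze_zero_norm (fun n => ?_) hlim0
        exact Real.le_sqrt_of_sq_le
          (hTclose n n le_rfl _ (hconj u hu (hTC n)) (hNconj u hu _ (hTC n)) j)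
      have h3 : Tendsto (fun n => T n (π j) (ζ j) - (star u * T n (π j) * u) (ζ j)) atTop
          (𝓝 (T' (π j) (ζ j) - (star u * T' (π j) * u) (ζ j))) := by
        refine (hT' _ _).sub ?_
        exact ((star u).continuous.tendsto _).comp (hT' (π j) (u (ζ j)))
      exact (sub_eq_zero.1 (tendsto_nhds_unique h3 h2)).symm
    have h4 : u * star u = 1 := by simpa using hGu _ (hGstar u hu)
    calc T' i * u = u * star u * (T' i * u) := by rw [h4, one_mul]
      _ = u * (star u * T' i * u) := by simp only [mul_assoc]
      _ = u * T' i := by rw [h1]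
  · refine ne_top_of_le_ne_top hM ?_
    rw [sqTrace, ENNReal.tsum_eq_iSup_sum]
    refine iSup_le fun F => ?_
    refine le_of_tendsto (f := fun n => ∑ j ∈ F, ‖T n (π j) (ζ j)‖ₑ ^ 2) (x := atTop)
      (tendsto_finsetSum F fun j _ => ?_) (.of_forall fun n => ?_)
    · simp only [enorm_sq_eq_ofReal]
      exact (ENNReal.continuous_ofReal.tendsto _).comp ((hT' (π j) (ζ j)).norm.pow 2)
    · exact (ENNReal.sum_le_tsum F).trans (hTM n)
  · refine ge_of_tendsto (f := fun n => ∑ i, RCLike.re ⟪η i, T n i (η i)⟫_ℂ) (x := atTop)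
      (tendsto_finsetSum _ fun i _ => ?_) (.of_forall fun n => hC4 (hTC n))
    exact (RCLike.continuous_re.tendsto _).comp (tendsto_const_nhds.inner (hT' i (η i)))

end FixedPoint

/-! ### Unitaries that are small on small sets -/

section SmallSets

variable {H : Type*} [NormedAddCommGroup H] [InnerProductSpace ℂ H] [CompleteSpace H]

/-- A von Neumann algebra is spanned by its unitaries. -/
theorem comm_of_comm_unitary {P : VonNeumannAlgebra H} {T : H →L[ℂ] H}
    (h : ∀ u ∈ P, star u * u = 1 → u * star u = 1 → T * u = u * T) {x : H →L[ℂ] H}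
    (hx : x ∈ P) : T * x = x * T := by
  have hcl : IsClosed (P.toStarSubalgebra : Set (H →L[ℂ] H)) := by
    rw [VonNeumannAlgebra.coe_toStarSubalgebra, ← P.centralizer_centralizer]
    exact Set.isClosed_centralizer _
  have : IsClosed (P.toStarSubalgebra : Set (H →L[ℂ] H)) := hcl
  have hspan : (⟨x, hx⟩ : P.toStarSubalgebra) ∈
      Submodule.span ℂ (unitary P.toStarSubalgebra : Set P.toStarSubalgebra) := by
    rw [CStarAlgebra.span_unitary P.toStarSubalgebra]
    trivial
  have key : ∀ y ∈ Submodule.span ℂ (unitary P.toStarSubalgebra : Set P.toStarSubalgebra),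
      T * (y : H →L[ℂ] H) = y * T := fun y hy => by
    induction hy using Submodule.span_induction with
    | mem u hu =>
      have hu' := Unitary.mem_iff.1 hu
      exact h u u.2 (congrArg Subtype.val hu'.1) (congrArg Subtype.val hu'.2)
    | zero => simp
    | add a b _ _ ha hb =>
      change T * ((a : H →L[ℂ] H) + b) = ((a : H →L[ℂ] H) + b) * T
      rw [mul_add, add_mul, ha, hb]
    | smul c a _ ha =>
      change T * (c • (a : H →L[ℂ] H)) = (c • (a : H →L[ℂ] H)) * T
      rw [mul_smul_comm, smul_mul_assoc, ha]
  exact key _ hspan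

variable {Λ : Type*} [Group Λ] {B : VonNeumannAlgebra H}
  {σ : Λ →* (B.toStarSubalgebra ≃⋆ₐ[ℂ] B.toStarSubalgebra)} {Ω : H}

/-- A spectral subspace of an operator of finite trace in the commutant of `P` and of the right
action of `B ⋊ S` is a bimodule that witnesses `P ≺ B ⋊ S`. -/
theorem intertwines_of_invariant (hΩ : IsTraceVector B Ω)
    (hM : IsTraceVector (crossed σ ⊤) (delta 1 Ω)) {S : Subgroup Λ}
    {P : VonNeumannAlgebra (Ell2 Λ H)} {T : Ell2 Λ H →L[ℂ] Ell2 Λ H} (hT : RightLinear σ Ω S T)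
    (hTs : star T = T) (hT0 : T ≠ 0) (hTP : ∀ x ∈ P, T * x = x * T)
    (hfin : ∑' k : Λ ⧸ S, ‖T (delta k.out Ω)‖ₑ ^ 2 ≠ ⊤) :
    Intertwines (crossed σ ⊤) (delta 1 Ω) P.toStarSubalgebra (crossed σ S) := by
  obtain ⟨K, hKcl, hK0, hKc, C, hC⟩ := exists_spectral_subspace (T := T) hTs hT0
  have : CompleteSpace K := hKcl.completeSpace_coe
  refine ⟨K, hKcl, hK0, fun x hx ξ hξ => hKc x (hTP x hx) ξ hξ,
    fun y hy ξ hξ => hKc _ (hT y hy) ξ hξ, ?_⟩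
  refine hasFiniteRightDim_of_tsum_ne_top hΩ hM K (fun y hy ξ hξ => hKc _ (hT y hy) ξ hξ) ?_
  refine ne_top_of_le_ne_top (ENNReal.mul_ne_top (a := ENNReal.ofReal (C ^ 2))
    ENNReal.ofReal_ne_top hfin) ?_
  rw [← ENNReal.tsum_mul_left]
  refine ENNReal.tsum_le_tsum fun k => ?_
  rw [enorm_sq_eq_ofReal, enorm_sq_eq_ofReal, ← ENNReal.ofReal_mul (sq_nonneg _), ← mul_pow]
  exact ENNReal.ofReal_le_ofReal (pow_le_pow_left₀ (norm_nonneg _) (hC _) 2)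

/-- The basis `(δ_k ⊗ Ω)_k` of `L²(B ⋊ Λ)` over `B ⋊ S_i`, simultaneously for a family of subgroups. -/
def cosetBasis {ι : Type*} (S : ι → Subgroup Λ) (Ω : H) (j : Σ i, Λ ⧸ S i) : Ell2 Λ H :=
  delta j.2.out Ω

theorem sqTrace_coset_star (hΩ : IsTraceVector B Ω)
    (hM : IsTraceVector (crossed σ ⊤) (delta 1 Ω)) {ι : Type*} {S : ι → Subgroup Λ}
    {X : ι → (Ell2 Λ H →L[ℂ] Ell2 Λ H)} (hX : ∀ i, RightLinear σ Ω (S i) (X i)) :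
    sqTrace Sigma.fst (cosetBasis S Ω) (star X) = sqTrace Sigma.fst (cosetBasis S Ω) X := by
  rw [sqTrace, sqTrace, ENNReal.tsum_sigma', ENNReal.tsum_sigma']
  refine tsum_congr fun i => ?_
  have h := tsum_coset_star hΩ hM (hX i)
  simp only [cosetBasis, Pi.star_apply]
  exact h

theorem sqTrace_cosetProj_ne_top {ι : Type*} [Fintype ι] (S : ι → Subgroup Λ) (g : ι → Λ) :
    sqTrace Sigma.fst (cosetBasis S Ω) (fun i => cosetProj (S i) (g i : Λ ⧸ S i)) ≠ ⊤ := by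
  rw [sqTrace, ENNReal.tsum_sigma', tsum_fintype]
  refine ENNReal.sum_ne_top.2 fun i _ => ?_
  -- Only the coset of `g` contributes.
  rw [tsum_eq_single (g i : Λ ⧸ S i)]
  · exact ENNReal.pow_ne_top enorm_ne_top
  · intro k hk
    simp only [cosetBasis, cosetProj]
    rw [coordProj_delta_of_notMem]
    · simp
    · intro h
      refine hk ?_
      rw [← QuotientGroup.out_eq' k]
      exact h

/-- If `P` does not intertwine into any of finitely many `B ⋊ S`, then a single unitary of `P` is
almost orthogonal to finitely many prescribed cosets `g S h`. -/
theorem exists_unitary_cosetProj_lt (hΩ : IsTraceVector B Ω)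
    (hσ : ∀ (s : Λ) (b : B.toStarSubalgebra),
      ⟪Ω, ((σ s b : B.toStarSubalgebra) : H →L[ℂ] H) Ω⟫_ℂ = ⟪Ω, (b : H →L[ℂ] H) Ω⟫_ℂ)
    {P : VonNeumannAlgebra (Ell2 Λ H)} (hPM : P ≤ crossed σ ⊤)
    {ι : Type*} [Fintype ι] (S : ι → Subgroup Λ) (g h : ι → Λ)
    (hT : ∀ i, ¬ Intertwines (crossed σ ⊤) (delta 1 Ω) P.toStarSubalgebra (crossed σ (S i)))
    {ε : ℝ} (hε : 0 < ε) :
    ∃ u ∈ P, star u * u = 1 ∧ u * star u = 1 ∧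
      ∑ i, ‖cosetProj (S i) (g i : Λ ⧸ S i) (u (delta (h i)⁻¹ Ω))‖ ^ 2 < ε := by
  have hM := hΩ.crossed hσ
  by_contra! hcon
  refine absurd (exists_invariant_of_finite_trace
    Sigma.fst (cosetBasis S Ω) (fun p => {R | ∃ z ∈ crossed σ (S p),
      R = rightMul (crossed σ ⊤) (delta 1 Ω) z})
    {u | u ∈ P ∧ star u * u = 1 ∧ u * star u = 1}
    ⟨one_mem P, by simp, by simp⟩ ?_ ?_ (fun u hu => hu.2.1) ?_ ?_ ?_
    (fun p => cosetProj (S p) (g p : Λ ⧸ S p)) ?_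
    (fun p => star_coordProj _) ?_ (fun p => delta (h p)⁻¹ Ω) ε ?_) ?_
  rotate_right
  · rintro ⟨X, hX1, hX2, hX3, hX4, hX5⟩
    obtain ⟨p, hp⟩ : ∃ p, X p ≠ 0 := by
      by_contra! h0
      simp only [h0] at hX5
      simp at hX5
      linarith
    refine hT p (intertwines_of_invariant hΩ hM (T := X p) (fun z hz => hX1 p _ ⟨z, hz, rfl⟩)
      (hX2 p) hp (fun x hx => comm_of_comm_unitary (fun u hu h1 h2 => hX3 p u ⟨hu, h1, h2⟩) hx) ?_)
    refine ne_top_of_le_ne_top hX4 ?_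
    rw [sqTrace, ENNReal.tsum_sigma']
    exact ENNReal.le_tsum p
  · rintro u ⟨hu, hu1, hu2⟩ v ⟨hv, hv1, hv2⟩
    refine ⟨mul_mem hu hv, ?_, ?_⟩
    · rw [star_mul, mul_assoc, ← mul_assoc (star u), hu1, one_mul, hv1]
    · rw [star_mul, mul_assoc, ← mul_assoc v, hv2, one_mul, hu2]
  · rintro u ⟨hu, hu1, hu2⟩
    exact ⟨star_mem hu, by rwa [star_star], by rwa [star_star]⟩
  · intro p
    refine (dense_span_rightMul_delta hΩ hM (S p)).mono
      (Submodule.span_mono ?_)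
    rintro _ ⟨z, hz, k, rfl⟩
    exact ⟨_, ⟨z, hz, rfl⟩, ⟨p, k⟩, rfl, rfl⟩
  · rintro p u ⟨hu, -, -⟩ _ ⟨z, hz, rfl⟩
    exact comm_rightMul hM (hPM hu) (crossed_mono le_top hz)
  · intro X hX
    exact sqTrace_coset_star hΩ hM fun p z hz => hX p _ ⟨z, hz, rfl⟩
  · rintro p _ ⟨z, hz, rfl⟩
    exact cosetProj_comm_rightMul hΩ hM _ hz
  · exact sqTrace_cosetProj_ne_top _ _
  · rintro u ⟨hu, hu1, hu2⟩
    refine (hcon u hu hu1 hu2).trans_eq ?_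
    refine Finset.sum_congr rfl fun p _ => ?_
    rw [cosetProj, inner_coordProj_self]
    exact (RCLike.ofReal_re (K := ℂ) _).symm

/-- If `P` does not intertwine into any `B ⋊ S`, `S ∈ 𝒢`, then `P` contains unitaries with
arbitrarily small Fourier coefficients on a given small set. -/
theorem exists_unitary_coordProj_lt (hΩ : IsTraceVector B Ω)
    (hσ : ∀ (s : Λ) (b : B.toStarSubalgebra),
      ⟪Ω, ((σ s b : B.toStarSubalgebra) : H →L[ℂ] H) Ω⟫_ℂ = ⟪Ω, (b : H →L[ℂ] H) Ω⟫_ℂ)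
    {P : VonNeumannAlgebra (Ell2 Λ H)} (hPM : P ≤ crossed σ ⊤) {𝒢 : Set (Subgroup Λ)}
    (hP : ∀ S ∈ 𝒢,
      ¬ Intertwines (crossed σ ⊤) (delta 1 Ω) P.toStarSubalgebra (crossed σ S))
    {F : Set Λ} (hF : SmallRelativeTo 𝒢 F) {ε : ℝ} (hε : 0 < ε) :
    ∃ u ∈ P, star u * u = 1 ∧ u * star u = 1 ∧ ‖coordProj F (u (delta 1 Ω))‖ ^ 2 < ε := by
  classical
  obtain ⟨T, hT, hFT⟩ := hF
  obtain ⟨u, hu, hu1, hu2, hlt⟩ := exists_unitary_cosetProj_lt hΩ hσ hPM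
    (fun p : T => (p : Λ × Subgroup Λ × Λ).2.1) (fun p => (p : Λ × Subgroup Λ × Λ).1)
    (fun p => (p : Λ × Subgroup Λ × Λ).2.2) (fun p => hP _ (hT p p.2)) hε
  rw [Finset.sum_coe_sort T fun p =>
    ‖cosetProj p.2.1 (p.1 : Λ ⧸ p.2.1) (u (delta p.2.2⁻¹ Ω))‖ ^ 2] at hlt
  refine ⟨u, hu, hu1, hu2, lt_of_le_of_lt ?_ hlt⟩
  have key : ‖coordProj F (u (delta 1 Ω))‖ₑ ^ 2 ≤
      ∑ p ∈ T, ‖cosetProj p.2.1 (p.1 : Λ ⧸ p.2.1) (u (delta p.2.2⁻¹ Ω))‖ₑ ^ 2 := by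
    have e : ∀ p : Λ × Subgroup Λ × Λ,
        ‖cosetProj p.2.1 (p.1 : Λ ⧸ p.2.1) (u (delta p.2.2⁻¹ Ω))‖ₑ ^ 2 =
        ∑' s : Λ, ‖(cosetProj p.2.1 (p.1 : Λ ⧸ p.2.1) (u (delta p.2.2⁻¹ Ω)))
          (s * p.2.2⁻¹)‖ₑ ^ 2 := fun p => by
      rw [enorm_sq_eq_tsum]
      exact ((Equiv.mulRight p.2.2⁻¹).tsum_eq fun t =>
        ‖(cosetProj p.2.1 (p.1 : Λ ⧸ p.2.1) (u (delta p.2.2⁻¹ Ω))) t‖ₑ ^ 2).symm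
    rw [enorm_sq_eq_tsum, Finset.sum_congr rfl fun p _ => e p,
      ← Summable.tsum_finsetSum fun _ _ => ENNReal.summable]
    refine ENNReal.tsum_le_tsum fun s => ?_
    rw [coordProj_apply]
    split_ifs with hs
    · obtain ⟨p, hp, k, hk, rfl⟩ := hFT s hs
      refine le_trans ?_ (Finset.single_le_sum (fun _ _ => zero_le) hp)
      rw [mul_inv_cancel_right, cosetProj, coordProj_apply, if_pos, enorm_sq_eq_ofReal,
        enorm_sq_eq_ofReal]
      · exact ENNReal.ofReal_le_ofReal
          (pow_le_pow_left₀ (norm_nonneg _) (norm_apply_mul_le hΩ hσ (hPM hu) _ _) 2)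
      · exact QuotientGroup.eq.2 (by simpa using hk)
    · simp
  simp only [enorm_sq_eq_ofReal] at key
  rwa [← ENNReal.ofReal_sum_of_nonneg fun _ _ => sq_nonneg _,
    ENNReal.ofReal_le_ofReal_iff (Finset.sum_nonneg fun _ _ => sq_nonneg _)] at key

end SmallSets

/-! ### Unitaries of an intertwined subalgebra do not tend to zero -/

section Intertwining

open Filter Topology

variable {H : Type*} [NormedAddCommGroup H] [InnerProductSpace ℂ H] [CompleteSpace H]

theorem exists_span_norm_sub_lt {D : Set (H →L[ℂ] H)} {Ω : H}
    (hD : Dense (Submodule.span ℂ {ξ : H | ∃ a ∈ D, a Ω = ξ} : Set H)) (ξ : H) {δ : ℝ}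
    (hδ : 0 < δ) : ∃ a ∈ Submodule.span ℂ D, ‖ξ - a Ω‖ < δ := by
  obtain ⟨η, hη, hmem⟩ := Metric.dense_iff.1 hD ξ δ hδ
  have hle : Submodule.span ℂ {ξ : H | ∃ a ∈ D, a Ω = ξ} ≤
      (Submodule.span ℂ D).map (ContinuousLinearMap.apply ℂ H Ω).toLinearMap := by
    rw [Submodule.span_le]
    rintro _ ⟨a, ha, rfl⟩
    exact ⟨a, Submodule.subset_span ha, rfl⟩
  obtain ⟨a, ha, rfl⟩ := hle hmem
  rw [Metric.mem_ball, dist_comm, dist_eq_norm] at hη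
  exact ⟨a, ha, hη⟩

theorem tendsto_zero_of_span {ι : Type*} {l : Filter ι} {D : Set (H →L[ℂ] H)}
    {u : ι → (H →L[ℂ] H)} {Ω : H} {p : H →L[ℂ] H}
    (h : ∀ a ∈ D, ∀ b ∈ D, Tendsto (fun i => p (star a (u i (b Ω)))) l (𝓝 0))
    {a b : H →L[ℂ] H} (ha : a ∈ Submodule.span ℂ D) (hb : b ∈ Submodule.span ℂ D) :
    Tendsto (fun i => p (star a (u i (b Ω)))) l (𝓝 0) := by
  have h1 : ∀ a ∈ D, ∀ b ∈ Submodule.span ℂ D,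
      Tendsto (fun i => p (star a (u i (b Ω)))) l (𝓝 0) := fun a ha b hb => by
    induction hb using Submodule.span_induction with
    | mem b hb => exact h a ha b hb
    | zero => simpa using tendsto_const_nhds
    | add b c _ _ hb hc => simpa using hb.add hc
    | smul t b _ hb => simpa using hb.const_smul t
  induction ha using Submodule.span_induction with
  | mem a ha => exact h1 a ha b hb
  | zero => simpa using tendsto_const_nhds
  | add a c _ _ ha hc => simpa [star_add] using ha.add hc
  | smul t a _ ha => simpa [star_smul] using ha.const_smul (star t)

/-- If `P ≺_N R`, then no net of unitaries of `P` converges to zero relative to `R`. With the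
right-bounded vectors `v_n = V* (δ_n ⊗ Ω)`, the matrix of `V u V*` has the entries
`E_R(v_n* u v_m)`. They tend to zero along such a net, whereas the sum of the squares of their
`2`-norms over `n` is always `‖v_m‖²`; since the `n`-th one is at most `‖v_n‖²`, which is
summable, this is a contradiction. -/
theorem Intertwines.not_tendsto_zero {N R : VonNeumannAlgebra H} {Ω : H}
    (hN : IsTraceVector N Ω) {P : StarSubalgebra ℂ (H →L[ℂ] H)} (hPN : ∀ x ∈ P, x ∈ N)
    (hRN : R ≤ N) (hint : Intertwines N Ω P R) {ι : Type*} {l : Filter ι} [l.NeBot]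
    {u : ι → (H →L[ℂ] H)} (hu : ∀ i, u i ∈ P) (hu1 : ∀ i, star (u i) * u i = 1)
    (hu2 : ∀ i, u i * star (u i) = 1) {D : Set (H →L[ℂ] H)} (hDN : ∀ a ∈ D, a ∈ N)
    (hD : Dense (Submodule.span ℂ {ξ : H | ∃ a ∈ D, a Ω = ξ} : Set H))
    (hlim : ∀ a ∈ D, ∀ b ∈ D,
      Tendsto (fun i => (L2 R Ω).starProjection (star a (u i (b Ω)))) l (𝓝 0)) : False := by
  obtain ⟨K, hKcl, hK0, hKP, hKR, V, hV, hsum⟩ := hint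
  have : CompleteSpace K := hKcl.completeSpace_coe
  have hsp : ∀ a ∈ Submodule.span ℂ D, a ∈ N := fun a ha =>
    (Submodule.span_le (p := N.toStarSubalgebra.toSubalgebra.toSubmodule)).2 hDN ha
  let C : ℕ → K → H := fun n ξ => ((V ξ : ∀ _ : ℕ, L2 R Ω) n : H)
  have hCmem : ∀ n ξ, C n ξ ∈ L2 R Ω := fun n ξ => ((V ξ : ∀ _ : ℕ, L2 R Ω) n).2
  have hCsum : ∀ ξ : K, HasSum (fun n => ‖C n ξ‖ ^ 2) (‖ξ‖ ^ 2) := fun ξ => by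
    rw [← V.norm_map ξ]
    exact hasSum_norm_sq (V ξ)
  have hCle : ∀ n (ξ : K), ‖C n ξ‖ ≤ ‖ξ‖ := fun n ξ =>
    (sq_le_sq₀ (norm_nonneg _) (norm_nonneg _)).1
      (le_hasSum (hCsum ξ) n fun _ _ => sq_nonneg _)
  set q := (LinearMap.range V.toLinearMap).topologicalClosure
  let w : ℕ → lp (fun _ : ℕ => L2 R Ω) 2 := fun n =>
    lp.single 2 n (⟨Ω, omega_mem_L2 R Ω⟩ : L2 R Ω)
  have hw : ∀ n (ξ : K), ⟪w n, V ξ⟫_ℂ = ⟪Ω, C n ξ⟫_ℂ := fun n ξ =>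
    lp.inner_single_left (𝕜 := ℂ) (G := fun _ : ℕ => L2 R Ω) n _ (V ξ)
  obtain ⟨v, hv⟩ : ∃ v : ℕ → K, ∀ n (ξ : K), ⟪(v n : H), (ξ : H)⟫_ℂ = ⟪Ω, C n ξ⟫_ℂ := by
    refine ⟨fun n => ContinuousLinearMap.adjoint V.toContinuousLinearMap (w n), fun n ξ => ?_⟩
    rw [← hw]
    exact ContinuousLinearMap.adjoint_inner_left V.toContinuousLinearMap ξ (w n)
  have hvsum : Summable fun n => ‖v n‖ ^ 2 := by
    refine Summable.of_nonneg_of_le (fun _ => sq_nonneg _) (fun n => ?_) hsum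
    refine pow_le_pow_left₀ (norm_nonneg _) ?_ 2
    have h1 : ⟪w n, V (v n)⟫_ℂ = ⟪q.starProjection (w n), V (v n)⟫_ℂ := by
      rw [Submodule.inner_starProjection_left_eq_right, Submodule.starProjection_eq_self_iff.2]
      exact Submodule.le_topologicalClosure _ ⟨v n, rfl⟩
    rw [hw, ← hv, inner_self_eq_norm_sq_to_K] at h1
    have h2 := congrArg norm h1
    rw [norm_pow, RCLike.norm_ofReal, abs_norm] at h2
    have h3 := h2.trans_le (norm_inner_le_norm (𝕜 := ℂ) _ _)
    rw [V.norm_map, sq] at h3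
    rcases (norm_nonneg (v n)).eq_or_lt with h0 | h0
    · rw [← h0]
      exact norm_nonneg _
    · exact le_of_mul_le_mul_right h3 h0
  have hF : ∀ n (ξ : K), ∀ z ∈ R, ⟪z Ω, C n ξ⟫_ℂ = ⟪(v n : H), rightMul N Ω (star z) ξ⟫_ℂ := by
    intro n ξ z hz
    have h1 := hV _ (star_mem hz) ξ ⟨_, hKR _ (star_mem hz) ξ ξ.2⟩ rfl n
    rw [hv n ⟨_, hKR _ (star_mem hz) ξ ξ.2⟩, ← rightMul_omega hN (hRN hz),
      inner_rightMul_left hN (hRN hz)]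
    exact congrArg (fun η => ⟪Ω, η⟫_ℂ) h1.symm
  have hC_le : ∀ n (ξ : K) (c : ℝ), 0 ≤ c →
      (∀ z ∈ R, ‖⟪(v n : H), rightMul N Ω (star z) ξ⟫_ℂ‖ ≤ c * ‖z Ω‖) → ‖C n ξ‖ ≤ c := by
    intro n ξ c hc h
    rw [← Submodule.starProjection_eq_self_iff.2 (hCmem n ξ)]
    refine norm_starProjection_le_of_inner (L2_subset_closure R Ω) hc ?_
    rintro _ ⟨z, hz, rfl⟩
    rw [hF n ξ z hz]
    exact h z hz
  have hvb : ∀ n, ∀ z ∈ R, ‖rightMul N Ω z (v n)‖ ≤ ‖z Ω‖ := by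
    intro n z hz
    set ξ : K := ⟨rightMul N Ω z (v n), hKR z hz _ (v n).2⟩ with hξ
    have h1 : ⟪rightMul N Ω z (v n), (ξ : H)⟫_ℂ = ⟪z Ω, C n ξ⟫_ℂ := by
      rw [hF n ξ z hz, inner_rightMul_left hN (hRN hz)]
    rw [inner_self_eq_norm_sq_to_K] at h1
    have h2 := congrArg norm h1
    rw [norm_pow, RCLike.norm_ofReal, abs_norm] at h2
    have h3 := h2.trans_le (norm_inner_le_norm (𝕜 := ℂ) _ _)
    have h4 : ‖C n ξ‖ ≤ ‖rightMul N Ω z (v n)‖ := hCle n ξ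
    rcases (norm_nonneg (rightMul N Ω z (v n))).eq_or_lt with h0 | h0
    · rw [← h0]
      exact norm_nonneg _
    · refine le_of_mul_le_mul_right ?_ h0
      rw [← sq]
      exact h3.trans (by gcongr)
  obtain ⟨m, hm⟩ : ∃ m, v m ≠ 0 := by
    by_contra! h0
    refine hK0 ((Submodule.eq_bot_iff K).2 fun ξ hξ => ?_)
    have h1 : ∀ n, C n ⟨ξ, hξ⟩ = 0 := fun n => norm_le_zero_iff.1 <|
      hC_le n ⟨ξ, hξ⟩ 0 le_rfl fun z _ => by rw [h0]; simp
    have h2 : HasSum (fun _ : ℕ => (0 : ℝ)) (‖(⟨ξ, hξ⟩ : K)‖ ^ 2) := by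
      simpa [h1] using hCsum ⟨ξ, hξ⟩
    simpa using h2.unique hasSum_zero
  have hiso : ∀ i ξ, ‖u i ξ‖ = ‖ξ‖ := fun i ξ => by
    have h1 : ⟪u i ξ, u i ξ⟫_ℂ = ⟪ξ, ξ⟫_ℂ := by
      rw [← inner_star_right, ← mul_apply_eq_comp, hu1]
      rfl
    rw [inner_self_eq_norm_sq_to_K, inner_self_eq_norm_sq_to_K] at h1
    have h2 : ‖u i ξ‖ ^ 2 = ‖ξ‖ ^ 2 := by exact_mod_cast h1
    exact (sq_eq_sq₀ (norm_nonneg _) (norm_nonneg _)).1 h2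
  have hiso' : ∀ i ξ, ‖star (u i) ξ‖ = ‖ξ‖ := fun i ξ => by
    rw [← hiso i, ← mul_apply_eq_comp, hu2]
    rfl
  have huR : ∀ i, ∀ z ∈ R, u i * rightMul N Ω z = rightMul N Ω z * u i := fun i z hz =>
    comm_rightMul hN (hPN _ (hu i)) (hRN hz)
  let uv : ι → K := fun i => ⟨u i (v m), hKP _ (hu i) _ (v m).2⟩
  have hbound : ∀ i n, ‖C n (uv i)‖ ≤ ‖v n‖ := by
    intro i n
    refine hC_le n (uv i) _ (norm_nonneg _) fun z hz => ?_
    set ξ : K := ⟨star (u i) (v n), hKP _ (star_mem (hu i)) _ (v n).2⟩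
    have h1 : ⟪(v n : H), rightMul N Ω (star z) (uv i)⟫_ℂ =
        (starRingEnd ℂ) ⟪star z Ω, C m ξ⟫_ℂ := by
      rw [hF m ξ _ (star_mem hz), inner_conj_symm, star_star,
        inner_rightMul_left hN (hRN hz)]
      change ⟪(v n : H), rightMul N Ω (star z) (u i (v m))⟫_ℂ =
        ⟪star (u i) (v n), rightMul N Ω (star z) (v m)⟫_ℂ
      rw [inner_star_left, comm_apply (huR i _ (star_mem hz))]
    rw [h1, RCLike.norm_conj]
    refine (norm_inner_le_norm _ _).trans ?_
    rw [norm_star_apply hN (hRN hz), mul_comm]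
    gcongr
    exact (hCle m ξ).trans_eq (hiso' i _)
  have htend : ∀ n, Tendsto (fun i => ‖C n (uv i)‖ ^ 2) l (𝓝 0) := by
    intro n
    suffices h : Tendsto (fun i => ‖C n (uv i)‖) l (𝓝 0) by simpa using h.pow 2
    rw [Metric.tendsto_nhds]
    intro ε hε
    obtain ⟨b, hb, hbδ⟩ := exists_span_norm_sub_lt hD (v m : H) (δ := ε / 4) (by positivity)
    obtain ⟨a, ha, haδ⟩ := exists_span_norm_sub_lt hD (v n : H) (δ := ε / 4 / (‖b‖ + 1))
      (by positivity)
    have hab := tendsto_zero_of_span hlim ha hb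
    filter_upwards [Metric.tendsto_nhds.1 hab (ε / 4) (by positivity)] with i hi
    rw [dist_zero_right] at hi ⊢
    rw [norm_norm]
    refine lt_of_le_of_lt (b := ε / 4 + ε / 4 + ε / 4) ?_ (by linarith)
    refine hC_le n (uv i) _ (by positivity) fun z hz => ?_
    -- Replace first `v_m` and then `v_n` by the approximations `b Ω` and `a Ω`.
    have e : ⟪(v n : H), rightMul N Ω (star z) (uv i)⟫_ℂ =
        ⟪rightMul N Ω z (v n), u i ((v m : H) - b Ω)⟫_ℂ +
          ⟪(v n : H) - a Ω, u i (b (star z Ω))⟫_ℂ +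
          ⟪z Ω, (L2 R Ω).starProjection (star a (u i (b Ω)))⟫_ℂ := by
      have e1 : ⟪z Ω, (L2 R Ω).starProjection (star a (u i (b Ω)))⟫_ℂ =
          ⟪a Ω, u i (b (star z Ω))⟫_ℂ := by
        rw [← Submodule.inner_starProjection_left_eq_right,
          Submodule.starProjection_eq_self_iff.2 (mem_L2 hz Ω), inner_star_right,
          ← rightMul_apply hN (hsp a ha) (hRN hz), inner_rightMul_left hN (hRN hz),
          ← comm_apply (huR i _ (star_mem hz)),
          rightMul_apply hN (hsp b hb) (hRN (star_mem hz))]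
      have e2 : ⟪rightMul N Ω z (v n), u i (b Ω)⟫_ℂ = ⟪(v n : H), u i (b (star z Ω))⟫_ℂ := by
        rw [inner_rightMul_left hN (hRN hz), ← comm_apply (huR i _ (star_mem hz)),
          rightMul_apply hN (hsp b hb) (hRN (star_mem hz))]
      rw [e1, map_sub, inner_sub_right, inner_sub_left, e2, inner_rightMul_left hN (hRN hz)]
      change ⟪(v n : H), rightMul N Ω (star z) (u i (v m))⟫_ℂ = _
      ring
    rw [e, add_mul, add_mul]
    refine (norm_add₃_le).trans (add_le_add (add_le_add ?_ ?_) ?_)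
    · refine (norm_inner_le_norm _ _).trans ?_
      rw [hiso, mul_comm]
      gcongr
      exact hvb n z hz
    · refine (norm_inner_le_norm _ _).trans ?_
      rw [hiso]
      have h1 := b.le_opNorm (star z Ω)
      rw [norm_star_apply hN (hRN hz)] at h1
      calc ‖(v n : H) - a Ω‖ * ‖b (star z Ω)‖ ≤ ε / 4 / (‖b‖ + 1) * ((‖b‖ + 1) * ‖z Ω‖) := by
            gcongr
            exact h1.trans (by gcongr; linarith)
        _ = ε / 4 * ‖z Ω‖ := by field_simp
    · refine (norm_inner_le_norm _ _).trans ?_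
      rw [mul_comm]
      gcongr
  have hconst : Tendsto (fun _ : ι => ‖v m‖ ^ 2) l (𝓝 0) := by
    have h1 := tendsto_tsum_of_dominated_convergence (𝓕 := l) hvsum htend
      (.of_forall fun i n => by
        rw [Real.norm_of_nonneg (sq_nonneg _)]
        exact pow_le_pow_left₀ (norm_nonneg _) (hbound i n) 2)
    rw [tsum_zero] at h1
    refine h1.congr fun i => ?_
    rw [(hCsum (uv i)).tsum_eq]
    exact congrArg (· ^ 2) (hiso i _)
  have := tendsto_nhds_unique hconst tendsto_const_nhds
  exact hm (norm_eq_zero.1 (by simpa using this.symm))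

end Intertwining

/-! ### Fourier expansion of the dual coaction -/

section Coaction

open Filter Topology

variable {H : Type*} [NormedAddCommGroup H] [InnerProductSpace ℂ H] [CompleteSpace H]
  {Λ : Type*} [Group Λ]

/-- If `ξ = ∑ₛ δₛ ⊗ ξₛ`, then `(1 ⊗ T) W (ξ ⊗ η)` is the orthogonal sum of the vectors
`(δₛ ⊗ ξₛ) ⊗ T vₛ η`. -/
theorem hasSum_norm_sq_otmul_dualUnitary (T : Ell2 Λ H →L[ℂ] Ell2 Λ H) (ξ η : Ell2 Λ H) :
    HasSum (fun s => ‖ξ s‖ ^ 2 * ‖T (vOp H s η)‖ ^ 2)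
      (‖otmul 1 T (dualUnitary Λ H (vtmul ξ η))‖ ^ 2) := by
  classical
  set Z := otmul 1 T (dualUnitary Λ H (vtmul ξ η)) with hZ
  set ζ : Λ → HTensor (Ell2 Λ H) (Ell2 Λ H) := fun s => vtmul (delta s (ξ s)) (T (vOp H s η))
    with hζ
  have hsum : HasSum ζ Z := by
    have h := (hasSum_delta ξ).mapL (((otmul 1 T).comp
      (dualUnitary Λ H).toLinearIsometry.toContinuousLinearMap).comp (tensorRight η))
    refine Eq.mp (congrArg (HasSum · Z) (funext fun s => ?_)) h
    change otmul 1 T (dualUnitary Λ H (vtmul (delta s (ξ s)) η)) = _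
    rw [dualUnitary_apply, otmul_vtmul]
    rfl
  have hdiag : ∀ s, ⟪Z, ζ s⟫_ℂ = ((‖ξ s‖ ^ 2 * ‖T (vOp H s η)‖ ^ 2 : ℝ) : ℂ) := by
    intro s
    have h1 := hsum.mapL (innerSL ℂ (ζ s))
    have h2 : ∀ t, t ≠ s → innerSL ℂ (ζ s) (ζ t) = 0 := fun t ht => by
      rw [innerSL_apply_apply, hζ, inner_vtmul, inner_delta_left, delta_apply, if_neg ht.symm,
        inner_zero_right, zero_mul]
    have h3 := h1.unique (hasSum_single s h2)
    rw [innerSL_apply_apply, innerSL_apply_apply, inner_self_eq_norm_sq_to_K] at h3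
    rw [← inner_conj_symm, h3, hζ, norm_vtmul, (delta s).norm_map]
    simp [mul_pow]
  have h := hsum.mapL (innerSL ℂ Z)
  simp only [innerSL_apply_apply, hdiag, inner_self_eq_norm_sq_to_K] at h
  exact Complex.hasSum_ofReal.1 (by simpa using h)

/-- Commutation with `Δ(x) = W (x ⊗ 1) W*`, expressed by `T' = W* T W`. -/
theorem dualCoaction_mul_comm_iff {x : Ell2 Λ H →L[ℂ] Ell2 Λ H}
    {T T' : HTensor (Ell2 Λ H) (Ell2 Λ H) →L[ℂ] HTensor (Ell2 Λ H) (Ell2 Λ H)}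
    (hT : ∀ ζ, dualUnitary Λ H (T' ζ) = T (dualUnitary Λ H ζ)) :
    dualCoaction Λ H x * T = T * dualCoaction Λ H x ↔ otmul x 1 * T' = T' * otmul x 1 := by
  constructor
  · intro h
    ext ζ
    apply (dualUnitary Λ H).injective
    have := comm_apply h (dualUnitary Λ H ζ)
    rw [dualCoaction_apply, ← hT, ← hT, dualCoaction_apply] at this
    exact this
  · intro h
    ext ζ
    obtain ⟨ζ, rfl⟩ := (dualUnitary Λ H).surjective ζ
    have := congrArg (dualUnitary Λ H) (comm_apply h ζ)
    rw [hT, ← dualCoaction_apply, hT, ← dualCoaction_apply] at this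
    exact this

variable {B : VonNeumannAlgebra H} {σ : Λ →* (B.toStarSubalgebra ≃⋆ₐ[ℂ] B.toStarSubalgebra)}

/-- The dual coaction takes values in `M ⊗ M`, `M = B ⋊ Λ`. -/
theorem dualCoaction_mem {x : Ell2 Λ H →L[ℂ] Ell2 Λ H} (hx : x ∈ crossed σ (⊤ : Subgroup Λ)) :
    dualCoaction Λ H x ∈ vnTensor (crossed σ (⊤ : Subgroup Λ)) (crossed σ ⊤) := by
  refine mem_of_comm_commutant fun T hT => ?_
  let T' : HTensor (Ell2 Λ H) (Ell2 Λ H) →L[ℂ] HTensor (Ell2 Λ H) (Ell2 Λ H) :=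
    ((dualUnitary Λ H).symm.toLinearIsometry.toContinuousLinearMap.comp T).comp
      (dualUnitary Λ H).toLinearIsometry.toContinuousLinearMap
  have hT' : ∀ ζ, dualUnitary Λ H (T' ζ) = T (dualUnitary Λ H ζ) := fun ζ =>
    (dualUnitary Λ H).apply_symm_apply _
  have hb : ∀ b, otmul (piB σ b) 1 * T' = T' * otmul (piB σ b) 1 := fun b => by
    rw [← dualCoaction_mul_comm_iff hT', dualCoaction_piB]
    exact hT _ (otmul_mem (piB_mem ⊤ b) (one_mem _))
  have hv : ∀ s, otmul (vOp H s) 1 * T' = T' * otmul (vOp H s) 1 := fun s => by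
    rw [← dualCoaction_mul_comm_iff hT', dualCoaction_vOp]
    exact hT _ (otmul_mem (vOp_mem (Subgroup.mem_top s)) (vOp_mem (Subgroup.mem_top s)))
  rw [dualCoaction_mul_comm_iff hT']
  refine otmul_one_comm ?_ hx
  rintro _ (⟨b, rfl⟩ | ⟨s, -, rfl⟩)
  · exact ⟨hb b, by rw [star_piB]; exact hb _⟩
  · exact ⟨hv s, by rw [star_vOp]; exact hv _⟩

theorem dualCoaction_apply_vtmul_omega (x : Ell2 Λ H →L[ℂ] Ell2 Λ H) (ξ : H) (η : Ell2 Λ H) :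
    dualCoaction Λ H x (vtmul (delta 1 ξ) η) =
      dualUnitary Λ H (vtmul (x (delta 1 ξ)) η) := by
  have h : dualUnitary Λ H (vtmul (delta 1 ξ) η) = vtmul (delta 1 ξ) η := by
    rw [dualUnitary_apply, vOp_one]
    rfl
  conv_lhs => rw [← h]
  rw [dualCoaction_apply, otmul_vtmul]
  rfl

variable {Ω : H}

/-- The left tensor factors of the two elementary tensors on either side of `Δ(u)` only contribute
a constant: on the right one, `c Ω` is the value at `Ω` of right multiplication by `c`, which
commutes with `Δ(u)`. -/
theorem norm_starProjection_dualCoaction_le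
    (hΩ : IsTraceVector (crossed σ (⊤ : Subgroup Λ)) (delta 1 Ω))
    (Q : VonNeumannAlgebra (Ell2 Λ H)) {a b c d u : Ell2 Λ H →L[ℂ] Ell2 Λ H}
    (hc : c ∈ crossed σ (⊤ : Subgroup Λ)) (hu : u ∈ crossed σ (⊤ : Subgroup Λ)) :
    ‖(L2 (vnTensor (crossed σ (⊤ : Subgroup Λ)) Q)
        (vtmul (delta 1 Ω) (delta 1 Ω))).starProjection
        (otmul a b (dualCoaction Λ H u (otmul c d (vtmul (delta 1 Ω) (delta 1 Ω)))))‖ ≤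
      ‖otmul (H₂ := Ell2 Λ H) (a * rightMul (crossed σ ⊤) (delta 1 Ω) c) 1‖ *
        ‖otmul 1 ((L2 Q (delta 1 Ω)).starProjection * b)
          (dualUnitary Λ H (vtmul (u (delta 1 Ω)) (d (delta 1 Ω))))‖ := by
  refine (norm_starProjection_vnTensor_le _ _ _ _ _).trans ?_
  set r := rightMul (crossed σ ⊤) (delta 1 Ω) c
  have h1 : otmul c d (vtmul (delta 1 Ω) (delta 1 Ω)) =
      otmul r 1 (vtmul (delta 1 Ω) (d (delta 1 Ω))) := by
    rw [otmul_vtmul, otmul_vtmul, rightMul_omega hΩ hc]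
    rfl
  have h2 : dualCoaction Λ H u * otmul r 1 = otmul r 1 * dualCoaction Λ H u :=
    vnTensor_comm (fun x hx y _ => otmul_comm (comm_rightMul hΩ hx hc) (by simp))
      (dualCoaction_mem hu)
  rw [h1, comm_apply h2, dualCoaction_apply_vtmul_omega]
  refine le_trans (le_of_eq (congrArg norm ?_)) (ContinuousLinearMap.le_opNorm _ _)
  simp only [← mul_apply_eq_comp, otmul_mul_otmul, one_mul, mul_one]

end Coaction

/-! ### Unitaries whose images under the dual coaction are small relative to `M ⊗ Q` -/

section Conclusion

open Filter Topology

variable {H : Type*} [NormedAddCommGroup H] [InnerProductSpace ℂ H] [CompleteSpace H]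
  {Λ : Type*} [Group Λ] {B : VonNeumannAlgebra H} {Ω : H}
  {σ : Λ →* (B.toStarSubalgebra ≃⋆ₐ[ℂ] B.toStarSubalgebra)}

/-- If the Fourier coefficients of the unit vector `ξ` almost vanish on `F`, and `‖T vₛ η‖²` is
small for `s ∉ F`, then `(1 ⊗ T) W (ξ ⊗ η)` is small. -/
theorem norm_sq_otmul_dualUnitary_le {F : Set Λ} {ξ η : Ell2 Λ H} {T : Ell2 Λ H →L[ℂ] Ell2 Λ H}
    {δ : ℝ} (hδ : 0 ≤ δ) (hξ : ‖ξ‖ = 1) (hF : ∀ s, s ∉ F → ‖T (vOp H s η)‖ ^ 2 ≤ δ) :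
    ‖otmul 1 T (dualUnitary Λ H (vtmul ξ η))‖ ^ 2 ≤
      δ + (‖T‖ * ‖η‖) ^ 2 * ‖coordProj F ξ‖ ^ 2 := by
  have h1 := (hasSum_norm_sq ξ).mul_left δ
  have h2 := (hasSum_norm_sq (coordProj F ξ)).mul_left ((‖T‖ * ‖η‖) ^ 2)
  refine (hasSum_le (fun s => ?_) (hasSum_norm_sq_otmul_dualUnitary T ξ η) (h1.add h2)).trans_eq
    (by rw [hξ]; ring)
  rw [mul_comm]
  by_cases hs : s ∈ F
  · rw [coordProj_apply, if_pos hs]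
    have h3 : ‖T (vOp H s η)‖ ≤ ‖T‖ * ‖η‖ := by
      simpa [norm_vOp] using T.le_opNorm (vOp H s η)
    have h4 : ‖T (vOp H s η)‖ ^ 2 * ‖ξ s‖ ^ 2 ≤ (‖T‖ * ‖η‖) ^ 2 * ‖ξ s‖ ^ 2 := by gcongr
    have h5 : 0 ≤ δ * ‖ξ s‖ ^ 2 := by positivity
    linarith
  · rw [coordProj_apply, if_neg hs, norm_zero]
    have h4 : ‖T (vOp H s η)‖ ^ 2 * ‖ξ s‖ ^ 2 ≤ δ * ‖ξ s‖ ^ 2 := by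
      gcongr
      exact hF s hs
    simpa using h4

theorem le_sum_sum {ι κ : Type*} {s : Finset ι} {t : Finset κ} {g : ι → κ → ℝ}
    (hg : ∀ i k, 0 ≤ g i k) {i : ι} {k : κ} (hi : i ∈ s) (hk : k ∈ t) :
    g i k ≤ ∑ i ∈ s, ∑ k ∈ t, g i k :=
  (Finset.single_le_sum (f := g i) (fun k _ => hg i k) hk).trans
    (Finset.single_le_sum (f := fun i => ∑ k ∈ t, g i k)
      (fun i _ => Finset.sum_nonneg fun k _ => hg i k) hi)

/-- Suppose that for every finite family `x` in `M = B ⋊ Λ` the sums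
`∑ ‖E_Q(x_i vₛ x_k*)‖₂²` are uniformly small for `s` outside some small set. The unitaries of `P`
whose Fourier coefficients are negligible on that set make `(1 ⊗ e_Q) (1 ⊗ a) Δ(u) (Ω ⊗ b* Ω)`
small for finitely many prescribed `a, b ∈ M`. -/
theorem exists_unitary_norm_dualUnitary_lt (hΩ : IsTraceVector B Ω)
    (hσ : ∀ (s : Λ) (b : B.toStarSubalgebra),
      ⟪Ω, ((σ s b : B.toStarSubalgebra) : H →L[ℂ] H) Ω⟫_ℂ = ⟪Ω, (b : H →L[ℂ] H) Ω⟫_ℂ)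
    {𝒢 : Set (Subgroup Λ)} {P Q : VonNeumannAlgebra (Ell2 Λ H)} (hPM : P ≤ crossed σ ⊤)
    (hP : ∀ S ∈ 𝒢, ¬ Intertwines (crossed σ ⊤) (delta 1 Ω) P.toStarSubalgebra (crossed σ S))
    (hfail : ∀ (n : ℕ) (x : Fin n → (Ell2 Λ H →L[ℂ] Ell2 Λ H)), (∀ i, x i ∈ crossed σ ⊤) →
      ∀ δ : ℝ, 0 < δ → ∃ F : Set Λ, SmallRelativeTo 𝒢 F ∧ ∀ s : Λ, s ∉ F →
        ∑ i, ∑ k, ‖condExp Q (delta 1 Ω) (x i * vOp H s * star (x k))‖ ^ 2 < δ)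
    (X : Finset (crossed σ (⊤ : Subgroup Λ)).toStarSubalgebra) {δ : ℝ} (hδ : 0 < δ) :
    ∃ u ∈ P, star u * u = 1 ∧ u * star u = 1 ∧ ∀ a ∈ X, ∀ b ∈ X,
      ‖otmul 1 ((L2 Q (delta 1 Ω)).starProjection * (a : Ell2 Λ H →L[ℂ] Ell2 Λ H))
        (dualUnitary Λ H (vtmul (u (delta 1 Ω))
          (star (b : Ell2 Λ H →L[ℂ] Ell2 Λ H) (delta 1 Ω))))‖ ^ 2 < δ := by
  obtain ⟨F, hF, hlt⟩ := hfail X.card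
    (fun i => ((X.equivFin.symm i : (crossed σ (⊤ : Subgroup Λ)).toStarSubalgebra) :
      Ell2 Λ H →L[ℂ] Ell2 Λ H)) (fun i => (X.equivFin.symm i).1.2) (δ / 2) (by positivity)
  have hsmall : ∀ a ∈ X, ∀ b ∈ X, ∀ s, s ∉ F →
      ‖((L2 Q (delta 1 Ω)).starProjection * (a : Ell2 Λ H →L[ℂ] Ell2 Λ H))
        (vOp H s (star (b : Ell2 Λ H →L[ℂ] Ell2 Λ H) (delta 1 Ω)))‖ ^ 2 ≤ δ / 2 := by
    intro a ha b hb s hs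
    refine le_trans ?_ (hlt s hs).le
    refine le_trans (le_of_eq ?_) (le_sum_sum (g := fun i k => ‖condExp Q (delta 1 Ω)
      (((X.equivFin.symm i : (crossed σ (⊤ : Subgroup Λ)).toStarSubalgebra) :
        Ell2 Λ H →L[ℂ] Ell2 Λ H) * vOp H s * star
          ((X.equivFin.symm k : (crossed σ (⊤ : Subgroup Λ)).toStarSubalgebra) :
            Ell2 Λ H →L[ℂ] Ell2 Λ H))‖ ^ 2) (fun i k => sq_nonneg _)
      (Finset.mem_univ (X.equivFin ⟨a, ha⟩)) (Finset.mem_univ (X.equivFin ⟨b, hb⟩)))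
    simp only [Equiv.symm_apply_apply]
    rfl
  -- `C` bounds `‖e_Q a vₛ b* Ω‖²` for all `s` and all `a, b ∈ X`.
  obtain ⟨C, hC0, hle⟩ : ∃ C : ℝ, 0 ≤ C ∧ ∀ a ∈ X, ∀ b ∈ X,
      (‖(L2 Q (delta 1 Ω)).starProjection * (a : Ell2 Λ H →L[ℂ] Ell2 Λ H)‖ *
        ‖star (b : Ell2 Λ H →L[ℂ] Ell2 Λ H) (delta 1 Ω)‖) ^ 2 ≤ C :=
    ⟨_, Finset.sum_nonneg fun _ _ => Finset.sum_nonneg fun _ _ => sq_nonneg _,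
      fun a ha b hb => le_sum_sum
        (g := fun a b : (crossed σ (⊤ : Subgroup Λ)).toStarSubalgebra =>
          (‖(L2 Q (delta 1 Ω)).starProjection * (a : Ell2 Λ H →L[ℂ] Ell2 Λ H)‖ *
            ‖star (b : Ell2 Λ H →L[ℂ] Ell2 Λ H) (delta 1 Ω)‖) ^ 2)
        (fun _ _ => sq_nonneg _) ha hb⟩
  obtain ⟨u, hu, hu1, hu2, hlt⟩ := exists_unitary_coordProj_lt hΩ hσ hPM hP hF
    (ε := δ / 2 / (C + 1)) (by positivity)
  refine ⟨u, hu, hu1, hu2, fun a ha b hb => ?_⟩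
  have hnorm : ‖u (delta 1 Ω)‖ = 1 := by
    have h1 : ⟪u (delta 1 Ω), u (delta 1 Ω)⟫_ℂ = ⟪(delta 1 Ω : Ell2 Λ H), delta 1 Ω⟫_ℂ := by
      rw [← inner_star_right, ← mul_apply_eq_comp, hu1]
      rfl
    rw [inner_self_eq_norm_sq_to_K, inner_self_eq_norm_sq_to_K, (delta 1).norm_map,
      hΩ.norm_eq_one] at h1
    have h2 : ‖u (delta 1 Ω)‖ ^ 2 = 1 ^ 2 := by exact_mod_cast h1
    exact (sq_eq_sq₀ (norm_nonneg _) zero_le_one).1 h2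
  refine (norm_sq_otmul_dualUnitary_le (by positivity) hnorm (hsmall a ha b hb)).trans_lt ?_
  rw [lt_div_iff₀ (by positivity)] at hlt
  nlinarith [mul_le_mul_of_nonneg_right (hle a ha b hb) (sq_nonneg ‖coordProj F (u (delta 1 Ω))‖),
    sq_nonneg ‖coordProj F (u (delta 1 Ω))‖]

end Conclusion

end TransferRigidity

end

open TransferRigidity in
theorem theorem3p1 {H : Type*} [NormedAddCommGroup H] [InnerProductSpace ℂ H] [CompleteSpace H]
    -- a tracial von Neumann algebra `B`, acting on `H = L²(B)`, with trace vector `Ω`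
    (B : VonNeumannAlgebra H) (Ω : H) (hΩ : IsTraceVector B Ω)
    -- a trace preserving action `σ` of `Λ` on `B`
    {Λ : Type*} [Group Λ] (σ : Λ →* (B.toStarSubalgebra ≃⋆ₐ[ℂ] B.toStarSubalgebra))
    (hσ : ∀ (s : Λ) (b : B.toStarSubalgebra),
      inner ℂ Ω (((σ s b : B.toStarSubalgebra) : H →L[ℂ] H) Ω) = inner ℂ Ω ((b : H →L[ℂ] H) Ω))
    (M : VonNeumannAlgebra (Ell2 Λ H)) (hM : M = crossed σ ⊤)
    (𝒢 : Set (Subgroup Λ))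
    (P Q : VonNeumannAlgebra (Ell2 Λ H)) (hPM : P ≤ M) (hQM : Q ≤ M)
    (hPQ : Intertwines (vnTensor M M) (vtmul (delta 1 Ω) (delta 1 Ω))
      (P.toStarSubalgebra.map (dualCoaction Λ H)) (vnTensor M Q))
    (hP : ∀ S ∈ 𝒢, ¬ Intertwines M (delta 1 Ω) P.toStarSubalgebra (crossed σ S)) :
    ∃ (n : ℕ) (x : Fin n → (Ell2 Λ H →L[ℂ] Ell2 Λ H)), (∀ i, x i ∈ M) ∧ ∃ δ : ℝ, 0 < δ ∧
      ∀ F : Set Λ, SmallRelativeTo 𝒢 F → ∃ s : Λ, s ∉ F ∧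
        δ ≤ ∑ i, ∑ k, ‖condExp Q (delta 1 Ω) (x i * vOp H s * star (x k))‖ ^ 2 := by
  classical
  subst hM
  by_contra! hfail
  have hΩ' : IsTraceVector (crossed σ (⊤ : Subgroup Λ)) (delta 1 Ω) := hΩ.crossed hσ
  choose u hu hu1 hu2 hlt using fun i : Finset (crossed σ (⊤ : Subgroup Λ)).toStarSubalgebra × ℕ =>
    exists_unitary_norm_dualUnitary_lt hΩ hσ hPM hP hfail i.1
      (δ := 1 / ((i.2 : ℝ) + 1)) (by positivity)
  -- The unitaries `Δ(u i)` of `Δ(P)` contradict `Δ(P) ≺ M ⊗ Q`.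
  refine hPQ.not_tendsto_zero (hΩ'.vnTensor hΩ') (l := Filter.atTop)
    (u := fun i => dualCoaction Λ H (u i)) (D := {T | ∃ x ∈ crossed σ (⊤ : Subgroup Λ),
      ∃ y ∈ crossed σ (⊤ : Subgroup Λ), T = otmul x y}) ?_ (vnTensor_mono hQM)
    (fun i => ⟨u i, hu i, rfl⟩) (fun i => by rw [← map_star, ← map_mul, hu1, map_one])
    (fun i => by rw [← map_star, ← map_mul, hu2, map_one]) ?_ (dense_span_otmul hΩ' hΩ') ?_
  · rintro _ ⟨x, hx, rfl⟩
    exact dualCoaction_mem (hPM hx)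
  · rintro _ ⟨x, hx, y, hy, rfl⟩
    exact otmul_mem hx hy
  · rintro _ ⟨a, ha, b, hb, rfl⟩ _ ⟨c, hc, d, hd, rfl⟩
    simp only [star_otmul]
    refine squeeze_zero_norm (fun i =>
      norm_starProjection_dualCoaction_le hΩ' Q hc (hPM (hu i))) ?_
    suffices h : Filter.Tendsto (fun i =>
        ‖otmul 1 ((L2 Q (delta 1 Ω)).starProjection * star b)
          (dualUnitary Λ H (vtmul (u i (delta 1 Ω)) (d (delta 1 Ω))))‖ ^ 2)
        Filter.atTop (nhds 0) by
      have h' := h.sqrt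
      simp only [Real.sqrt_sq (norm_nonneg _), Real.sqrt_zero] at h'
      simpa using h'.const_mul _
    have h1 : Filter.Tendsto (fun i : Finset (crossed σ (⊤ : Subgroup Λ)).toStarSubalgebra × ℕ =>
        1 / ((i.2 : ℝ) + 1)) Filter.atTop (nhds 0) := by
      rw [← Filter.prod_atTop_atTop_eq]
      exact tendsto_one_div_add_atTop_nhds_zero_nat.comp Filter.tendsto_snd
    refine squeeze_zero' (Filter.Eventually.of_forall fun i => sq_nonneg _) ?_ h1
    filter_upwards [Filter.eventually_ge_atTop
      (({⟨star b, star_mem hb⟩, ⟨star d, star_mem hd⟩}, 0) :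
        Finset (crossed σ (⊤ : Subgroup Λ)).toStarSubalgebra × ℕ)] with i hi
    have h2 := hlt i ⟨star b, star_mem hb⟩ (hi.1 (by simp)) ⟨star d, star_mem hd⟩
      (hi.1 (by simp))
    rw [star_star] at h2
    exact h2.le
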